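/- All graphs are finite, simple and nonempty; $e(G)$ is the number of edges of $G$. A $(1 \bmod 3)$-cycle is a cycle whose length is congruent to $1$ modulo $3$. A block of $G$ is a maximal connected subgraph that has no cut-vertex. Let $n\ge 1$ and write $n-1=9q+r$ with integers $q\ge 0$ and $0\le r\le 8$. (1) If $G$ is an $n$-vertex graph with $e(G)>15q+\lfloor 3r/2\rfloor$, then $G$ contains a $(1\bmod 3)$-cycle. (2) Write $r=2q'+r'$ with integers $q'\ge 0$ and $0\le r'\le 1$. There is a connected $n$-vertex graph that consists of exactly $q$ blocks isomorphic to the Petersen graph, $q'$ blocks isomorphic to triangles and $r'$ blocks isomorphic to $K_2$ (for $n=1$ this means $K_1$). Every such graph $G$ contains no $(1\bmod 3)$-cycle and has $e(G)=15q+\lfloor 3r/2\rfloor$. (3) Consequently the maximum number $ex(n,\mathcal C_{1\bmod 3})$ of edges in an $n$-vertex graph without $(1\bmod 3)$-cycles is exactly $15q+\lfloor 3r/2\rfloor$. (4) The least real constant $c_{1,3}$ such that, for all $n\ge 1$, every $n$-vertex graph with at least $c_{1,3}\cdot n$ edges contains a $(1\bmod 3)$-cycle is $c_{1,3}=\frac53$.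 -/

import Mathlib

namespace CycleMod

/-- `G` contains an `(ℓ mod k)`-cycle, i.e. a cycle whose length is congruent to `ℓ` modulo `k`. -/
def HasCycleMod {V : Type*} (G : SimpleGraph V) (l k : ℕ) : Prop :=
  ∃ (v : V) (c : G.Walk v v), c.IsCycle ∧ c.length ≡ l [MOD k]

/-- The possible numbers of edges of graphs on `n` vertices without `(ℓ mod k)`-cycles; the
greatest element of this set is the extremal number `ex(n, C_{ℓ mod k})`. -/
def edgeCountsAvoiding (n l k : ℕ) : Set ℕ :=
  {m | ∃ G : SimpleGraph (Fin n), ¬ HasCycleMod G l k ∧ G.edgeSet.ncard = m}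

/-- The constants `c` such that every (nonempty) `n`-vertex graph with at least `c * n` edges
contains an `(ℓ mod k)`-cycle; the least element of this set is `c_{ℓ,k}`. -/
def forcingConstants (l k : ℕ) : Set ℝ :=
  {c | ∀ n : ℕ, 1 ≤ n → ∀ G : SimpleGraph (Fin n),
    c * (n : ℝ) ≤ (G.edgeSet.ncard : ℝ) → HasCycleMod G l k}

/-- One orientation of the adjacency of the Petersen graph: an outer 5-cycle, an inner pentagram,
and five spokes. -/
def petersenRel : Fin 5 ⊕ Fin 5 → Fin 5 ⊕ Fin 5 → Prop
  | .inl i, .inl j => j = i + 1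
  | .inr i, .inr j => j = i + 2
  | .inl i, .inr j => i = j
  | .inr _, .inl _ => False

/-- The Petersen graph. -/
def petersenGraph : SimpleGraph (Fin 5 ⊕ Fin 5) := SimpleGraph.fromRel petersenRel

/-- A subgraph that is connected and has no cut-vertex. -/
def ConnectedNoCutVertex {V : Type*} {G : SimpleGraph V} (H : G.Subgraph) : Prop :=
  H.Connected ∧ ∀ v ∈ H.verts, (H.deleteVerts {v}).Preconnected

/-- A block of `G`: a maximal connected subgraph without a cut-vertex (of itself). -/
def IsBlock {V : Type*} {G : SimpleGraph V} (B : G.Subgraph) : Prop :=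
  Maximal ConnectedNoCutVertex B

/-- The set of blocks of `G` that are isomorphic to the graph `F`. -/
def blocksIso {V W : Type*} (G : SimpleGraph V) (F : SimpleGraph W) : Set G.Subgraph :=
  {B | IsBlock B ∧ Nonempty (B.coe ≃g F)}

/-- `G` is a connected graph consisting of exactly `q` blocks isomorphic to the Petersen graph,
`t` blocks isomorphic to triangles and `s` blocks isomorphic to `K₂`. (In a connected graph a block
with a single vertex occurs only if the whole graph is `K₁`, which is the case `q = t = s = 0`.) -/
structure IsPetersenTriangleEdgeGraph {V : Type*} (G : SimpleGraph V) (q t s : ℕ) : Prop where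
  connected : G.Connected
  block_cases : ∀ B : G.Subgraph, IsBlock B → B.verts.Nontrivial →
    B ∈ blocksIso G petersenGraph ∨ B ∈ blocksIso G (⊤ : SimpleGraph (Fin 3)) ∨
      B ∈ blocksIso G (⊤ : SimpleGraph (Fin 2))
  card_petersen : (blocksIso G petersenGraph).encard = q
  card_triangle : (blocksIso G (⊤ : SimpleGraph (Fin 3))).encard = t
  card_edge : (blocksIso G (⊤ : SimpleGraph (Fin 2))).encard = s

end CycleMod

/-!
Call a graph *free* if it has no cycle of length `1` modulo `3`. The upper bound
`e ≤ 15 q + ⌊3 r / 2⌋` is proved by induction; the tool that makes the induction work is the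
operation `triGlue`. Given a free graph `G`, a set `A` of vertices and a colouring, with three
colours, of the roots (the vertices outside `A` having neighbours in `A`), keep the graph induced on
`A`, identify all roots of the same colour, forget the rest and join the three resulting vertices to
a triangle. An *ear* is a path through `A` between two different roots. If no ear between roots of
the same colour has length `1` modulo `3`, and all ears between roots of different colours have
length `1` modulo `3`, then every excursion of a cycle into `A` can be traded for an edge of the
triangle without changing the length modulo `3`, so the new graph is again free
(`triGlue_not_hasCycle`). Usually the roots belong to a copy in `G` of a fixed small graph `K`; the
paths in `K` then forbid all ears but those with the right length, because an ear and a path in `K`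
with the same ends form a cycle. This is a finite check (`earTable`).

*Graphs without a Petersen graph minus an edge* (`PFree`) satisfy `2 e ≤ 3 (n - 1)`
(`Sparse.card_edges_le`). In a minimal counterexample `n` is even and `2 e = 3 n - 2`, and every
nonempty set `X ≠ V` meets more than `3 |X| / 2` edges. As long as the ears between roots of the
same colour all have length `0`, or all have length `2`, modulo `3`, gluing creates no Petersen
graph minus an edge (`triGlue_pFree`). Three reductions then give a contradiction.
* There is no copy of a Petersen graph minus an edge in which another edge is replaced by a path of
  length four (`p4Free`): `n` is even and such a copy has thirteen vertices, so vertices remain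
  outside it, and gluing along the copy shows that they meet too few edges.
* Since the degrees sum to `3 n - 2`, discharging yields a vertex of degree `d ≥ 3` with more than
  `2 d - 6` neighbours of degree two (`exists_low`). Deleting it with these neighbours, or in
  addition joining or identifying two vertices around them, shows that `d = 3` and that there is
  exactly one such neighbour (`low_eq`).
* The surroundings of this vertex are determined first up to seven vertices and then up to nine,
  where they form the Petersen graph minus a vertex; gluing along them contradicts minimality
  (`not_lowPair`).

*In general*, the bound `2 e ≤ 3 (n - 1) + 3 p` with `9 p + 2 τ ≤ n - 1`, where `τ` is the number of
triangles, holds for some `p` (`exists_card_edges_le`). This is the statement above with `p = 0` if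
the graph is `PFree`, since triangles of a free graph are edge-disjoint. Otherwise glue along a copy
of the Petersen graph minus an edge, coloured properly with three colours: ten vertices with at
most fifteen edges are replaced by a triangle, and `p` and `τ` account for the difference. The
bound in terms of `q` and `r` follows, as `p ≤ q`.

For sharpness, every cycle lies inside a single block, the Petersen graph has no cycle of length
`4`, `7` or `10`, and every edge lies in exactly one nontrivial block, which gives the number of
edges. A graph with the prescribed blocks arises by gluing all of them together at one common vertex
(`exists_petersenTriangleEdgeGraph`). The constant `5 / 3` is the limit of
`15 q / (9 q + 1)`.
-/

namespace CycleMod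

open SimpleGraph

universe u

/-! ### Cycles from paths -/

theorem HasCycleMod.mono {V : Type*} {G H : SimpleGraph V} (h : G ≤ H) {l k : ℕ}
    (hG : HasCycleMod G l k) : HasCycleMod H l k := by
  obtain ⟨v, c, hc, hl⟩ := hG
  exact ⟨v, c.mapLe h, hc.mapLe h, by simpa using hl⟩

theorem isPath_append {V : Type*} {G : SimpleGraph V} {x y z : V} {p : G.Walk x y}
    {q : G.Walk y z} (hp : p.IsPath) (hq : q.IsPath)
    (h : ∀ w, w ∈ p.support → w ∈ q.support → w = y) : (p.append q).IsPath := by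
  induction p with
  | nil => simpa using hq
  | cons e p ih =>
    rw [Walk.cons_isPath_iff] at hp
    rw [Walk.cons_append, Walk.cons_isPath_iff]
    refine ⟨ih hp.1 hq fun w hw hw' => h w (by simp [hw]) hw', ?_⟩
    rw [Walk.mem_support_append_iff]
    rintro (h1 | h1)
    · exact hp.2 h1
    · have := h _ (by simp) h1
      subst this
      exact hp.2 (Walk.end_mem_support _)

/-- Two internally disjoint paths with the same ends form a cycle, unless both are the same edge;
in that case the lengths sum to `2`, so the conclusion needs no exception. -/
theorem hasCycle_of_paths {V : Type*} {G : SimpleGraph V} {x y : V} (hxy : x ≠ y)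
    {p q : G.Walk x y} (hp : p.IsPath) (hq : q.IsPath)
    (disj : ∀ z, z ∈ p.support → z ∈ q.support → z = x ∨ z = y)
    (h : (p.length + q.length) % 3 = 1) : HasCycleMod G 1 3 := by
  cases p with
  | nil => exact absurd rfl hxy
  | @cons _ u _ e p =>
  rw [Walk.cons_isPath_iff] at hp
  have hpath : (p.append q.reverse).IsPath := by
    refine isPath_append hp.1 hq.reverse fun w hw hw' => ?_
    rcases disj w (by simp [hw]) (by simpa using hw') with rfl | rfl
    · exact absurd hw hp.2
    · rfl
  refine ⟨x, Walk.cons e (p.append q.reverse), ?_, ?_⟩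
  · rw [Walk.cons_isCycle_iff]
    refine ⟨hpath, fun he => ?_⟩
    rw [Walk.edges_append, List.mem_append] at he
    rcases he with he | he
    · exact hp.2 (Walk.fst_mem_support_of_mem_edges _ he)
    · rw [Walk.edges_reverse, List.mem_reverse] at he
      have hu : u = y := by
        rcases disj u (by simp) (Walk.snd_mem_support_of_mem_edges _ he) with h1 | h1
        · subst h1; exact absurd rfl e.ne
        · exact h1
      subst hu
      have h0 : p.length = 0 := by
        cases p with
        | nil => rfl
        | cons e' p' =>
          have := hp.1
          rw [Walk.cons_isPath_iff] at this
          exact absurd (Walk.end_mem_support _) this.2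
      cases q with
      | nil => exact hxy rfl
      | @cons _ u' _ e' q' =>
        rw [Walk.cons_isPath_iff] at hq
        rw [Walk.edges_cons, List.mem_cons] at he
        rcases he with he | he
        · have : u' = u := by
            rcases Sym2.eq_iff.1 he with ⟨_, h2⟩ | ⟨h1, _⟩
            · exact h2.symm
            · exact absurd h1 e'.ne
          subst this
          cases q' with
          | nil => simp [h0] at h
          | cons e'' q'' =>
            have := hq.1
            rw [Walk.cons_isPath_iff] at this
            exact absurd (Walk.end_mem_support _) this.2
        · exact hq.2 (Walk.fst_mem_support_of_mem_edges _ he)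
  · simp only [Walk.length_cons, Walk.length_append, Walk.length_reverse] at h ⊢
    show _ % 3 = 1 % 3
    omega

/-- A cycle is an edge `xy` together with a path from `y` back to `x`. -/
theorem exists_path_of_isCycle {V : Type*} {G : SimpleGraph V} {x : V} {c : G.Walk x x}
    (hc : c.IsCycle) : ∃ (y : V) (_ : G.Adj x y) (p : G.Walk y x), p.IsPath ∧
      p.length + 1 = c.length ∧ 2 ≤ p.length ∧ ∀ z, z ∈ p.support ↔ z ∈ c.support := by
  cases c with
  | nil => exact (Walk.not_isCycle_nil hc).elim
  | @cons _ y _ e p =>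
    refine ⟨y, e, p, ?_, rfl, ?_, fun z => ?_⟩
    · exact ((Walk.cons_isCycle_iff _ _).1 hc).1
    · have := hc.three_le_length
      simp at this; omega
    · simp only [Walk.support_cons, List.mem_cons]
      exact ⟨Or.inr, fun h => h.elim (fun h => by subst h; exact Walk.end_mem_support p) id⟩

/-- `G` has a path of length `l` from `x` to `y` all of whose interior vertices lie in `A`. -/
def PathThrough {V : Type*} (G : SimpleGraph V) (A : Set V) (x y : V) (l : ℕ) : Prop :=
  ∃ p : G.Walk x y, p.IsPath ∧ p.length = l ∧ ∀ z ∈ p.support, z = x ∨ z = y ∨ z ∈ A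

theorem PathThrough.symm {V : Type*} {G : SimpleGraph V} {A : Set V} {x y : V} {l : ℕ}
    (h : PathThrough G A x y l) : PathThrough G A y x l := by
  obtain ⟨p, hp, hl, hs⟩ := h
  refine ⟨p.reverse, hp.reverse, by simpa using hl, fun z hz => ?_⟩
  rcases hs z (by simpa using hz) with h | h | h <;> tauto

theorem PathThrough.mono {V : Type*} {G H : SimpleGraph V} {A B : Set V} {x y : V} {l : ℕ}
    (hGH : G ≤ H) (hAB : A ⊆ B) (h : PathThrough G A x y l) : PathThrough H B x y l := by
  obtain ⟨p, hp, hl, hs⟩ := h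
  refine ⟨p.mapLe hGH, hp.mapLe hGH, by simpa using hl, fun z hz => ?_⟩
  rcases hs z (by simpa using hz) with h | h | h
  · exact .inl h
  · exact .inr (.inl h)
  · exact .inr (.inr (hAB h))

theorem PathThrough.single {V : Type*} {G : SimpleGraph V} (A : Set V) {x y : V}
    (h : G.Adj x y) : PathThrough G A x y 1 :=
  ⟨h.toWalk, by simp [h.ne], rfl, by simp⟩

theorem PathThrough.cons {V : Type*} {G : SimpleGraph V} {A : Set V} {x y z : V} {l : ℕ}
    (hxy : G.Adj x y) (hyA : y ∈ A) (hxA : x ∉ A) (hxz : x ≠ z)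
    (h : PathThrough G A y z l) : PathThrough G A x z (l + 1) := by
  obtain ⟨p, hp, hl, hs⟩ := h
  refine ⟨Walk.cons hxy p, ?_, by simp [hl], fun w hw => ?_⟩
  · rw [Walk.cons_isPath_iff]
    refine ⟨hp, fun h => ?_⟩
    rcases hs x h with h | h | h
    · exact hxy.ne h
    · exact hxz h
    · exact hxA h
  · rw [Walk.support_cons, List.mem_cons] at hw
    rcases hw with h | h
    · exact .inl h
    · rcases hs w h with h | h | h
      · exact .inr (.inr (h ▸ hyA))
      · exact .inr (.inl h)
      · exact .inr (.inr h)

theorem PathThrough.snoc {V : Type*} {G : SimpleGraph V} {A : Set V} {x y z : V} {l : ℕ}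
    (h : PathThrough G A x y l) (hyz : G.Adj y z) (hyA : y ∈ A) (hzA : z ∉ A) (hxz : x ≠ z) :
    PathThrough G A x z (l + 1) :=
  (h.symm.cons hyz.symm hyA hzA hxz.symm).symm

theorem PathThrough.pos {V : Type*} {G : SimpleGraph V} {A : Set V} {x y : V} {l : ℕ}
    (h : PathThrough G A x y l) (hxy : x ≠ y) : 1 ≤ l := by
  obtain ⟨p, -, rfl, -⟩ := h
  cases p with
  | nil => exact absurd rfl hxy
  | cons e p => simp

/-- Paths through disjoint sets cannot close up to a `(1 mod 3)`-cycle. -/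
theorem PathThrough.add_ne {V : Type*} {G : SimpleGraph V} {A B : Set V} {x y : V} {l l' : ℕ}
    (hG : ¬ HasCycleMod G 1 3) (hxy : x ≠ y) (hAB : Disjoint A B)
    (h : PathThrough G A x y l) (h' : PathThrough G B x y l') : (l + l') % 3 ≠ 1 := by
  obtain ⟨p, hp, rfl, hs⟩ := h
  obtain ⟨q, hq, rfl, hs'⟩ := h'
  intro h
  refine hG (hasCycle_of_paths hxy hp hq (fun z hz hz' => ?_) h)
  rcases hs z hz with h | h | h
  · exact .inl h
  · exact .inr h
  · rcases hs' z hz' with h' | h' | h'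
    · exact .inl h'
    · exact .inr h'
    · exact absurd h' (Set.disjoint_left.1 hAB h)

/-- A path from `a ∈ A` through `A` to a vertex outside `A`, and an edge from that vertex back
to `a`. -/
theorem PathThrough.succ_ne {V : Type*} {G : SimpleGraph V} {A : Set V} {x y : V} {l : ℕ}
    (hG : ¬ HasCycleMod G 1 3) (h : PathThrough G A x y l) (h' : G.Adj y x) :
    (l + 1) % 3 ≠ 1 := 
  h.add_ne hG h'.ne' (B := ∅) (by simp) (PathThrough.single _ h'.symm)

/-! ### Replacing a set of roots by a triangle -/

/-- The adjacency of `triGlue`. -/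
def triGlueAdj {V : Type*} (G : SimpleGraph V) (A : Set V) (col : V → Option (Fin 3)) :
    V ⊕ Fin 3 → V ⊕ Fin 3 → Prop
  | .inl x, .inl y => x ∈ A ∧ y ∈ A ∧ G.Adj x y
  | .inl x, .inr i => x ∈ A ∧ ∃ ρ, col ρ = some i ∧ G.Adj x ρ
  | .inr i, .inl x => x ∈ A ∧ ∃ ρ, col ρ = some i ∧ G.Adj x ρ
  | .inr i, .inr j => i ≠ j

/-- The graph obtained from `G` by keeping the part induced on `A`, identifying the roots
(the vertices on which `col` is defined, meant to lie outside `A`) of each colour to one vertex,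
and joining the three resulting vertices to a triangle. -/
def triGlue {V : Type*} (G : SimpleGraph V) (A : Set V) (col : V → Option (Fin 3)) :
    SimpleGraph (V ⊕ Fin 3) where
  Adj := triGlueAdj G A col
  symm := ⟨by
    rintro (x | i) (y | j) h
    · exact ⟨h.2.1, h.1, h.2.2.symm⟩
    · exact h
    · exact h
    · exact h.symm⟩
  loopless := ⟨by
    rintro (x | i) h
    · exact h.2.2.ne rfl
    · exact h rfl⟩

/-- The condition on ears (paths through `A` of length at least two between different roots) under
which `triGlue` creates no `(1 mod 3)`-cycle. -/
structure EarCond {V : Type*} (G : SimpleGraph V) (A : Set V) (col : V → Option (Fin 3)) :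
    Prop where
  root_notMem : ∀ ρ i, col ρ = some i → ρ ∉ A
  same : ∀ ρ ρ' i n, ρ ≠ ρ' → col ρ = some i → col ρ' = some i → 2 ≤ n →
    PathThrough G A ρ ρ' n → n % 3 ≠ 1
  diff : ∀ ρ ρ' i j n, i ≠ j → col ρ = some i → col ρ' = some j → 2 ≤ n →
    PathThrough G A ρ ρ' n → n % 3 = 1

/-- The number of triangle vertices on a walk in `triGlue`. -/
def triCount {V : Type*} (l : List (V ⊕ Fin 3)) : ℕ := l.countP (·.isRight)

/-- A path in `triGlue` ending in the triangle has, modulo `3`, the length that it would have if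
all its excursions into `A` had length `1`, apart from the initial one, which lifts to `G`. -/
theorem triGlue_path_length {V : Type*} {G : SimpleGraph V} {A : Set V}
    {col : V → Option (Fin 3)} (hE : EarCond G A col) (x z : V ⊕ Fin 3)
    (p : (triGlue G A col).Walk x z) (hp : p.IsPath) (j : Fin 3) (hz : z = .inr j) :
    (∀ i, x = .inr i → (p.length + 1) % 3 = triCount p.support % 3) ∧
    (∀ a, x = .inl a → ∃ k ρ, col ρ = some k ∧ .inr k ∈ p.support ∧
      (k = j → triCount p.support = 1) ∧ ∃ q : G.Walk a ρ, q.IsPath ∧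
      (∀ w ∈ q.support, w = ρ ∨ (w ∈ A ∧ .inl w ∈ p.support)) ∧
      (p.length + 1) % 3 = (q.length + triCount p.support) % 3) := by
  induction p with
  | nil =>
    subst hz
    exact ⟨fun _ _ => (by simp [triCount]), fun a h => by cases h⟩
  | @cons x y z e p ih =>
    rw [Walk.cons_isPath_iff] at hp
    obtain ⟨ih1, ih2⟩ := ih hp.1 hz
    have hcount : triCount (Walk.cons e p).support =
        triCount p.support + if x.isRight then 1 else 0 := by
      simp [triCount, List.countP_cons]
    rw [hcount, Walk.length_cons]
    rcases x with x | i <;> rcases y with y | i'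
    · refine ⟨fun i h => (by cases h), fun a h => ?_⟩
      obtain rfl : x = a := by simpa using h
      obtain ⟨k, ρ, hρ, hk, hkj, q, hq, hqs, hlen⟩ := ih2 y rfl
      have hx : x ∉ q.support := fun h => by
        rcases hqs x h with h | h
        · exact hE.root_notMem _ _ hρ (h ▸ e.1)
        · exact hp.2 h.2
      refine ⟨k, ρ, hρ, by simp [hk], by simpa using hkj, Walk.cons e.2.2 q, ?_, ?_, ?_⟩
      · exact (Walk.cons_isPath_iff _ _).2 ⟨hq, hx⟩
      · intro w hw
        rw [Walk.support_cons, List.mem_cons] at hw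
        rcases hw with rfl | hw
        · exact .inr ⟨e.1, by simp⟩
        · rcases hqs w hw with h | h
          · exact .inl h
          · exact .inr ⟨h.1, by simp [h.2]⟩
      · simp at hlen ⊢; omega
    · refine ⟨fun i h => (by cases h), fun a h => ?_⟩
      obtain rfl : x = a := by simpa using h
      have e' := e
      obtain ⟨hxA, ρ, hρ, hadj⟩ := e'
      refine ⟨i', ρ, hρ, by simp, ?_, hadj.toWalk, by simp [hadj.ne], ?_, ?_⟩
      · rintro rfl
        subst hz
        cases p with
        | nil => simp [triCount]
        | cons e' p' =>
          have := hp.1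
          rw [Walk.cons_isPath_iff] at this
          exact absurd (Walk.end_mem_support _) this.2
      · intro w hw
        simp at hw
        rcases hw with rfl | rfl
        · exact .inr ⟨hxA, by simp⟩
        · exact .inl rfl
      · have := ih1 i' rfl
        simp; omega
    · refine ⟨fun i' h => ?_, fun a h => by cases h⟩
      obtain ⟨k, ρ, hρ, hk, hkj, q, hq, hqs, hlen⟩ := ih2 y rfl
      obtain ⟨hyA, ρ', hρ', hadj⟩ := e
      have hik : i ≠ k := fun h => hp.2 (h ▸ hk)
      have hpt : PathThrough G A y ρ q.length :=
        ⟨q, hq, rfl, fun z hz => by rcases hqs z hz with h | h <;> tauto⟩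
      have hne : ρ' ≠ ρ := fun h => hik (by rw [h, hρ] at hρ'; simpa using hρ'.symm)
      have := hpt.pos fun h => hE.root_notMem _ _ hρ (h ▸ hyA)
      have := hE.diff ρ' ρ i k (q.length + 1) hik hρ' hρ (by omega)
        (hpt.cons hadj.symm hyA (hE.root_notMem _ _ hρ') hne)
      simp; omega
    · refine ⟨fun _ h => ?_, fun a h => by cases h⟩
      have := ih1 i' rfl
      simp; omega

/-- A path in `triGlue` avoiding the triangle is a path of `G` inside `A`. -/
theorem triGlue_path_avoid {V : Type*} {G : SimpleGraph V} {A : Set V}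
    {col : V → Option (Fin 3)} (x z : V ⊕ Fin 3)
    (p : (triGlue G A col).Walk x z) (hp : p.IsPath) (hav : ∀ i, .inr i ∉ p.support) (a b : V)
    (ha : x = .inl a) (hb : z = .inl b) :
    ∃ q : G.Walk a b, q.IsPath ∧ q.length = p.length ∧
      ∀ w ∈ q.support, .inl w ∈ p.support := by
  induction p generalizing a with
  | nil =>
    subst ha
    obtain rfl : a = b := by simpa using hb
    exact ⟨Walk.nil, by simp, rfl, by simp⟩
  | @cons x y z e p ih =>
    rw [Walk.cons_isPath_iff] at hp
    subst ha
    rcases y with y | i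
    · obtain ⟨q, hq, hl, hs⟩ := ih hp.1 (fun i h => hav i (by simp [h])) y rfl hb
      refine ⟨Walk.cons e.2.2 q, ?_, by simp [hl], ?_⟩
      · exact (Walk.cons_isPath_iff _ _).2 ⟨hq, fun h => hp.2 (hs _ h)⟩
      · intro w hw
        rw [Walk.support_cons, List.mem_cons] at hw
        rcases hw with rfl | hw
        · simp
        · simp [hs w hw]
    · exact absurd (by simp) (hav i)

theorem triCount_le {V : Type*} {l : List (V ⊕ Fin 3)} (h : l.Nodup) (s : Finset (Fin 3))
    (hs : ∀ i, .inr i ∈ l → i ∈ s) : triCount l ≤ s.card := by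
  unfold triCount
  rw [List.countP_eq_length_filter]
  have hn := h.filter (fun x => x.isRight)
  classical
  have h1 : ((l.filter (·.isRight)).toFinset) ⊆ s.map ⟨Sum.inr, Sum.inr_injective⟩ := by
    intro x hx
    simp only [List.mem_toFinset, List.mem_filter] at hx
    rcases x with x | x
    · simp at hx
    · simpa using hs x hx.1
  have := Finset.card_le_card h1
  rwa [List.toFinset_card_of_nodup hn, Finset.card_map] at this

theorem two_le_triCount {V : Type*} {l : List (V ⊕ Fin 3)} {i j : Fin 3} (hij : i ≠ j)
    (h : .inr i ∈ l) (h' : .inr j ∈ l) : 2 ≤ triCount l := by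
  unfold triCount
  rw [List.countP_eq_length_filter]
  by_contra hlt
  have : (l.filter (·.isRight)).length ≤ 1 := by omega
  have hi : (.inr i : V ⊕ Fin 3) ∈ l.filter (·.isRight) := by simp [h]
  have hj : (.inr j : V ⊕ Fin 3) ∈ l.filter (·.isRight) := by simp [h']
  rcases hl : l.filter (·.isRight) with _ | ⟨a, _ | ⟨b, t⟩⟩
  · simp [hl] at hi
  · rw [hl, List.mem_singleton] at hi hj
    exact hij (by simpa using hi.trans hj.symm)
  · simp [hl] at this

theorem triGlue_not_hasCycle {V : Type*} {G : SimpleGraph V} {A : Set V}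
    {col : V → Option (Fin 3)} (hG : ¬ HasCycleMod G 1 3) (hE : EarCond G A col) :
    ¬ HasCycleMod (triGlue G A col) 1 3 := by
  classical
  rintro ⟨x, c, hc, hl⟩
  replace hl : c.length % 3 = 1 := hl
  by_cases h : ∃ i : Fin 3, (.inr i : V ⊕ Fin 3) ∈ c.support
  · obtain ⟨i, hi⟩ := h
    have hc' := hc.rotate hi
    have hl' : (c.rotate _ hi).length % 3 = 1 := by
      rw [Walk.length_rotate]; exact hl
    obtain ⟨y, e, p, hp, hpl, hp2, hps⟩ := exists_path_of_isCycle hc'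
    rw [← hpl] at hl'
    obtain ⟨h1, h2⟩ := triGlue_path_length hE _ _ p hp i rfl
    have hle : _ ≤ 3 := triCount_le hp.support_nodup Finset.univ (by simp)
    rcases y with y | j
    -- the cycle leaves the triangle at `i` along the ear from `ρ'` to `ρ`
    · obtain ⟨k, ρ, hρ, hk, hki, q, hq, hqs, hlen⟩ := h2 y rfl
      obtain ⟨hyA, ρ', hρ', hadj⟩ := e
      have hpt : PathThrough G A y ρ q.length :=
        ⟨q, hq, rfl, fun z hz => by rcases hqs z hz with h | h <;> tauto⟩
      have hpos := hpt.pos fun h => hE.root_notMem _ _ hρ (h ▸ hyA)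
      by_cases hik : k = i
      · have hcnt := hki hik
        subst hik
        by_cases hρρ : ρ' = ρ
        · subst hρρ
          have := hpt.succ_ne hG hadj.symm
          omega
        · have := hE.same ρ' ρ k _ hρρ hρ' hρ (by omega)
            (hpt.cons hadj.symm hyA (hE.root_notMem _ _ hρ') hρρ)
          omega
      · have hne : ρ' ≠ ρ := fun h => hik (by rw [h, hρ] at hρ'; simpa using hρ')
        have := hE.diff ρ' ρ i k _ (Ne.symm hik) hρ' hρ (by omega)
          (hpt.cons hadj.symm hyA (hE.root_notMem _ _ hρ') hne)
        have := two_le_triCount (Ne.symm hik) (Walk.end_mem_support p) hk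
        omega
    · have := h1 j rfl
      have h3 : (triGlue G A col).Adj (.inr i) (.inr j) := e
      have hij : i ≠ j := h3
      -- modulo `3` the length is the number of triangle vertices, which is two or three
      have := two_le_triCount hij (Walk.end_mem_support p) (Walk.start_mem_support p)
      omega
  · push Not at h
    rcases x with x | i
    · obtain ⟨y, e, p, hp, hpl, hp2, hps⟩ := exists_path_of_isCycle hc
      rcases y with y | j
      · obtain ⟨q, hq, hql, -⟩ := triGlue_path_avoid _ _ p hp
          (fun i hi => h i ((hps _).1 hi)) y x rfl rfl
        have hpt : PathThrough G Set.univ y x q.length := ⟨q, hq, rfl, by simp⟩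
        have := hpt.succ_ne hG e.2.2
        omega
      · exact h j ((hps _).1 (Walk.start_mem_support p))
    · exact h i (Walk.start_mem_support c)

/-! ### Finite path tables -/

/-- `f` embeds the graph on `{0, …, k - 1}` with neighbour lists `N` into `G`
(not necessarily as an induced subgraph). -/
structure IsCopy {V : Type*} (N : ℕ → List ℕ) (k : ℕ) (G : SimpleGraph V) (f : ℕ → V) :
    Prop where
  inj : ∀ i < k, ∀ j < k, f i = f j → i = j
  adj : ∀ i < k, ∀ j ∈ N i, G.Adj (f i) (f j)

theorem IsCopy.mono {V : Type*} {N : ℕ → List ℕ} {k : ℕ} {G H : SimpleGraph V} {f : ℕ → V}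
    (h : IsCopy N k G f) (hGH : G ≤ H) : IsCopy N k H f :=
  ⟨h.inj, fun i hi j hj => hGH (h.adj i hi j hj)⟩

/-- Depth first search for a path from `a` to `b` of length congruent to `r` modulo `3`, of at most
`fuel` vertices, which avoids the vertices in `vis`. -/
def findPath (N : ℕ → List ℕ) (b : ℕ) : ℕ → List ℕ → ℕ → ℕ → Bool
  | 0, _, _, _ => false
  | fuel + 1, vis, a, r =>
    bif a == b then r == 0
    else (N a).any fun c => !vis.contains c && findPath N b fuel (c :: vis) c ((r + 2) % 3)

theorem PathThrough.of_findPath {V : Type*} {N : ℕ → List ℕ} {k : ℕ} {G : SimpleGraph V}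
    {f : ℕ → V} (hf : IsCopy N k G f) (hN : ∀ i < k, ∀ j ∈ N i, j < k) {b : ℕ} (hb : b < k)
    (fuel : ℕ) (vis : List ℕ) (a r : ℕ) (ha : a < k) (hav : a ∈ vis)
    (h : findPath N b fuel vis a r = true) :
    ∃ l, l % 3 = r % 3 ∧ PathThrough G {x | ∃ c < k, c ∉ vis ∧ x = f c} (f a) (f b) l := by
  induction fuel generalizing vis a r with
  | zero => simp [findPath] at h
  | succ fuel ih =>
    rw [findPath] at h
    by_cases hab : a = b
    · subst hab
      simp at h
      subst h
      exact ⟨0, rfl, Walk.nil, by simp, rfl, by simp⟩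
    · have hab' : (a == b) = false := by simpa using hab
      rw [hab', cond_false, List.any_eq_true] at h
      obtain ⟨c, hc, hcs⟩ := h
      simp only [Bool.and_eq_true, Bool.not_eq_true', List.contains_eq_mem,
        decide_eq_false_iff_not] at hcs
      have hck := hN a ha c hc
      obtain ⟨l, hl, hp⟩ := ih (c :: vis) c _ hck (by simp) hcs.2
      refine ⟨l + 1, by omega, PathThrough.cons (hf.adj a ha c hc) ⟨c, hck, hcs.1, rfl⟩ ?_ ?_
        (hp.mono le_rfl ?_)⟩
      · rintro ⟨c', hc', hc'v, h⟩
        exact hc'v (hf.inj a ha c' hc' h ▸ hav)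
      · exact fun h => hab (hf.inj a ha b hb h)
      · rintro _ ⟨c', hc', hv, rfl⟩
        exact ⟨c', hc', fun h => hv (by simp [h]), rfl⟩

/-- Neighbour lists of the Petersen graph minus the edge `{0, 5}`; the outer cycle is
`0, …, 4`, and `i` is matched to `5 + i`. -/
def pmN : ℕ → List ℕ
  | 0 => [1, 4]
  | 1 => [0, 2, 6]
  | 2 => [1, 3, 7]
  | 3 => [2, 4, 8]
  | 4 => [3, 0, 9]
  | 5 => [7, 8]
  | 6 => [8, 9, 1]
  | 7 => [5, 9, 2]
  | 8 => [6, 5, 3]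
  | 9 => [7, 6, 4]
  | _ => []

/-- `G` has no subgraph isomorphic to the Petersen graph minus an edge. -/
def PFree {V : Type*} (G : SimpleGraph V) : Prop := ∀ f : ℕ → V, ¬ IsCopy pmN 10 G f

theorem PFree.mono {V : Type*} {G H : SimpleGraph V} (h : G ≤ H) (hH : PFree H) : PFree G :=
  fun f hf => hH f (hf.mono h)

theorem pmN_lt : ∀ i < 10, ∀ j ∈ pmN i, j < 10 := by decide

theorem pmN_symm : ∀ i < 10, ∀ j ∈ pmN i, i ∈ pmN j := by decide

theorem pmN_irrefl : ∀ i < 10, i ∉ pmN i := by decide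

theorem exists_mem_pmN (i : ℕ) (hi : i < 10) : ∃ j, j ∈ pmN i :=
  List.exists_mem_of_ne_nil _ ((by decide : ∀ i < 10, pmN i ≠ []) i hi)

theorem pmN_path_pair : ∀ a < 10, ∀ b < 10, a ≠ b →
    findPath pmN b 10 [a] a 0 = true ∨ findPath pmN b 10 [a] a 2 = true := by decide +kernel

theorem pmN_path_triple : ∀ a < 10, ∀ b < 10, ∀ c < 10,
    (a == b || a == c || b == c || findPath pmN b 10 [a, c] a 0 || findPath pmN b 10 [a, c] a 2 ||
    findPath pmN c 10 [a, b] a 0 || findPath pmN c 10 [a, b] a 2 ||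
    findPath pmN c 10 [b, a] b 0 || findPath pmN c 10 [b, a] b 2) = true := by decide +kernel

theorem pmN_path_nbrs : ∀ a < 10, ∀ b ∈ pmN a, ∀ c ∈ pmN a, b ≠ c →
    (findPath pmN c 10 [b, a] b 0 && findPath pmN c 10 [b, a] b 1) = true := by decide +kernel

/-! ### Copies of the Petersen graph minus an edge in a glued graph -/

/-- Two branch vertices of a copy that are sent to the triangle are not joined, outside the other
such branch vertices, by a path of length `0` or `2` modulo `3`. -/
theorem copy_triGlue_pair {V : Type*} {G : SimpleGraph V} {A : Set V}
    {col : V → Option (Fin 3)} (hE : EarCond G A col) {f : ℕ → V ⊕ Fin 3}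
    (hf : IsCopy pmN 10 (triGlue G A col) f) {a b : ℕ} (ha : a < 10) (hb : b < 10) (hab : a ≠ b)
    {i j : Fin 3} (hi : f a = .inr i) (hj : f b = .inr j) {vis : List ℕ} {r : ℕ}
    (hvis : ∀ c < 10, c ∉ a :: vis → c ≠ b → ∀ k, f c ≠ .inr k) (hr : r % 3 ≠ 1) :
    findPath pmN b 10 (a :: vis) a r ≠ true := by
  intro h
  obtain ⟨l, hl, p, hp, hpl, hs⟩ := PathThrough.of_findPath hf pmN_lt hb _ _ _ _ ha (by simp) h
  have hij : i ≠ j := fun h => hab (hf.inj a ha b hb (by rw [hi, hj, h]))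
  have h1 := (triGlue_path_length hE _ _ p hp j hj).1 i hi
  have h2 : 2 ≤ triCount p.support :=
    two_le_triCount hij (hi ▸ Walk.start_mem_support p) (hj ▸ Walk.end_mem_support p)
  have h3 : triCount p.support ≤ ({i, j} : Finset (Fin 3)).card := by
    refine triCount_le hp.support_nodup _ fun k hk => ?_
    rcases hs _ hk with h | h | ⟨c, hc, hcv, h⟩
    · have := h.trans hi; simp_all
    · have := h.trans hj; simp_all
    · by_cases hcb : c = b
      · have := h.trans ((congrArg f hcb).trans hj); simp_all
      · exact absurd h.symm (hvis c hc hcv hcb k)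
  rw [Finset.card_pair hij] at h3
  omega

/-- A copy in a glued graph lies in the old graph, or else exactly one of its branch vertices
is a triangle vertex and no single root can replace it. -/
theorem copy_triGlue {V : Type*} {G : SimpleGraph V} {A : Set V}
    {col : V → Option (Fin 3)} (hE : EarCond G A col) (hP : PFree G) {f : ℕ → V ⊕ Fin 3}
    (hf : IsCopy pmN 10 (triGlue G A col) f) :
    ∃ α < 10, ∃ (i : Fin 3) (g : ℕ → V), f α = .inr i ∧ (∀ β < 10, β ≠ α → f β = .inl (g β)) ∧
      ∀ ρ, col ρ = some i → ∃ β ∈ pmN α, ¬ G.Adj (g β) ρ := by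
  by_cases h0 : ∃ α < 10, ∃ i, f α = .inr i
  swap
  · exfalso
    push Not at h0
    have h1 : ∀ α, ∃ x : V, α < 10 → f α = .inl x := fun α => by
      rcases hx : f α with x | i
      · exact ⟨x, fun _ => rfl⟩
      · rcases hy : f 0 with y | j
        · exact ⟨y, fun hα => absurd hx (h0 α hα i)⟩
        · exact absurd hy (h0 0 (by omega) j)
    choose g hg using h1
    refine hP g ⟨fun i hi j hj h => hf.inj i hi j hj (by rw [hg i hi, hg j hj, h]), ?_⟩
    intro i hi j hj
    have := hf.adj i hi j hj
    rw [hg i hi, hg j (pmN_lt i hi j hj)] at this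
    exact this.2.2
  obtain ⟨α, hα, i, hi⟩ := h0
  -- no other branch vertex lies in the triangle
  have huniq : ∀ β < 10, β ≠ α → ∀ j, f β ≠ .inr j := by
    intro β hβ hβα j hj
    by_cases h3 : ∃ γ < 10, γ ≠ α ∧ γ ≠ β ∧ ∃ k, f γ = .inr k
    · obtain ⟨γ, hγ, hγα, hγβ, k, hk⟩ := h3
      have hij : i ≠ j := fun h => hβα (hf.inj β hβ α hα (by rw [hi, hj, h]))
      have hik : i ≠ k := fun h => hγα (hf.inj γ hγ α hα (by rw [hi, hk, h]))
      have hjk : j ≠ k := fun h => hγβ (hf.inj γ hγ β hβ (by rw [hj, hk, h]))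
      have hall : ∀ c < 10, ∀ m, f c = .inr m → c = α ∨ c = β ∨ c = γ := by
        intro c hc m hm
        have : m = i ∨ m = j ∨ m = k := by omega
        rcases this with rfl | rfl | rfl
        · exact .inl (hf.inj c hc α hα (by rw [hm, hi]))
        · exact .inr (.inl (hf.inj c hc β hβ (by rw [hm, hj])))
        · exact .inr (.inr (hf.inj c hc γ hγ (by rw [hm, hk])))
      have ht := pmN_path_triple α hα β hβ γ hγ
      simp only [Bool.or_eq_true, beq_iff_eq] at ht
      have e1 := fun r => copy_triGlue_pair (r := r) hE hf hα hβ hβα.symm hi hj (vis := [γ])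
        (fun c hc hcv hcb m hm => by have := hall c hc m hm; simp at hcv; tauto)
      have e2 := fun r => copy_triGlue_pair (r := r) hE hf hα hγ hγα.symm hi hk (vis := [β])
        (fun c hc hcv hcb m hm => by have := hall c hc m hm; simp at hcv; tauto)
      have e3 := fun r => copy_triGlue_pair (r := r) hE hf hβ hγ hγβ.symm hj hk (vis := [α])
        (fun c hc hcv hcb m hm => by have := hall c hc m hm; simp at hcv; tauto)
      have := e1 0 (by decide); have := e1 2 (by decide)
      have := e2 0 (by decide); have := e2 2 (by decide)
      have := e3 0 (by decide); have := e3 2 (by decide)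
      tauto
    · push Not at h3
      have e1 := fun r => copy_triGlue_pair (r := r) hE hf hα hβ hβα.symm hi hj (vis := [])
        (fun c hc hcv hcb m hm => h3 c hc (by simpa using hcv) hcb m hm)
      rcases pmN_path_pair α hα β hβ hβα.symm with h | h
      · exact e1 0 (by decide) h
      · exact e1 2 (by decide) h
  have hV : Nonempty V := by
    rcases hx : f (α % 9 + 1) with x | j
    · exact ⟨x⟩
    · by_cases h9 : α % 9 + 1 = α
      · omega
      · exact absurd hx (huniq _ (by omega) h9 j)
  have h1 : ∀ β, ∃ x : V, β < 10 → β ≠ α → f β = .inl x := fun β => by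
    rcases hx : f β with x | j
    · exact ⟨x, fun _ _ => rfl⟩
    · exact ⟨hV.some, fun h h' => absurd hx (huniq β h h' j)⟩
  choose g hg using h1
  refine ⟨α, hα, i, g, hi, hg, fun ρ hρ => ?_⟩
  by_contra! hadj
  -- otherwise `ρ` completes a copy in `G`
  have hA : ∀ β < 10, β ≠ α → g β ∈ A := by
    intro β hβ hne
    obtain ⟨γ, hγ⟩ : ∃ γ, γ ∈ pmN β := exists_mem_pmN β hβ
    have := hf.adj β hβ γ hγ
    rw [hg β hβ hne] at this
    rcases hx : f γ with x | j <;> rw [hx] at this <;> exact this.1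
  refine hP (fun β => if β = α then ρ else g β) ⟨fun a ha b hb h => ?_, fun a ha b hb => ?_⟩
  · by_cases h1 : a = α <;> by_cases h2 : b = α
    · rw [h1, h2]
    · simp only [h1, h2, if_true, if_false] at h
      exact absurd (h ▸ hA b hb h2) (hE.root_notMem _ _ hρ)
    · simp only [h1, h2, if_true, if_false] at h
      exact absurd (h ▸ hA a ha h1) (hE.root_notMem _ _ hρ)
    · simp only [h1, h2, if_false] at h
      exact hf.inj a ha b hb (by rw [hg a ha h1, hg b hb h2, h])
  · have hb' := pmN_lt a ha b hb
    have hab : a ≠ b := fun h => pmN_irrefl a ha (h ▸ hb)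
    by_cases h1 : a = α <;> by_cases h2 : b = α
    · exact absurd (h1.trans h2.symm) hab
    · simp only [h1, h2, if_true, if_false]
      exact (hadj b (h1 ▸ hb)).symm
    · simp only [h1, h2, if_true, if_false]
      exact hadj a (h2 ▸ pmN_symm a ha b hb)
    · simp only [h1, h2, if_false]
      have := hf.adj a ha b hb
      rw [hg a ha h1, hg b hb' h2] at this
      exact this.2.2

/-- If the ears between different roots of the same colour all have length `0`, or all have
length `2`, modulo `3`, then gluing does not create a Petersen graph minus an edge: two neighbours
of a branch vertex are joined, off that vertex, by paths of lengths `0` and `1`. -/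
theorem triGlue_pFree {V : Type*} {G : SimpleGraph V} {A : Set V}
    {col : V → Option (Fin 3)} (hE : EarCond G A col) (hP : PFree G)
    (hE' : ∀ ρ ρ' i, ρ ≠ ρ' → col ρ = some i → col ρ' = some i →
      (∀ n, 2 ≤ n → PathThrough G A ρ ρ' n → n % 3 ≠ 0) ∨
      (∀ n, 2 ≤ n → PathThrough G A ρ ρ' n → n % 3 ≠ 2)) :
    PFree (triGlue G A col) := by
  intro f hf
  obtain ⟨α, hα, i, g, hi, hg, hno⟩ := copy_triGlue hE hP hf
  have hroot : ∀ β ∈ pmN α, g β ∈ A ∧ ∃ ρ, col ρ = some i ∧ G.Adj (g β) ρ := by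
    intro β hβ
    have := hf.adj β (pmN_lt α hα β hβ) α (pmN_symm α hα β hβ)
    rwa [hi, hg β (pmN_lt α hα β hβ) (fun h => pmN_irrefl α hα (h ▸ hβ))] at this
  obtain ⟨β, hβ⟩ : ∃ β, β ∈ pmN α := exists_mem_pmN α hα
  obtain ⟨hβA, ρ, hρ, hβρ⟩ := hroot β hβ
  obtain ⟨γ, hγ, hγρ⟩ := hno ρ hρ
  obtain ⟨hγA, ρ', hρ', hγρ'⟩ := hroot γ hγ
  have hne : ρ ≠ ρ' := fun h => hγρ (h ▸ hγρ')
  have hβγ : β ≠ γ := fun h => hγρ (h ▸ hβρ)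
  have hβα : β ≠ α := fun h => pmN_irrefl α hα (h ▸ hβ)
  have hγα : γ ≠ α := fun h => pmN_irrefl α hα (h ▸ hγ)
  have hβ' := pmN_lt α hα β hβ
  have hγ' := pmN_lt α hα γ hγ
  have key : ∀ r, findPath pmN γ 10 [β, α] β r = true →
      ∃ n, 2 ≤ n ∧ n % 3 = (r + 2) % 3 ∧ PathThrough G A ρ ρ' n := by
    intro r hr
    obtain ⟨l, hl, p, hp, hpl, hs⟩ :=
      PathThrough.of_findPath hf pmN_lt hγ' _ _ _ _ hβ' (by simp) hr
    have hs' : ∀ x ∈ p.support, ∃ c < 10, c ≠ α ∧ x = f c := by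
      intro x hx
      rcases hs x hx with h | h | ⟨c, hc, hcv, h⟩
      · exact ⟨β, hβ', hβα, h⟩
      · exact ⟨γ, hγ', hγα, h⟩
      · exact ⟨c, hc, fun h => hcv (by simp [h]), h⟩
    obtain ⟨q, hq, hql, hqs⟩ := triGlue_path_avoid _ _ p hp (fun j hj => by
      obtain ⟨c, hc, hcα, h⟩ := hs' _ hj
      rw [hg c hc hcα] at h; simp at h) (g β) (g γ) (hg β hβ' hβα) (hg γ hγ' hγα)
    have hpt : PathThrough G A (g β) (g γ) l := by
      refine ⟨q, hq, by omega, fun w hw => ?_⟩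
      by_cases hwβ : w = g β
      · exact .inl hwβ
      · right; right
        obtain ⟨c, hc, hcα, h⟩ := hs' _ (hqs w hw)
        obtain ⟨d, hd⟩ := exists_mem_pmN c hc
        have h3 := hf.adj c hc d hd
        rw [← h] at h3
        rcases hx : f d with x | j <;> rw [hx] at h3 <;> exact h3.1
    refine ⟨l + 2, by omega, by omega, ?_⟩
    exact (hpt.snoc hγρ' hγA (hE.root_notMem _ _ hρ')
      (fun h => hE.root_notMem _ _ hρ' (h ▸ hβA))).cons hβρ.symm hβA
      (hE.root_notMem _ _ hρ) hne
  have ht := pmN_path_nbrs α hα β hβ γ hγ hβγ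
  rw [Bool.and_eq_true] at ht
  obtain ⟨n, hn, hn3, hpn⟩ := key _ ht.1
  obtain ⟨n', hn', hn3', hpn'⟩ := key _ ht.2
  rcases hE' ρ ρ' i hne hρ hρ' with h | h
  · exact h n' hn' hpn' (by omega)
  · exact h n hn hpn (by omega)

/-! ### Counting edges -/

theorem col_eq_none_of_mem {V : Type*} {G : SimpleGraph V} {A : Set V}
    {col : V → Option (Fin 3)} (hE : EarCond G A col) {x : V} (hx : x ∈ A) : col x = none := by
  rcases h : col x with _ | i
  · rfl
  · exact absurd hx (hE.root_notMem _ _ h)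

/-- The map from the vertices of `G` to those of the glued graph: a root goes to its colour. -/
def glueMap {V : Type*} (col : V → Option (Fin 3)) (v : V) : V ⊕ Fin 3 :=
  (col v).elim (.inl v) .inr

/-- Edges of `G` that meet `A` and lie in `A` together with the roots, such that no two of them
join the same vertex of `A` to different roots of the same colour, remain distinct after gluing. -/
theorem triGlue_card {V : Type*} [Finite V] {G : SimpleGraph V} {A : Set V}
    {col : V → Option (Fin 3)} (hE : EarCond G A col) (F : Set (Sym2 V)) (hF : F ⊆ G.edgeSet)
    (hmeet : ∀ e ∈ F, ∃ a b, e = s(a, b) ∧ a ∈ A ∧ (b ∈ A ∨ ∃ i, col b = some i))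
    (hinj : ∀ a ∈ A, ∀ ρ ρ' i, col ρ = some i → col ρ' = some i → s(a, ρ) ∈ F → s(a, ρ') ∈ F →
      ρ = ρ') : F.ncard + 3 ≤ (triGlue G A col).edgeSet.ncard := by
  classical
  let φ : V → V ⊕ Fin 3 := glueMap col
  have hφA : ∀ a ∈ A, φ a = .inl a := fun a ha => by
    simp [φ, glueMap, col_eq_none_of_mem hE ha]
  have hφr : ∀ b i, col b = some i → φ b = .inr i := fun b i h => by simp [φ, glueMap, h]
  have hinjOn : Set.InjOn (Sym2.map φ) F := by
    intro e he e' he' h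
    obtain ⟨a, b, rfl, ha, hb⟩ := hmeet e he
    obtain ⟨a', b', rfl, ha', hb'⟩ := hmeet e' he'
    rw [Sym2.map_mk, Sym2.map_mk, hφA a ha, hφA a' ha'] at h
    rcases hb with hb | ⟨i, hi⟩ <;> rcases hb' with hb' | ⟨j, hj⟩
    · rw [hφA b hb, hφA b' hb'] at h
      simpa using h
    · rw [hφA b hb, hφr b' j hj] at h
      simp at h
    · rw [hφA b' hb', hφr b i hi] at h
      simp at h
    · rw [hφr b' j hj, hφr b i hi] at h
      simp at h
      obtain ⟨rfl, rfl⟩ := h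
      rw [hinj a ha b b' i hi hj he he']
  let T : Set (Sym2 (V ⊕ Fin 3)) := {s(.inr 0, .inr 1), s(.inr 0, .inr 2), s(.inr 1, .inr 2)}
  have hT : T.ncard = 3 := by
    rw [Set.ncard_eq_toFinset_card']
    simp [T]
  have hdisj : Disjoint (Sym2.map φ '' F) T := by
    rw [Set.disjoint_left]
    rintro _ ⟨e, he, rfl⟩ h
    obtain ⟨a, b, rfl, ha, hb⟩ := hmeet e he
    rw [Sym2.map_mk, hφA a ha] at h
    simp [T] at h
  have hsub : Sym2.map φ '' F ∪ T ⊆ (triGlue G A col).edgeSet := by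
    rintro e (⟨e, he, rfl⟩ | he)
    · obtain ⟨a, b, rfl, ha, hb⟩ := hmeet e he
      have hab : G.Adj a b := hF he
      rw [Sym2.map_mk, hφA a ha]
      rcases hb with hb | ⟨i, hi⟩
      · rw [hφA b hb]
        exact ⟨ha, hb, hab⟩
      · rw [hφr b i hi]
        exact ⟨ha, b, hi, hab⟩
    · rcases he with rfl | rfl | rfl
      · exact (by decide : (0 : Fin 3) ≠ 1)
      · exact (by decide : (0 : Fin 3) ≠ 2)
      · exact (by decide : (1 : Fin 3) ≠ 2)
  calc F.ncard + 3 = (Sym2.map φ '' F ∪ T).ncard := by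
        rw [Set.ncard_union_eq hdisj, hinjOn.ncard_image, hT]
    _ ≤ _ := Set.ncard_le_ncard hsub

/-- The graph `G` with all edges that meet `X` removed. -/
def del {V : Type*} (G : SimpleGraph V) (X : Set V) : SimpleGraph V where
  Adj x y := G.Adj x y ∧ x ∉ X ∧ y ∉ X
  symm := ⟨fun _ _ h => ⟨h.1.symm, h.2.2, h.2.1⟩⟩
  loopless := ⟨fun _ h => h.1.ne rfl⟩

theorem del_le {V : Type*} (G : SimpleGraph V) (X : Set V) : del G X ≤ G := fun _ _ h => h.1

/-- The set of edges of `G` that meet `X`. -/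
def meeting {V : Type*} (G : SimpleGraph V) (X : Set V) : Set (Sym2 V) :=
  {e | e ∈ G.edgeSet ∧ ∃ x ∈ X, x ∈ e}

theorem edgeSet_del {V : Type*} (G : SimpleGraph V) (X : Set V) :
    (del G X).edgeSet = G.edgeSet \ meeting G X := by
  ext e
  induction e with
  | h x y =>
    simp only [mem_edgeSet, del, meeting, Set.mem_sdiff, Set.mem_ofPred_eq, Sym2.mem_iff]
    constructor
    · rintro ⟨h, hx, hy⟩
      refine ⟨h, ?_⟩
      rintro ⟨-, z, hz, rfl | rfl⟩ <;> contradiction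
    · rintro ⟨h, h'⟩
      exact ⟨h, fun hx => h' ⟨h, x, hx, .inl rfl⟩, fun hy => h' ⟨h, y, hy, .inr rfl⟩⟩

theorem ncard_del {V : Type*} [Finite V] (G : SimpleGraph V) (X : Set V) :
    (del G X).edgeSet.ncard + (meeting G X).ncard = G.edgeSet.ncard := by
  rw [edgeSet_del]
  exact Set.ncard_sdiff_add_ncard_of_subset fun e he => he.1

/-- If a cycle of `G + s₁s₂` is not a cycle of `G`, it is the new edge and a path of `G`. -/
theorem hasCycle_add_edge {V : Type*} {G H : SimpleGraph V} {s₁ s₂ : V}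
    (hH : ∀ x y, H.Adj x y → G.Adj x y ∨ s(x, y) = s(s₁, s₂)) (h : HasCycleMod H 1 3) :
    HasCycleMod G 1 3 ∨ ∃ p : G.Walk s₁ s₂, p.IsPath ∧ (p.length + 1) % 3 = 1 := by
  classical
  obtain ⟨v, c, hc, hl⟩ := h
  replace hl : c.length % 3 = 1 := hl
  have htr : ∀ {x y} (p : H.Walk x y), s(s₁, s₂) ∉ p.edges → ∀ e ∈ p.edges, e ∈ G.edgeSet := by
    intro x y p hp e he
    have he' := p.edges_subset_edgeSet he
    induction e with
    | h a b =>
      rcases hH a b he' with h | h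
      · exact h
      · exact absurd (h ▸ he) hp
  by_cases he : s(s₁, s₂) ∈ c.edges
  swap
  · left
    refine ⟨v, c.transfer G (htr c he), hc.transfer _, ?_⟩
    rw [Walk.length_transfer]; exact hl
  right
  have hs := Walk.fst_mem_support_of_mem_edges _ he
  have hc' := hc.rotate hs
  have hl' : (c.rotate _ hs).length % 3 = 1 := by rw [Walk.length_rotate]; exact hl
  have he' : s(s₁, s₂) ∈ (c.rotate _ hs).edges := (Walk.rotate_edges c _ hs).mem_iff.2 he
  generalize c.rotate _ hs = d at hc' hl' he'
  cases d with
  | nil => simp at hl'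
  | @cons _ y _ e p =>
    have hp := (Walk.cons_isCycle_iff _ _).1 hc'
    by_cases hy : y = s₂
    · subst hy
      have hp2 : s(s₁, y) ∉ p.reverse.edges := by simpa using hp.2
      refine ⟨p.reverse.transfer G (htr _ hp2), hp.1.reverse.transfer _, ?_⟩
      simpa using hl'
    · have hep : s(s₁, s₂) ∈ p.reverse.edges := by
        rw [Walk.edges_cons, List.mem_cons] at he'
        rcases he' with h | h
        · rcases Sym2.eq_iff.1 h with ⟨_, h2⟩ | ⟨h1, _⟩
          · exact absurd h2.symm hy
          · exact absurd h1 e.ne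
        · simpa using h
      have hpr := hp.1.reverse
      have hlr : p.reverse.length = p.length := by simp
      generalize p.reverse = r at hep hpr hlr
      cases r with
      | nil => simp at hep
      | @cons _ z _ e' r =>
        rw [Walk.cons_isPath_iff] at hpr
        have hnot : s(s₁, s₂) ∉ r.edges := fun h =>
          hpr.2 (Walk.fst_mem_support_of_mem_edges _ h)
        have hz : z = s₂ := by
          rw [Walk.edges_cons, List.mem_cons] at hep
          rcases hep with h | h
          · rcases Sym2.eq_iff.1 h with ⟨_, h2⟩ | ⟨h1, _⟩
            · exact h2.symm
            · exact absurd h1 e'.ne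
          · exact absurd h hnot
        subst hz
        have hne : s(s₁, z) ≠ s(s₁, y) := fun h => by
          rcases Sym2.eq_iff.1 h with ⟨_, h2⟩ | ⟨h1, h2⟩
          · exact hy h2.symm
          · exact e.ne h1
        have hpath : (Walk.cons e r.reverse).IsPath := by
          rw [Walk.cons_isPath_iff]
          exact ⟨hpr.1.reverse, by simpa using hpr.2⟩
        have hnot' : s(s₁, z) ∉ (Walk.cons e r.reverse).edges := by
          rw [Walk.edges_cons, List.mem_cons]
          rintro (h | h)
          · exact hne h
          · exact hnot (by simpa using h)
        refine ⟨_, hpath.transfer (htr _ hnot'), ?_⟩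
        rw [Walk.length_transfer]
        simp at hl' hlr ⊢
        omega

/-! ### The Petersen graph with an edge replaced by a path of length four -/

/-- Neighbour lists of the Petersen graph minus `{0, 5}` with the edge `αβ` replaced by the path
`α, 10, 11, 12, β`. -/
def p4N (α β : ℕ) : ℕ → List ℕ := fun i =>
  if i < 10 then
    (pmN i).filter (fun j => !((i == α && j == β) || (i == β && j == α))) ++
      (if i = α then [10] else []) ++ (if i = β then [12] else [])
  else if i = 10 then [α, 11] else if i = 11 then [10, 12] else if i = 12 then [11, β] else []

/-- No edge of a Petersen graph minus an edge can be replaced by a path of length four such that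
the result embeds into `G`. -/
def P4Free {V : Type*} (G : SimpleGraph V) : Prop :=
  ∀ α < 10, ∀ β ∈ pmN α, ∀ f : ℕ → V, ¬ IsCopy (p4N α β) 13 G f

theorem isCopy_p4N {V : Type*} {G : SimpleGraph V} {α β : ℕ} (hα : α < 10) (hβ : β ∈ pmN α)
    {g : ℕ → V} (hinj : ∀ i < 10, ∀ j < 10, g i = g j → i = j)
    (hadj : ∀ i < 10, ∀ j ∈ pmN i, ¬ (i = α ∧ j = β) → ¬ (i = β ∧ j = α) → G.Adj (g i) (g j))
    {x y z : V} (hx : G.Adj (g α) x) (hxy : G.Adj x y) (hyz : G.Adj y z) (hz : G.Adj z (g β))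
    (hxz : x ≠ z) (hgx : ∀ i < 10, g i ≠ x) (hgy : ∀ i < 10, g i ≠ y) (hgz : ∀ i < 10, g i ≠ z) :
    ∃ f, IsCopy (p4N α β) 13 G f := by
  have hβ' := pmN_lt α hα β hβ
  let f : ℕ → V := fun i => if i < 10 then g i else if i = 10 then x else if i = 11 then y else z
  have f1 : ∀ i < 10, f i = g i := fun i hi => by simp [f, hi]
  have f10 : f 10 = x := rfl
  have f11 : f 11 = y := rfl
  have f12 : f 12 = z := rfl
  refine ⟨f, ⟨fun i hi j hj h => ?_, fun i hi j hj => ?_⟩⟩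
  · have hcase : ∀ i < 13, i < 10 ∨ i = 10 ∨ i = 11 ∨ i = 12 := by omega
    rcases hcase i hi with h1 | rfl | rfl | rfl <;> rcases hcase j hj with h2 | rfl | rfl | rfl
    · rw [f1 i h1, f1 j h2] at h; exact hinj i h1 j h2 h
    · rw [f1 i h1] at h; exact absurd h (hgx i h1)
    · rw [f1 i h1] at h; exact absurd h (hgy i h1)
    · rw [f1 i h1] at h; exact absurd h (hgz i h1)
    · rw [f1 j h2] at h; exact absurd h.symm (hgx j h2)
    · rfl
    · exact absurd h hxy.ne
    · exact absurd h hxz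
    · rw [f1 j h2] at h; exact absurd h.symm (hgy j h2)
    · exact absurd h hxy.ne'
    · rfl
    · exact absurd h hyz.ne
    · rw [f1 j h2] at h; exact absurd h.symm (hgz j h2)
    · exact absurd h hxz.symm
    · exact absurd h hyz.ne'
    · rfl
  · have hcase : i < 10 ∨ i = 10 ∨ i = 11 ∨ i = 12 := by omega
    rcases hcase with h1 | rfl | rfl | rfl
    · rw [f1 i h1]
      simp only [p4N, h1, if_true, List.mem_append] at hj
      rcases hj with (hj | hj) | hj
      · simp at hj
        rw [f1 j (pmN_lt i h1 j hj.1)]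
        exact hadj i h1 j hj.1 (not_and_or.2 hj.2.1) (not_and_or.2 hj.2.2)
      · by_cases hi : i = α
        · simp [hi] at hj
          rw [hj, hi, f10]; exact hx
        · simp [hi] at hj
      · by_cases hi : i = β
        · simp [hi] at hj
          rw [hj, hi, f12]; exact hz.symm
        · simp [hi] at hj
    · simp [p4N] at hj
      rcases hj with rfl | rfl
      · rw [f1 _ hα]; exact hx.symm
      · exact hxy
    · simp [p4N] at hj
      rcases hj with rfl | rfl
      · exact hxy.symm
      · exact hyz
    · simp [p4N] at hj
      rcases hj with rfl | rfl
      · exact hyz.symm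
      · rw [f1 _ hβ']; exact hz

/-! ### A minimal counterexample -/

/-- `G` has no `(1 mod 3)`-cycle and no Petersen graph minus an edge, and all its edges lie
within `S`. -/
structure Sparse {V : Type*} (G : SimpleGraph V) (S : Finset V) : Prop where
  supp : ∀ x y, G.Adj x y → x ∈ S
  noCycle : ¬ HasCycleMod G 1 3
  pFree : PFree G

/-- A graph `G` on the vertex set `S` just violating `2e ≤ 3(n - 1)`, with `n` even, such that all
smaller sparse graphs satisfy this bound. -/
structure MinCounterexample {V : Type u} (G : SimpleGraph V) (S : Finset V) : Prop
    extends Sparse G S where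
  card_edges : 2 * G.edgeSet.ncard + 2 = 3 * S.card
  smaller : ∀ (W : Type u) [Finite W] (H : SimpleGraph W) (T : Finset W), Sparse H T →
    T.Nonempty → T.card < S.card → 2 * H.edgeSet.ncard + 3 ≤ 3 * T.card

section
variable {V : Type u} {G : SimpleGraph V} {S : Finset V}

theorem Sparse.del [DecidableEq V] (h : Sparse G S) (X : Finset V) : Sparse (del G X) (S \ X) :=
  ⟨fun x y hxy => Finset.mem_sdiff.2 ⟨h.supp x y hxy.1, hxy.2.1⟩,
    fun hc => h.noCycle (hc.mono (del_le _ _)), h.pFree.mono (del_le _ _)⟩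

/-- Deletion: few edges cannot meet a set of vertices. -/
theorem MinCounterexample.meeting_ge [Finite V] [DecidableEq V]
    (h : MinCounterexample G S) {X : Finset V} (hX : X ⊆ S)
    (hX0 : X.Nonempty) (hXS : X ≠ S) : 3 * X.card + 1 ≤ 2 * (meeting G (X : Set V)).ncard := by
  have hcard := Finset.card_sdiff_add_card_eq_card hX
  have hpos := hX0.card_pos
  have hne : (S \ X).Nonempty := by
    rw [Finset.sdiff_nonempty]
    exact fun h' => hXS (hX.antisymm h')
  have h1 := h.smaller V _ _ (h.toSparse.del X) hne (by omega)
  have h2 := ncard_del G (X : Set V)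
  have h3 := h.card_edges
  omega

/-- What the bound for the smaller graph `triGlue H A col` says about the edges of `H`
meeting `A`. -/
theorem MinCounterexample.glue [Finite V] (h : MinCounterexample G S) {H : SimpleGraph V}
    (hH : ¬ HasCycleMod H 1 3) {A : Finset V} (hA : A.card + 3 < S.card)
    {col : V → Option (Fin 3)} (hE : EarCond H (A : Set V) col)
    (hP : PFree (triGlue H (A : Set V) col)) (F : Set (Sym2 V)) (hF : F ⊆ meeting H (A : Set V))
    (hclosed : ∀ a ∈ A, ∀ b, H.Adj a b → b ∈ A ∨ ∃ i, col b = some i)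
    (hinj : ∀ a ∈ A, ∀ ρ ρ' i, col ρ = some i → col ρ' = some i → s(a, ρ) ∈ F → s(a, ρ') ∈ F →
      ρ = ρ') : 2 * F.ncard ≤ 3 * A.card := by
  have h1 := triGlue_card hE F (fun e he => (hF he).1) (fun e he => by
    obtain ⟨he1, a, ha, hae⟩ := hF he
    obtain ⟨b, rfl⟩ := Sym2.mem_iff_exists.1 hae
    exact ⟨a, b, rfl, ha, hclosed a ha b he1⟩) hinj
  have h2 := h.smaller (V ⊕ Fin 3) (triGlue H (A : Set V) col) (A.disjSum Finset.univ)
    ⟨fun x y hxy => ?_, triGlue_not_hasCycle hH hE, hP⟩ ⟨.inr 0, by simp⟩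
    (by simpa [Finset.card_disjSum] using hA)
  · simp only [Finset.card_disjSum, Finset.card_univ, Fintype.card_fin] at h2
    omega
  · rcases x with x | i <;> rcases y with y | j
    · simpa using hxy.1
    · simpa using hxy.1
    · simp
    · simp

/-- Adding an edge between vertices joined by a path of length four through `X`, and deleting
`X`. -/
theorem MinCounterexample.add_edge [Finite V] [DecidableEq V]
    (h : MinCounterexample G S) (h4 : P4Free G) {X : Finset V}
    (hX : X ⊆ S) {s₁ s₂ x y z : V} (hs : s₁ ≠ s₂) (hs₁ : s₁ ∉ X) (hs₂ : s₂ ∉ X)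
    (hx : x ∈ X) (hy : y ∈ X) (hz : z ∈ X) (hxz : x ≠ z) (h1 : G.Adj s₁ x) (h2 : G.Adj x y)
    (h3 : G.Adj y z) (h5 : G.Adj z s₂) (hn : ¬ G.Adj s₁ s₂) :
    3 * X.card + 3 ≤ 2 * (meeting G (X : Set V)).ncard := by
  have hcard := Finset.card_sdiff_add_card_eq_card hX
  have hpos : 0 < X.card := Finset.card_pos.2 ⟨x, hx⟩
  have hs₁S : s₁ ∈ S := h.supp _ _ h1
  have hs₂S : s₂ ∈ S := h.supp _ _ h5.symm
  let H : SimpleGraph V := CycleMod.del G X ⊔ edge s₁ s₂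
  have hH : ∀ a b, H.Adj a b → (CycleMod.del G X).Adj a b ∨ s(a, b) = s(s₁, s₂) := by
    intro a b hab
    rcases hab with hab | hab
    · exact .inl hab
    · rw [edge_adj] at hab
      exact .inr (Sym2.eq_iff.2 hab.1)
  have hpt : PathThrough G (X : Set V) s₁ s₂ 4 := by
    refine PathThrough.cons h1 hx hs₁ hs (l := 3) ?_
    have hyz : PathThrough G {z} y s₂ 2 :=
      PathThrough.cons h3 (by simp) (by simpa using h3.ne) (fun h => hs₂ (h ▸ hy)) (.single _ h5)
    have : PathThrough G {y, z} x s₂ 3 :=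
      PathThrough.cons h2 (by simp) (by simpa using ⟨h2.ne, hxz⟩) (fun h => hs₂ (h ▸ hx))
        (hyz.mono le_rfl (by simp))
    exact this.mono le_rfl (by
      rintro w (rfl | rfl)
      · exact hy
      · exact hz)
  -- a cycle of length `1` through the new edge would come from a path whose length is `0`, whereas
  -- the path of length four through `X` forbids such paths outside `X`; a Petersen graph minus an
  -- edge through the new edge would, with this path, give a copy excluded by `P4Free`
  have hsp : Sparse H (S \ X) := by
    refine ⟨fun a b hab => ?_, fun hc => ?_, fun f hf => ?_⟩
    · rcases hH a b hab with h' | h'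
      · exact (h.toSparse.del X).supp a b h'
      · rcases Sym2.eq_iff.1 h' with ⟨rfl, -⟩ | ⟨rfl, -⟩ <;> simp [*]
    · rcases hasCycle_add_edge hH hc with hc | ⟨p, hp, hpl⟩
      · exact (h.toSparse.del X).noCycle hc
      · have hp' : PathThrough G (X : Set V)ᶜ s₁ s₂ p.length := by
          refine ⟨p.mapLe (del_le _ _), hp.mapLe _, by simp, fun w hw => ?_⟩
          by_cases hws : w = s₁
          · exact .inl hws
          · right; right
            have hw' : w ∈ p.support := by simpa using hw
            obtain ⟨e, he, hwe⟩ := (Walk.mem_support_iff_exists_mem_edges_of_not_nil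
              (p := p) (fun hnil => hs hnil.eq)).1 hw'
            obtain ⟨b, rfl⟩ := Sym2.mem_iff_exists.1 hwe
            exact (p.edges_subset_edgeSet he).2.1
        have := hpt.add_ne h.noCycle hs disjoint_compl_right hp'
        omega
    · by_cases hex : ∃ α < 10, ∃ β ∈ pmN α, f α = s₁ ∧ f β = s₂
      · obtain ⟨α, hα, β, hβ, hfα, hfβ⟩ := hex
        have hfX : ∀ i < 10, f i ∉ X := by
          intro i hi
          obtain ⟨j, hj⟩ := exists_mem_pmN i hi
          rcases hH _ _ (hf.adj i hi j hj) with h' | h'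
          · exact h'.2.1
          · rcases Sym2.eq_iff.1 h' with ⟨h', -⟩ | ⟨h', -⟩ <;> rw [h'] <;> assumption
        have hβ' := pmN_lt α hα β hβ
        obtain ⟨f', hf'⟩ := isCopy_p4N (G := G) hα hβ (g := f) hf.inj (fun i hi j hj hn1 hn2 => by
          rcases hH _ _ (hf.adj i hi j hj) with h' | h'
          · exact h'.1
          · have hj' := pmN_lt i hi j hj
            rcases Sym2.eq_iff.1 h' with ⟨h1, h2⟩ | ⟨h1, h2⟩
            · exact absurd ⟨hf.inj _ hi _ hα (h1.trans hfα.symm),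
                hf.inj _ hj' _ hβ' (h2.trans hfβ.symm)⟩ hn1
            · exact absurd ⟨hf.inj _ hi _ hβ' (h1.trans hfβ.symm),
                hf.inj _ hj' _ hα (h2.trans hfα.symm)⟩ hn2)
          (hfα ▸ h1) h2 h3 (hfβ ▸ h5) hxz (fun i hi e => hfX i hi (e ▸ hx))
          (fun i hi e => hfX i hi (e ▸ hy)) (fun i hi e => hfX i hi (e ▸ hz))
        exact h4 α hα β hβ f' hf'
      · refine (h.toSparse.del X).pFree f ⟨hf.inj, fun i hi j hj => ?_⟩
        rcases hH _ _ (hf.adj i hi j hj) with h' | h'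
        · exact h'
        · rcases Sym2.eq_iff.1 h' with ⟨h1, h2⟩ | ⟨h1, h2⟩
          · exact absurd ⟨i, hi, j, hj, h1, h2⟩ hex
          · exact absurd ⟨j, pmN_lt i hi j hj, i, pmN_symm i hi j hj, h2, h1⟩ hex
  have hb := h.smaller V H _ hsp ⟨s₁, by simp [*]⟩ (by omega)
  have hHe : H.edgeSet.ncard = (CycleMod.del G X).edgeSet.ncard + 1 := by
    have : H.edgeSet = insert s(s₁, s₂) (CycleMod.del G (X : Set V)).edgeSet := by
      ext e
      induction e with
      | h a b =>
        constructor
        · intro hab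
          rcases hH a b hab with h' | h'
          · exact .inr h'
          · exact .inl h'
        · rintro (h' | h')
          · exact .inr ((edge_adj ..).2 ⟨Sym2.eq_iff.1 h', by
              rcases Sym2.eq_iff.1 h' with ⟨rfl, rfl⟩ | ⟨rfl, rfl⟩
              · exact hs
              · exact hs.symm⟩)
          · exact .inl h'
    rw [this, Set.ncard_insert_of_notMem]
    exact fun h' => hn h'.1
  have hd := ncard_del G (X : Set V)
  have he := h.card_edges
  omega

theorem not_two_common (hG : ¬ HasCycleMod G 1 3) {p s a b : V} (hps : p ≠ s) (hab : a ≠ b)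
    (h1 : G.Adj a p) (h2 : G.Adj a s) (h3 : G.Adj b p) (h4 : G.Adj b s) : False := by
  have e1 : PathThrough G {a} p s 2 :=
    PathThrough.cons h1.symm (by simp) (by simpa using h1.ne') hps (.single _ h2)
  have e2 : PathThrough G {b} p s 2 :=
    PathThrough.cons h3.symm (by simp) (by simpa using h3.ne') hps (.single _ h4)
  exact e1.add_ne hG hps (by simpa using hab) e2 (by norm_num)

theorem exists_split {l : List ℕ} (hl : l.length ≤ 3) {P Q : ℕ → Prop}
    (h : ∀ i ∈ l, P i ∨ Q i) (hP : ∃ i ∈ l, ¬ P i) (hQ : ∃ i ∈ l, ¬ Q i) :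
    ∃ i ∈ l, (P i ∧ ∀ j ∈ l, j ≠ i → Q j) ∨ (Q i ∧ ∀ j ∈ l, j ≠ i → P j) := by
  match l, hl with
  | [], _ => simp at hP
  | [a], _ => simp at *; tauto
  | [a, b], _ => simp at *; by_cases hab : a = b <;> grind
  | [a, b, c], _ => simp at *; grind
  | _ :: _ :: _ :: _ :: _, hl => simp at hl; omega

/-- Deleting `X` and identifying two nonadjacent vertices that are joined by a path of length three
through `X`. -/
theorem MinCounterexample.identify [Finite V] [DecidableEq V]
    (h : MinCounterexample G S) (h4 : P4Free G) {X : Finset V}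
    (hX : X ⊆ S) {p s x y : V} (hps : p ≠ s) (hp : p ∉ X) (hs : s ∉ X) (hx : x ∈ X) (hy : y ∈ X)
    (h1 : G.Adj p x) (h2 : G.Adj x y) (h3 : G.Adj y s) (hn : ¬ G.Adj p s) :
    3 * X.card + 4 ≤ 2 * (meeting G (X : Set V)).ncard ∨
    (3 * X.card + 2 ≤ 2 * (meeting G (X : Set V)).ncard ∧ ∃ b ∉ X, G.Adj b p ∧ G.Adj b s) := by
  have hpS : p ∈ S := h.supp _ _ h1
  have hsS : s ∈ S := h.supp _ _ h3.symm
  have hcard := Finset.card_sdiff_add_card_eq_card hX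
  have hX2 : 2 ≤ X.card := Finset.one_lt_card.2 ⟨x, hx, y, hy, h2.ne⟩
  let A : Finset V := (S \ X) \ {p, s}
  have hcardA : A.card + 2 = (S \ X).card := by
    have := Finset.card_sdiff_add_card_eq_card (s := {p, s}) (t := S \ X) (by
      intro w; simp; rintro (rfl | rfl) <;> simp [*])
    rwa [Finset.card_pair hps] at this
  let H := CycleMod.del G (X : Set V)
  have hHG : H ≤ G := del_le _ _
  have hHc : ¬ HasCycleMod H 1 3 := (h.toSparse.del X).noCycle
  let col : V → Option (Fin 3) := fun v => if v = p ∨ v = s then some 0 else none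
  have hcol : ∀ ρ i, col ρ = some i ↔ (ρ = p ∨ ρ = s) ∧ i = 0 := by
    intro ρ i
    by_cases hρ : ρ = p ∨ ρ = s
    · simp [col, eq_comm]
    · simp [col, hρ]
  have hAX : Disjoint (A : Set V) (X : Set V) := by
    rw [Finset.disjoint_coe, Finset.disjoint_left]
    intro w hw; simp [A] at hw; exact hw.1.2
  have hpA : p ∉ A := by simp [A]
  have hsA : s ∉ A := by simp [A]
  have hpt : PathThrough G (X : Set V) p s 3 := by
    refine PathThrough.cons h1 hx hp hps (l := 2) ?_
    have hyz : PathThrough G {y} x s 2 :=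
      PathThrough.cons h2 (by simp) (by simpa using h2.ne) (fun h => hs (h ▸ hx)) (.single _ h3)
    exact hyz.mono le_rfl (by simpa using hy)
  have hE : EarCond H (A : Set V) col := by
    refine ⟨fun ρ i hρ => ?_, fun ρ ρ' i n hne hρ hρ' hn hpath => ?_,
      fun ρ ρ' i j n hij hρ hρ' => ?_⟩
    · rcases ((hcol _ _).1 hρ).1 with rfl | rfl
      · simpa using hpA
      · simpa using hsA
    · have hpath' := hpath.mono hHG (le_refl (A : Set V))
      rcases ((hcol _ _).1 hρ).1 with rfl | rfl <;> rcases ((hcol _ _).1 hρ').1 with rfl | rfl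
      · exact absurd rfl hne
      · have := hpath'.add_ne h.noCycle hne hAX hpt
        omega
      · have := hpath'.add_ne h.noCycle hne hAX hpt.symm
        omega
      · exact absurd rfl hne
    · exact absurd (((hcol _ _).1 hρ).2.trans ((hcol _ _).1 hρ').2.symm) hij
  -- `triGlue_pFree` does not apply, since nothing is known about ears of lengths `0` and `2`
  have hP : PFree (triGlue H (A : Set V) col) := by
    intro f hf
    obtain ⟨α, hα, i, g, hi, hg, hno⟩ := copy_triGlue hE (h.toSparse.del X).pFree hf
    have hne : ∀ β ∈ pmN α, β ≠ α := fun β hβ h => pmN_irrefl α hα (h ▸ hβ)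
    have hroot : ∀ β ∈ pmN α, ∃ ρ, col ρ = some i ∧ H.Adj (g β) ρ := by
      intro β hβ
      have := hf.adj β (pmN_lt α hα β hβ) α (pmN_symm α hα β hβ)
      rw [hi, hg β (pmN_lt α hα β hβ) (hne β hβ)] at this
      exact this.2
    have hgA : ∀ β < 10, β ≠ α → g β ∈ A := by
      intro β hβ hne
      obtain ⟨γ, hγ⟩ := exists_mem_pmN β hβ
      have := hf.adj β hβ γ hγ
      rw [hg β hβ hne] at this
      rcases hx : f γ with x | j <;> rw [hx] at this <;> exact this.1
    have hi0 : i = 0 := by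
      obtain ⟨β, hβ⟩ := exists_mem_pmN α hα
      obtain ⟨ρ, hρ, -⟩ := hroot β hβ
      exact ((hcol _ _).1 hρ).2
    subst hi0
    -- a copy of the Petersen graph with the edge `αβ` replaced by a path through `X`
    have build : ∀ β ∈ pmN α, ∀ ρ ρ' x y, ρ ∉ X → ρ' ∉ X → ρ ∉ A → ρ' ∉ A → ρ ≠ ρ' → x ∈ X → y ∈ X →
        G.Adj ρ x → G.Adj x y → G.Adj y ρ' → G.Adj (g β) ρ →
        (∀ γ ∈ pmN α, γ ≠ β → H.Adj (g γ) ρ') → False := by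
      intro β hβ ρ ρ' x y hρX hρ'X hρA hρ'A hρρ hx hy h1 h2 h3 hβρ hγ
      let g' : ℕ → V := fun γ => if γ = α then ρ' else g γ
      have hg'α : g' α = ρ' := by simp [g']
      have hg' : ∀ γ, γ ≠ α → g' γ = g γ := fun γ h => by simp [g', h]
      have hout : ∀ z ∈ X, ∀ γ < 10, g' γ ≠ z := by
        intro z hz γ hγ e
        by_cases hγα : γ = α
        · rw [hγα, hg'α] at e; exact hρ'X (e ▸ hz)
        · rw [hg' γ hγα] at e
          exact Set.disjoint_left.1 hAX (hgA γ hγ hγα) (e ▸ hz)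
      obtain ⟨f', hf'⟩ := isCopy_p4N (G := G) hα hβ (g := g') (fun a ha b hb e => by
          by_cases ha' : a = α <;> by_cases hb' : b = α
          · rw [ha', hb']
          · rw [ha', hg'α, hg' b hb'] at e
            exact absurd (e ▸ hgA b hb hb') hρ'A
          · rw [hb', hg'α, hg' a ha'] at e
            exact absurd (e ▸ hgA a ha ha') hρ'A
          · rw [hg' a ha', hg' b hb'] at e
            exact hf.inj a ha b hb (by rw [hg a ha ha', hg b hb hb', e]))
        (fun a ha b hb hn1 hn2 => by
          have hb10 := pmN_lt a ha b hb
          by_cases ha' : a = α <;> by_cases hb' : b = α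
          · subst ha' hb'
            exact absurd hb (pmN_irrefl _ hα)
          · subst ha'
            rw [hg'α, hg' b hb']
            exact (hHG (hγ b hb (fun e => hn1 ⟨rfl, e⟩))).symm
          · subst hb'
            rw [hg'α, hg' a ha']
            exact hHG (hγ a (pmN_symm _ ha _ hb) (fun e => hn2 ⟨e, rfl⟩))
          · have := hf.adj a ha b hb
            rw [hg a ha ha', hg b hb10 hb'] at this
            rw [hg' a ha', hg' b hb']
            exact hHG this.2.2)
        (x := y) (y := x) (z := ρ) (hg'α ▸ h3.symm) h2.symm h1.symm
        (by rw [hg' β (hne β hβ)]; exact hβρ.symm) (fun e => hρX (e ▸ hy)) (hout y hy) (hout x hx)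
        (fun γ hγ e => by
          by_cases hγα : γ = α
          · rw [hγα, hg'α] at e; exact hρρ e.symm
          · rw [hg' γ hγα] at e
            exact hρA (e ▸ hgA γ hγ hγα))
      exact h4 α hα β hβ f' hf'
    -- `α` has at most three neighbours, so one of `p` and `s` is the root of just one of them
    obtain ⟨β, hβ, hβ'⟩ := exists_split (l := pmN α) (P := fun β => H.Adj (g β) p)
      (Q := fun β => H.Adj (g β) s) ((by decide : ∀ i < 10, (pmN i).length ≤ 3) α hα)
      (fun β hβ => by
        obtain ⟨ρ, hρ, hadj⟩ := hroot β hβ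
        rcases ((hcol _ _).1 hρ).1 with rfl | rfl
        · exact .inl hadj
        · exact .inr hadj)
      (hno p ((hcol _ _).2 (by simp))) (hno s ((hcol _ _).2 (by simp)))
    rcases hβ' with ⟨ha, hb⟩ | ⟨ha, hb⟩
    · exact build β hβ p s x y hp hs hpA hsA hps hx hy h1 h2 h3 (hHG ha) hb
    · exact build β hβ s p y x hs hp hsA hpA hps.symm hy hx h3.symm h2.symm h1.symm (hHG ha) hb
  have hclosed : ∀ a ∈ A, ∀ b, H.Adj a b → b ∈ A ∨ ∃ i, col b = some i := by
    intro a ha b hab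
    by_cases hb : b = p ∨ b = s
    · exact .inr ⟨0, (hcol _ _).2 ⟨hb, rfl⟩⟩
    · left
      have := (h.toSparse.del X).supp b a hab.symm
      push Not at hb
      simp only [A, Finset.mem_sdiff, Finset.mem_insert, Finset.mem_singleton] at this ⊢
      tauto
  have hHm : meeting H (A : Set V) = H.edgeSet := by
    ext e
    refine ⟨fun h => h.1, fun he => ⟨he, ?_⟩⟩
    induction e with
    | h a b =>
      by_cases ha : a ∈ A
      · exact ⟨a, ha, by simp⟩
      · by_cases hb : b ∈ A
        · exact ⟨b, hb, by simp⟩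
        · exfalso
          have e1 := (h.toSparse.del X).supp a b he
          have e2 := (h.toSparse.del X).supp b a (SimpleGraph.Adj.symm (G := H) he)
          have hne := H.ne_of_adj he
          have hpsa := hHG he
          simp only [A, Finset.mem_sdiff, Finset.mem_insert, Finset.mem_singleton] at ha hb e1 e2
          have ha' : a = p ∨ a = s := by tauto
          have hb' : b = p ∨ b = s := by tauto
          rcases ha' with rfl | rfl <;> rcases hb' with rfl | rfl
          · exact hne rfl
          · exact hn hpsa
          · exact hn hpsa.symm
          · exact hne rfl
  have hd : H.edgeSet.ncard + _ = _ := ncard_del G (X : Set V)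
  have he := h.card_edges
  -- a common neighbour is unique, so the identification loses at most one edge
  by_cases hex : ∃ b ∉ X, G.Adj b p ∧ G.Adj b s
  · right
    refine ⟨?_, hex⟩
    obtain ⟨b, hb, hbp, hbs⟩ := hex
    have hg := h.glue hHc (A := A) (by omega) hE hP (H.edgeSet \ {s(b, p)})
      (by rw [hHm]; exact Set.sdiff_subset) hclosed (by
        intro a ha ρ ρ' i hρ hρ' hF hF'
        rcases ((hcol _ _).1 hρ).1 with rfl | rfl <;> rcases ((hcol _ _).1 hρ').1 with rfl | rfl
        · rfl
        · exact (not_two_common h.noCycle hps (fun e : a = b => hF.2 (by subst e; rfl)) (hHG hF.1)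
            (hHG hF'.1) hbp hbs).elim
        · exact (not_two_common h.noCycle hps (fun e : a = b => hF'.2 (by subst e; rfl)) (hHG hF'.1)
            (hHG hF.1) hbp hbs).elim
        · rfl)
    have hbH : s(b, p) ∈ H.edgeSet := ⟨hbp, hb, hp⟩
    have := Set.ncard_sdiff_singleton_add_one hbH
    omega
  · left
    push Not at hex
    have hg := h.glue hHc (A := A) (by omega) hE hP H.edgeSet hHm.ge hclosed (by
        intro a ha ρ ρ' i hρ hρ' hF hF'
        have haX : a ∉ X := Set.disjoint_left.1 hAX ha
        rcases ((hcol _ _).1 hρ).1 with rfl | rfl <;> rcases ((hcol _ _).1 hρ').1 with rfl | rfl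
        · rfl
        · exact absurd (hHG hF') (hex a haX (hHG hF))
        · exact absurd (hHG hF) (hex a haX (hHG hF'))
        · rfl)
    omega

end

/-! ### Gluing along a copy of a fixed graph -/

theorem PathThrough.add_ne_copy {V : Type*} {N : ℕ → List ℕ} {k : ℕ} {G : SimpleGraph V}
    {f : ℕ → V} (hG : ¬ HasCycleMod G 1 3) (hf : IsCopy N k G f)
    (hN : ∀ i < k, N i ≠ [] ∧ ∀ j ∈ N i, j < k) {A : Set V} (hA : ∀ i < k, f i ∉ A) {i j n r : ℕ}
    (hi : i < k) (hj : j < k) (hij : i ≠ j) (h : PathThrough G A (f i) (f j) n)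
    (hr : findPath N j k [i] i r = true) : (n + r) % 3 ≠ 1 := by
  obtain ⟨l, hl, hp⟩ := PathThrough.of_findPath hf (fun i hi => (hN i hi).2) hj k [i] i r hi
    (by simp) hr
  have := h.add_ne hG (fun e => hij (hf.inj i hi j hj e)) (by
    rw [Set.disjoint_left]
    rintro _ hx ⟨c, hc, -, rfl⟩
    exact hA c hc hx) hp
  omega

/-- The colouring of the vertices of a copy by given colours of the branch vertices. -/
noncomputable def copyCol {V : Type*} (f : ℕ → V) (k : ℕ) (c : ℕ → Option (Fin 3)) (v : V) :
    Option (Fin 3) := by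
  classical
  exact if h : ∃ i < k, f i = v then c h.choose else none

theorem exists_of_copyCol {V : Type*} {f : ℕ → V} {k : ℕ} {c : ℕ → Option (Fin 3)} {v : V}
    {a : Fin 3} (h : copyCol f k c v = some a) : ∃ i < k, f i = v ∧ c i = some a := by
  unfold copyCol at h
  split_ifs at h with h'
  exact ⟨_, h'.choose_spec.1, h'.choose_spec.2, h⟩

theorem copyCol_apply {V : Type*} {f : ℕ → V} {k : ℕ} {c : ℕ → Option (Fin 3)}
    (hf : ∀ i < k, ∀ j < k, f i = f j → i = j) {i : ℕ} (hi : i < k) :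
    copyCol f k c (f i) = c i := by
  have h' : ∃ j < k, f j = f i := ⟨i, hi, rfl⟩
  unfold copyCol
  rw [dif_pos h', hf _ h'.choose_spec.1 i hi h'.choose_spec.2]

/-- The graph `N` contains paths that rule out all ears between differently coloured vertices
except those of length `1` modulo `3`, and all ears between vertices of the same colour except
those of length `0`, or, unless `strict`, those of length `2`. -/
def earTable (N : ℕ → List ℕ) (k : ℕ) (c : ℕ → Option (Fin 3)) (strict : Bool) : Bool :=
  (List.range k).all fun i => (List.range i).all fun j =>
    match c i, c j with
    | some a, some b =>
      bif a == b then
        findPath N j k [i] i 0 &&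
          (findPath N j k [i] i 2 || (!strict && findPath N j k [i] i 1))
      else findPath N j k [i] i 1 && findPath N j k [i] i 2
    | _, _ => true

theorem ears_of_earTable {V : Type*} {N : ℕ → List ℕ} {k : ℕ} {G : SimpleGraph V}
    {f : ℕ → V} (hG : ¬ HasCycleMod G 1 3) (hf : IsCopy N k G f)
    (hN : ∀ i < k, N i ≠ [] ∧ ∀ j ∈ N i, j < k) {A : Set V} (hA : ∀ i < k, f i ∉ A)
    {c : ℕ → Option (Fin 3)} {strict : Bool} (ht : earTable N k c strict = true)
    {i j : ℕ} {a b : Fin 3} (hi : i < k) (hj : j < k) (hij : i ≠ j) (ha : c i = some a)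
    (hb : c j = some b) :
    (a = b → (∀ n, PathThrough G A (f i) (f j) n → n % 3 ≠ 1) ∧
      ((∀ n, PathThrough G A (f i) (f j) n → n % 3 ≠ 2) ∨
        strict = false ∧ (∀ n, PathThrough G A (f i) (f j) n → n % 3 ≠ 0))) ∧
    (a ≠ b → ∀ n, PathThrough G A (f i) (f j) n → n % 3 = 1) := by
  have main : ∀ i < k, ∀ j < i, ∀ a b, c i = some a → c j = some b →
    (a = b → (∀ n, PathThrough G A (f i) (f j) n → n % 3 ≠ 1) ∧
      ((∀ n, PathThrough G A (f i) (f j) n → n % 3 ≠ 2) ∨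
        strict = false ∧ (∀ n, PathThrough G A (f i) (f j) n → n % 3 ≠ 0))) ∧
    (a ≠ b → ∀ n, PathThrough G A (f i) (f j) n → n % 3 = 1) := by
    intro i hi j hj a b ha hb
    have hj' : j < k := hj.trans hi
    have key := fun r n h => PathThrough.add_ne_copy (n := n) (r := r) hG hf hN hA hi hj' hj.ne' h
    rw [earTable, List.all_eq_true] at ht
    have h1 := ht i (by simpa using hi)
    rw [List.all_eq_true] at h1
    have h2 := h1 j (by simpa using hj)
    simp only [ha, hb] at h2
    constructor
    · rintro rfl
      simp only [beq_self_eq_true, cond_true, Bool.and_eq_true, Bool.or_eq_true,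
        Bool.not_eq_true'] at h2
      refine ⟨fun n h => by have := key 0 n h h2.1; omega, ?_⟩
      rcases h2.2 with h3 | ⟨h3, h4⟩
      · exact .inl fun n h => by have := key 2 n h h3; omega
      · exact .inr ⟨h3, fun n h => by have := key 1 n h h4; omega⟩
    · intro hab n h
      have hab' : (a == b) = false := by simpa using hab
      simp only [hab', cond_false, Bool.and_eq_true] at h2
      have := key 1 n h h2.1
      have := key 2 n h h2.2
      omega
  rcases lt_or_gt_of_ne hij with h | h
  · have := main j hj i h b a hb ha
    refine ⟨fun hab => ⟨fun n hp => (this.1 hab.symm).1 n hp.symm, ?_⟩,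
      fun hab n hp => this.2 hab.symm n hp.symm⟩
    rcases (this.1 hab.symm).2 with h3 | ⟨h3, h4⟩
    · exact .inl fun n hp => h3 n hp.symm
    · exact .inr ⟨h3, fun n hp => h4 n hp.symm⟩
  · exact main i hi j h a b ha hb

theorem earCond_of_earTable {V : Type*} {N : ℕ → List ℕ} {k : ℕ} {G : SimpleGraph V}
    {f : ℕ → V} (hG : ¬ HasCycleMod G 1 3) (hf : IsCopy N k G f)
    (hN : ∀ i < k, N i ≠ [] ∧ ∀ j ∈ N i, j < k) {A : Set V} (hA : ∀ i < k, f i ∉ A)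
    {c : ℕ → Option (Fin 3)} {strict : Bool} (ht : earTable N k c strict = true) :
    EarCond G A (copyCol f k c) ∧
    ∀ ρ ρ' i, ρ ≠ ρ' → copyCol f k c ρ = some i → copyCol f k c ρ' = some i →
      (∀ n, 2 ≤ n → PathThrough G A ρ ρ' n → n % 3 ≠ 0) ∨
      (∀ n, 2 ≤ n → PathThrough G A ρ ρ' n → n % 3 ≠ 2) := by
  refine ⟨⟨fun ρ a hρ => ?_, fun ρ ρ' a n hne hρ hρ' _ h => ?_,
    fun ρ ρ' a b n hne hρ hρ' _ h => ?_⟩, fun ρ ρ' a hne hρ hρ' => ?_⟩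
  · obtain ⟨i, hi, rfl, -⟩ := exists_of_copyCol hρ
    exact hA i hi
  · obtain ⟨i, hi, rfl, hci⟩ := exists_of_copyCol hρ
    obtain ⟨j, hj, rfl, hcj⟩ := exists_of_copyCol hρ'
    have := ears_of_earTable hG hf hN hA ht hi hj (fun e => hne (e ▸ rfl)) hci hcj
    exact (this.1 rfl).1 n h
  · obtain ⟨i, hi, rfl, hci⟩ := exists_of_copyCol hρ
    obtain ⟨j, hj, rfl, hcj⟩ := exists_of_copyCol hρ'
    have := ears_of_earTable hG hf hN hA ht hi hj
      (fun e => hne (by subst e; rw [hci] at hcj; simpa using hcj)) hci hcj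
    exact this.2 hne n h
  · obtain ⟨i, hi, rfl, hci⟩ := exists_of_copyCol hρ
    obtain ⟨j, hj, rfl, hcj⟩ := exists_of_copyCol hρ'
    have := ears_of_earTable hG hf hN hA ht hi hj (fun e => hne (e ▸ rfl)) hci hcj
    rcases (this.1 rfl).2 with h | ⟨-, h⟩
    · exact .inr fun n _ => h n
    · exact .inl fun n _ => h n

theorem pathThrough_two {V : Type*} {G : SimpleGraph V} {A : Set V} {x y b : V} (hxy : x ≠ y)
    (hx : x ∉ A) (hb : b ∈ A) (h1 : G.Adj b x) (h2 : G.Adj b y) : PathThrough G A x y 2 :=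
  PathThrough.cons h1.symm hb hx hxy (.single _ h2)

section
variable {V : Type u} {G : SimpleGraph V} {S : Finset V}

theorem IsCopy.mem [DecidableEq V] {N : ℕ → List ℕ} {k : ℕ} {f : ℕ → V} (hf : IsCopy N k G f)
    (h : Sparse G S) (hN : ∀ i < k, N i ≠ [] ∧ ∀ j ∈ N i, j < k) :
    (Finset.range k).image f ⊆ S := by
  intro x hx
  simp only [Finset.mem_image, Finset.mem_range] at hx
  obtain ⟨i, hi, rfl⟩ := hx
  obtain ⟨j, hj⟩ := List.exists_mem_of_ne_nil _ (hN i hi).1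
  exact h.supp _ _ (hf.adj i hi j hj)

theorem IsCopy.card [DecidableEq V] {N : ℕ → List ℕ} {k : ℕ} {f : ℕ → V} (hf : IsCopy N k G f)
    (h : Sparse G S) (hN : ∀ i < k, N i ≠ [] ∧ ∀ j ∈ N i, j < k) :
    (S \ (Finset.range k).image f).card + k = S.card := by
  have := Finset.card_sdiff_add_card_eq_card (hf.mem h hN)
  rwa [Finset.card_image_of_injOn, Finset.card_range] at this
  intro i hi j hj e
  simp only [Finset.coe_range, Set.mem_Iio] at hi hj
  exact hf.inj i hi j hj e

theorem MinCounterexample.glue_copy [Finite V] [DecidableEq V] (h : MinCounterexample G S)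
    {N : ℕ → List ℕ} {k : ℕ} {f : ℕ → V} (hf : IsCopy N k G f) (hk : 4 ≤ k)
    (hN : ∀ i < k, N i ≠ [] ∧ ∀ j ∈ N i, j < k) {c : ℕ → Option (Fin 3)} {strict : Bool}
    (ht : earTable N k c strict = true) {A : Finset V} (hA : A = S \ (Finset.range k).image f)
    (hclosed : ∀ i < k, c i = none → ∀ a ∈ A, ¬ G.Adj a (f i))
    (F : Set (Sym2 V)) (hF : F ⊆ meeting G (A : Set V))
    (hinj : ∀ a ∈ A, ∀ i < k, ∀ j < k, i ≠ j → c i = c j → s(a, f i) ∈ F → s(a, f j) ∉ F) :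
    2 * F.ncard ≤ 3 * A.card := by
  have hcard := hf.card h.toSparse hN
  rw [← hA] at hcard
  have hfA : ∀ i < k, f i ∉ (A : Set V) := by
    intro i hi hmem
    rw [hA] at hmem
    simp only [Finset.coe_sdiff, Set.mem_sdiff, Finset.mem_coe, Finset.mem_image,
      Finset.mem_range] at hmem
    exact hmem.2 ⟨i, hi, rfl⟩
  obtain ⟨hE, hE'⟩ := earCond_of_earTable h.noCycle hf hN hfA ht
  refine h.glue h.noCycle (by omega) hE (triGlue_pFree hE h.pFree hE') F hF ?_ ?_
  · intro a ha b hab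
    by_cases hb : ∃ i < k, f i = b
    · obtain ⟨i, hi, rfl⟩ := hb
      right
      rcases hc : c i with _ | x
      · exact absurd hab (hclosed i hi hc a ha)
      · exact ⟨x, by rw [copyCol_apply hf.inj hi, hc]⟩
    · left
      rw [hA]
      simp only [Finset.mem_sdiff, Finset.mem_image, Finset.mem_range]
      exact ⟨h.supp b a hab.symm, hb⟩
  · intro a ha ρ ρ' x hρ hρ' h1 h2
    obtain ⟨i, hi, rfl, hci⟩ := exists_of_copyCol hρ
    obtain ⟨j, hj, rfl, hcj⟩ := exists_of_copyCol hρ'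
    by_contra hne
    exact hinj a ha i hi j hj (fun e => hne (e ▸ rfl)) (hci.trans hcj.symm) h1 h2

/-- A minimal counterexample has an even number of vertices, so a copy of a graph with an odd
number of vertices leaves some vertices uncovered; gluing shows that too few edges meet them. -/
theorem MinCounterexample.no_copy [Finite V] [DecidableEq V] (h : MinCounterexample G S)
    {N : ℕ → List ℕ} {k : ℕ} {f : ℕ → V} (hf : IsCopy N k G f) (hk : 4 ≤ k) (hodd : k % 2 = 1)
    (hN : ∀ i < k, N i ≠ [] ∧ ∀ j ∈ N i, j < k) {c : ℕ → Option (Fin 3)} {strict : Bool}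
    (ht : earTable N k c strict = true)
    (hclosed : ∀ i < k, c i = none → ∀ a ∈ S \ (Finset.range k).image f, ¬ G.Adj a (f i))
    (hcommon : ∀ i < k, ∀ j < k, i ≠ j → c i = c j → ∀ a ∈ S \ (Finset.range k).image f,
      G.Adj a (f i) → ¬ G.Adj a (f j)) : False := by
  have hcard := hf.card h.toSparse hN
  have h1 := h.glue_copy hf hk hN ht rfl hclosed _ le_rfl
    fun a ha i hi j hj hij hc h1 h2 => hcommon i hi j hj hij hc a ha h1.1 h2.1
  have he := h.card_edges
  have h2 := h.meeting_ge (X := S \ (Finset.range k).image f) Finset.sdiff_subset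
    (Finset.card_pos.1 (by omega)) (fun e => by
      rw [e] at hcard; omega)
  omega

/-- A proper colouring of the Petersen graph in which moreover the two neighbours of `0` other
than `5` have different colours, and likewise for `5` and `0`. -/
def petCol (i : ℕ) : Fin 3 := [0, 1, 0, 1, 2, 1, 2, 2, 0, 0].getD i 0

/-- The extension of `petCol` to a proper colouring of the graph given by `p4N α β`. -/
def p4Col (α β i : ℕ) : Option (Fin 3) :=
  if i < 10 then some (petCol i)
  else if i = 10 then some (petCol β)
  else if i = 11 then some (-(petCol α + petCol β))
  else if i = 12 then some (petCol α) else none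

theorem earTable_p4N : ∀ α < 10, ∀ β ∈ pmN α, earTable (p4N α β) 13 (p4Col α β) true = true := by
  decide +kernel

theorem p4N_lt : ∀ α < 10, ∀ β ∈ pmN α, ∀ i < 13,
    p4N α β i ≠ [] ∧ ∀ j ∈ p4N α β i, j < 13 := by
  decide +kernel

theorem MinCounterexample.p4Free [Finite V] (h : MinCounterexample G S) : P4Free G := by
  classical
  intro α hα β hβ f hf
  have hN := p4N_lt α hα β hβ
  have ht := earTable_p4N α hα β hβ
  have hsome : ∀ i < 13, ∃ x, p4Col α β i = some x := by
    intro i hi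
    unfold p4Col
    split_ifs
    · exact ⟨_, rfl⟩
    · exact ⟨_, rfl⟩
    · exact ⟨_, rfl⟩
    · exact ⟨_, rfl⟩
    · omega
  refine h.no_copy hf (by norm_num) (by norm_num) hN ht (fun i hi hc => ?_) ?_
  · obtain ⟨x, hx⟩ := hsome i hi
    rw [hx] at hc; cases hc
  · intro i hi j hj hij hc a ha h1 h2
    obtain ⟨x, hx⟩ := hsome i hi
    have hA : ∀ i < 13, f i ∉ ((S \ (Finset.range 13).image f : Finset V) : Set V) := by
      intro i hi hmem
      simp only [Finset.coe_sdiff, Set.mem_sdiff, Finset.mem_coe, Finset.mem_image,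
        Finset.mem_range] at hmem
      exact hmem.2 ⟨i, hi, rfl⟩
    have := ears_of_earTable h.noCycle hf hN hA ht hi hj hij hx (hc ▸ hx)
    rcases (this.1 rfl).2 with h3 | ⟨h3, -⟩
    · exact h3 2 (pathThrough_two (fun e => hij (hf.inj i hi j hj e)) (hA i hi) ha h1 h2) rfl
    · cases h3

end

/-! ### A vertex of degree three with a neighbour of degree two -/

theorem IsCopy.of_list {V : Type*} {G : SimpleGraph V} {N : ℕ → List ℕ} {k : ℕ} (L : List V)
    (d : V) (hk : L.length = k) (hL : L.Nodup)
    (hadj : ∀ i < k, ∀ j ∈ N i, G.Adj (L.getD i d) (L.getD j d)) :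
    IsCopy N k G (fun i => L.getD i d) := by
  subst hk
  refine ⟨fun i hi j hj h => ?_, hadj⟩
  simp only [List.getD_eq_getElem _ _ hi, List.getD_eq_getElem _ _ hj] at h
  exact (hL.getElem_inj_iff).1 h

/-- Two adjacent vertices `u` and `w`, of degrees three and two, with the surroundings that they
have in the Petersen graph minus an edge at `w`. -/
structure LowPair {V : Type*} (G : SimpleGraph V) (u w s p p' t t' : V) : Prop where
  nodup : [u, w, s, p, p', t, t'].Nodup
  uw : G.Adj u w
  ws : G.Adj w s
  up : G.Adj u p
  up' : G.Adj u p'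
  pt : G.Adj p t
  pt' : G.Adj p' t'
  st : G.Adj s t
  st' : G.Adj s t'
  nbr_u : ∀ x, G.Adj u x → x = w ∨ x = p ∨ x = p'
  nbr_w : ∀ x, G.Adj w x → x = u ∨ x = s

theorem LowPair.swap {V : Type*} {G : SimpleGraph V} {u w s p p' t t' : V}
    (h : LowPair G u w s p p' t t') : LowPair G u w s p' p t' t where
  nodup := by have := h.nodup; simp at this ⊢; grind
  uw := h.uw
  ws := h.ws
  up := h.up'
  up' := h.up
  pt := h.pt'
  pt' := h.pt
  st := h.st'
  st' := h.st
  nbr_u x hx := by have := h.nbr_u x hx; tauto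
  nbr_w := h.nbr_w

/-- Neighbour lists of the graph of `LowPair`, in the order `u, w, s, p, p', t, t'`. -/
def lowN : ℕ → List ℕ
  | 0 => [1, 3, 4]
  | 1 => [0, 2]
  | 2 => [1, 5, 6]
  | 3 => [0, 5]
  | 4 => [0, 6]
  | 5 => [2, 3]
  | 6 => [2, 4]
  | _ => []

/-- The colours used for gluing along the graph of `LowPair`. -/
def lowCol (i : ℕ) : Option (Fin 3) :=
  [none, none, some 2, some 0, some 1, some 1, some 0].getD i none

theorem lowN_lt : ∀ i < 7, lowN i ≠ [] ∧ ∀ j ∈ lowN i, j < 7 := by decide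

theorem earTable_lowN : earTable lowN 7 lowCol false = true := by decide +kernel

theorem lowN_chord : ∀ i < 7, ∀ j < 7, (i == j || findPath lowN j 7 [i] i 0 ||
    (lowN i).contains j || (i == 3 && j == 4) || (i == 4 && j == 3) ||
    (i == 5 && j == 6) || (i == 6 && j == 5)) = true := by
  decide +kernel

theorem lowCol_none : ∀ i < 7, lowCol i = none → i = 0 ∨ i = 1 := by decide

theorem lowCol_eq : ∀ i < 7, ∀ j < 7, i ≠ j → lowCol i = lowCol j →
    (i = 0 ∨ i = 1) ∨ (i = 3 ∧ j = 6) ∨ (i = 6 ∧ j = 3) ∨ (i = 4 ∧ j = 5) ∨ (i = 5 ∧ j = 4) := by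
  intro i hi j hj
  have : (i == j || lowCol i != lowCol j || (i == 0 || i == 1) || (i == 3 && j == 6) ||
      (i == 6 && j == 3) || (i == 4 && j == 5) || (i == 5 && j == 4)) = true := by
    revert j; revert i; decide
  simp at this
  tauto

theorem LowPair.isCopy {V : Type*} {G : SimpleGraph V} {u w s p p' t t' : V}
    (h : LowPair G u w s p p' t t') :
    IsCopy lowN 7 G (fun i => [u, w, s, p, p', t, t'].getD i u) := by
  refine .of_list _ _ rfl h.nodup fun i hi j hj => ?_
  have h1 := h.uw; have h2 := h.ws; have h3 := h.up; have h4 := h.up'; have h5 := h.pt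
  have h6 := h.pt'; have h7 := h.st; have h8 := h.st'
  interval_cases i <;> simp [lowN] at hj <;> rcases hj with rfl | rfl | rfl <;>
    first | assumption | exact SimpleGraph.Adj.symm (by assumption)

/-- Neighbour lists of the Petersen graph minus a vertex, in the order
`u, w, s, p, p', t, t', c, c'`, where `c` is joined to `p, t'`, and `c'` to `p', t`. -/
def petDelN : ℕ → List ℕ
  | 0 => [1, 3, 4]
  | 1 => [0, 2]
  | 2 => [1, 5, 6]
  | 3 => [0, 5, 7]
  | 4 => [0, 6, 8]
  | 5 => [2, 3, 8]
  | 6 => [2, 4, 7]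
  | 7 => [3, 6]
  | 8 => [4, 5]
  | _ => []

/-- The colours used for gluing along the Petersen graph minus a vertex. -/
def petDelCol (i : ℕ) : Option (Fin 3) :=
  [none, none, some 1, some 1, some 1, some 2, some 2, some 0, some 0].getD i none

theorem petDelN_lt : ∀ i < 9, petDelN i ≠ [] ∧ ∀ j ∈ petDelN i, j < 9 := by decide

theorem earTable_petDelN : earTable petDelN 9 petDelCol false = true := by decide +kernel

theorem petDelN_common : ∀ i < 9, ∀ j < 9, (i == j || petDelCol i != petDelCol j ||
    petDelCol i == none || findPath petDelN j 9 [i] i 2 || (i == 7 && j == 8) ||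
      (i == 8 && j == 7)) = true := by
  decide +kernel

theorem petDelCol_none : ∀ i < 9, petDelCol i = none → i = 0 ∨ i = 1 := by decide

section
variable {V : Type u} {G : SimpleGraph V} {S : Finset V}

theorem getD_notMem [DecidableEq V] {L : List V} {k : ℕ} {d a : V} (hk : L.length = k)
    (ha : a ∉ (Finset.range k).image fun i => L.getD i d) : a ∉ L := by
  intro h
  obtain ⟨i, hi, rfl⟩ := List.getElem_of_mem h
  refine ha (Finset.mem_image.2 ⟨i, by simpa [← hk] using hi, ?_⟩)
  exact List.getD_eq_getElem _ _ hi

/-- If `p, t'` and `p', t` have common neighbours, then `G` contains the Petersen graph minus a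
vertex. -/
theorem MinCounterexample.lowPair_two [Finite V] (h : MinCounterexample G S)
    {u w s p p' t t' c c' : V} (hl : LowPair G u w s p p' t t') (hnd : c ∉ [u, w, s, p, p', t, t'])
    (hnd' : c' ∉ [u, w, s, p, p', t, t']) (h1 : G.Adj c p) (h2 : G.Adj c t') (h3 : G.Adj c' p')
    (h4 : G.Adj c' t) : False := by
  classical
  have hnodup := hl.nodup
  have hcc : c ≠ c' := by
    rintro rfl
    refine not_two_common h.noCycle (p := p) (s := p') (a := u) (b := c) ?_ ?_ hl.up hl.up' h1 h3
    · simp at hnodup; tauto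
    · simp at hnd; tauto
  have e1 := hl.uw; have e2 := hl.ws; have e3 := hl.up; have e4 := hl.up'; have e5 := hl.pt
  have e6 := hl.pt'; have e7 := hl.st; have e8 := hl.st'
  have hnd9 : [u, w, s, p, p', t, t', c, c'].Nodup := by
    simp at hnodup hnd hnd' ⊢
    grind
  have hf : IsCopy petDelN 9 G (fun i => [u, w, s, p, p', t, t', c, c'].getD i u) := by
    refine .of_list _ _ rfl hnd9 fun i hi j hj => ?_
    interval_cases i <;> simp [petDelN] at hj <;> rcases hj with rfl | rfl | rfl <;>
      first | assumption | exact SimpleGraph.Adj.symm (by assumption)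
  -- two vertices of the same colour with a common neighbour outside could only be `c` and `c'`
  refine h.no_copy hf (by norm_num) (by norm_num) petDelN_lt earTable_petDelN ?_ ?_
  · intro i hi hc a ha hadj
    have ha' := getD_notMem (L := [u, w, s, p, p', t, t', c, c']) rfl (Finset.mem_sdiff.1 ha).2
    have hi' := petDelCol_none i hi hc
    rcases hi' with rfl | rfl
    · have := hl.nbr_u a hadj.symm
      simp at ha'; tauto
    · have := hl.nbr_w a hadj.symm
      simp at ha'; tauto
  · intro i hi j hj hij hc b hb hb1 hb2
    have hb' := getD_notMem (L := [u, w, s, p, p', t, t', c, c']) rfl (Finset.mem_sdiff.1 hb).2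
    -- a common neighbour of `c` and `c'` completes a Petersen graph minus an edge
    have hpm : G.Adj b c → G.Adj b c' → False := by
      intro hb1 hb2
      have hnd10 : [b, c, p, t, c', w, t', u, s, p'].Nodup := by
        simp at hnd9 hb' ⊢
        grind
      refine h.pFree _ (IsCopy.of_list (N := pmN) _ u rfl hnd10 fun i hi j hj => ?_)
      interval_cases i <;> simp [pmN] at hj <;> rcases hj with rfl | rfl | rfl <;>
        first | assumption | exact SimpleGraph.Adj.symm (by assumption)
    have ht := petDelN_common i hi j hj
    simp [hij, hc] at ht
    rw [or_assoc, or_assoc] at ht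
    rcases ht with h5 | h5 | ⟨rfl, rfl⟩ | ⟨rfl, rfl⟩
    · have hi' := petDelCol_none i hi (hc.trans h5)
      rcases hi' with rfl | rfl
      · have := hl.nbr_u b hb1.symm
        simp at hb'; tauto
      · have := hl.nbr_w b hb1.symm
        simp at hb'; tauto
    · have hA : ∀ i < 9, [u, w, s, p, p', t, t', c, c'].getD i u ∉ ({b} : Set V) := by
        intro i hi e
        refine hb' ?_
        rw [← Set.mem_singleton_iff.1 e, List.getD_eq_getElem _ _ (by simpa using hi)]
        exact List.getElem_mem _
      have := PathThrough.add_ne_copy h.noCycle hf petDelN_lt hA hi hj hij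
        (pathThrough_two (fun e => hij (hf.inj i hi j hj e)) (hA i hi) (by simp) hb1 hb2) h5
      omega
    · exact hpm hb1 hb2
    · exact hpm hb2 hb1

/-- If `p, t'` have a common neighbour, but `p', t` do not, then all but one of the edges outside
the configuration survive gluing, and its seven vertices would have to span nine edges. -/
theorem MinCounterexample.lowPair_one [Finite V] (h : MinCounterexample G S)
    {u w s p p' t t' c : V} (hl : LowPair G u w s p p' t t') (hnd : c ∉ [u, w, s, p, p', t, t'])
    (h1 : G.Adj c p) (h2 : G.Adj c t')
    (hno : ∀ c', c' ∉ [u, w, s, p, p', t, t'] → G.Adj c' p' → ¬ G.Adj c' t) : False := by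
  classical
  have hf := hl.isCopy
  have hnodup := hl.nodup
  obtain ⟨A, hA⟩ : ∃ A, A = S \ (Finset.range 7).image fun i => [u, w, s, p, p', t, t'].getD i u :=
    ⟨_, rfl⟩
  have hcard := hf.card h.toSparse lowN_lt
  rw [← hA] at hcard
  have haL : ∀ a ∈ A, a ∉ [u, w, s, p, p', t, t'] := by
    intro a ha
    rw [hA] at ha
    exact getD_notMem rfl (Finset.mem_sdiff.1 ha).2
  have hcA : c ∈ A := by
    rw [hA, Finset.mem_sdiff]
    refine ⟨h.supp _ _ h1, fun hc => hnd ?_⟩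
    simp only [Finset.mem_image, Finset.mem_range] at hc
    obtain ⟨i, hi, rfl⟩ := hc
    rw [List.getD_eq_getElem _ _ (by simpa using hi)]
    exact List.getElem_mem _
  have hpt' : p ≠ t' := by simp at hnodup; tauto
  -- only `c` is joined from outside to two vertices of the same colour; give up its edge to `p`
  have hg := h.glue_copy hf (by norm_num) lowN_lt earTable_lowN hA (fun i hi hc a ha hadj => by
      have ha' := haL a ha
      have hi' := lowCol_none i hi hc
      rcases hi' with rfl | rfl
      · have := hl.nbr_u a hadj.symm
        simp at ha'; tauto
      · have := hl.nbr_w a hadj.symm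
        simp at ha'; tauto) (meeting G (A : Set V) \ {s(c, p)}) Set.sdiff_subset (by
    intro a ha i hi j hj hij hc hi1 hj1
    have ha' := haL a ha
    have hcases := lowCol_eq i hi j hj hij hc
    have hpc : ∀ a, s(a, p) ∈ meeting G (A : Set V) \ {s(c, p)} → G.Adj a t' → False := by
      intro a hap hat
      exact not_two_common h.noCycle hpt' (fun e : a = c => hap.2 (by subst e; rfl)) hap.1.1 hat
        h1 h2
    rcases hcases with (rfl | rfl) | ⟨rfl, rfl⟩ | ⟨rfl, rfl⟩ | ⟨rfl, rfl⟩ | ⟨rfl, rfl⟩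
    · have := hl.nbr_u a (G.adj_symm hi1.1.1)
      simp at ha'; tauto
    · have := hl.nbr_w a (G.adj_symm hi1.1.1)
      simp at ha'; tauto
    · exact hpc a hi1 hj1.1.1
    · exact hpc a hj1 hi1.1.1
    · exact hno a ha' hi1.1.1 hj1.1.1
    · exact hno a ha' hj1.1.1 hi1.1.1)
  have hmem : s(c, p) ∈ meeting G (A : Set V) := ⟨h1, c, hcA, by simp⟩
  have hm := Set.ncard_sdiff_singleton_add_one hmem
  have he := h.card_edges
  have hd := ncard_del G (A : Set V)
  -- chords of the configuration would form a four-cycle with `c`, so it spans only eight edges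
  have hsub : (del G (A : Set V)).edgeSet ⊆ (({s(u, w), s(u, p), s(u, p'), s(w, s), s(s, t),
      s(s, t'), s(p, t), s(p', t')} : Finset (Sym2 V)) : Set (Sym2 V)) := by
    intro e hedge
    induction e with
    | h x y =>
    obtain ⟨hxy, hx, hy⟩ := hedge
    have hidx : ∀ x y, G.Adj x y → x ∉ A → ∃ i < 7, [u, w, s, p, p', t, t'].getD i u = x := by
      intro x y hxy hx
      have hxS := h.supp x y hxy
      rw [hA, Finset.mem_sdiff] at hx
      simpa [hxS] using hx
    obtain ⟨i, hi, rfl⟩ := hidx x y hxy hx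
    obtain ⟨j, hj, rfl⟩ := hidx y _ hxy.symm hy
    have hij : i ≠ j := fun e => hxy.ne (e ▸ rfl)
    have htt : t ≠ c := by rintro rfl; simp at hnd
    have hpp : p' ≠ c := by rintro rfl; simp at hnd
    have ht := lowN_chord i hi j hj
    simp [hij] at ht
    simp only [or_assoc] at ht
    rcases ht with h3 | h3 | ⟨rfl, rfl⟩ | ⟨rfl, rfl⟩ | ⟨rfl, rfl⟩ | ⟨rfl, rfl⟩
    · have := PathThrough.add_ne_copy (A := ∅) h.noCycle hf lowN_lt (by simp) hi hj hij
        (.single _ hxy) h3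
      omega
    · clear hxy hx hy
      interval_cases i <;> simp [lowN] at h3 <;> rcases h3 with rfl | rfl | rfl <;> simp
    · exact (not_two_common h.noCycle hpt' hpp (SimpleGraph.Adj.symm hxy) hl.pt' h1 h2).elim
    · exact (not_two_common h.noCycle hpt' hpp hxy hl.pt' h1 h2).elim
    · exact (not_two_common h.noCycle hpt' htt hl.pt.symm hxy h1 h2).elim
    · exact (not_two_common h.noCycle hpt' htt hl.pt.symm (SimpleGraph.Adj.symm hxy) h1 h2).elim
  have h8 : (del G (A : Set V)).edgeSet.ncard ≤ 8 := by
    refine (Set.ncard_le_ncard hsub).trans ?_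
    rw [Set.ncard_coe_finset]
    repeat refine (Finset.card_insert_le _ _).trans (Nat.succ_le_succ ?_)
    simp
  omega

theorem MinCounterexample.not_lowPair [Finite V] (h : MinCounterexample G S)
    {u w s p p' t t' : V} (hl : LowPair G u w s p p' t t') : False := by
  classical
  by_cases hc : ∃ c, c ∉ [u, w, s, p, p', t, t'] ∧ G.Adj c p ∧ G.Adj c t'
  · obtain ⟨c, hnd, h1, h2⟩ := hc
    by_cases hc' : ∃ c', c' ∉ [u, w, s, p, p', t, t'] ∧ G.Adj c' p' ∧ G.Adj c' t
    · obtain ⟨c', hnd', h3, h4⟩ := hc'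
      exact h.lowPair_two hl hnd hnd' h1 h2 h3 h4
    · push Not at hc'
      exact h.lowPair_one hl hnd h1 h2 hc'
  · push Not at hc
    by_cases hc' : ∃ c', c' ∉ [u, w, s, p, p', t, t'] ∧ G.Adj c' p' ∧ G.Adj c' t
    · obtain ⟨c', hnd', h3, h4⟩ := hc'
      refine h.lowPair_one hl.swap (by simp at hnd' ⊢; tauto) h3 h4 fun x hx => hc x ?_
      simp at hx ⊢; tauto
    · push Not at hc'
      refine h.no_copy hl.isCopy (by norm_num) (by norm_num) lowN_lt earTable_lowN ?_ ?_
      · intro i hi hcol a ha hadj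
        have ha' := getD_notMem (L := [u, w, s, p, p', t, t']) rfl (Finset.mem_sdiff.1 ha).2
        have hi' := lowCol_none i hi hcol
        rcases hi' with rfl | rfl
        · have := hl.nbr_u a hadj.symm
          simp at ha'; tauto
        · have := hl.nbr_w a hadj.symm
          simp at ha'; tauto
      · intro i hi j hj hij hcol a ha hi1 hj1
        have ha' := getD_notMem (L := [u, w, s, p, p', t, t']) rfl (Finset.mem_sdiff.1 ha).2
        have hcases := lowCol_eq i hi j hj hij hcol
        rcases hcases with (rfl | rfl) | ⟨rfl, rfl⟩ | ⟨rfl, rfl⟩ | ⟨rfl, rfl⟩ | ⟨rfl, rfl⟩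
        · have := hl.nbr_u a hi1.symm
          simp at ha'; tauto
        · have := hl.nbr_w a hi1.symm
          simp at ha'; tauto
        · exact hc a ha' hi1 hj1
        · exact hc a ha' hj1 hi1
        · exact hc' a ha' hi1 hj1
        · exact hc' a ha' hj1 hi1

end

/-! ### The bound for graphs without a Petersen graph minus an edge -/

theorem no_seven_cycle {V : Type u} {G : SimpleGraph V} (hG : ¬ HasCycleMod G 1 3)
    {a b c d e f g : V}
    (hnd : [a, b, c, d, e, f, g].Nodup) (h1 : G.Adj a b) (h2 : G.Adj b c) (h3 : G.Adj c d)
    (h4 : G.Adj d e) (h5 : G.Adj e f) (h6 : G.Adj f g) : ¬ G.Adj g a := by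
  intro h7
  have hf : IsCopy (fun i => [(i + 1) % 7]) 7 G (fun i => [a, b, c, d, e, f, g].getD i a) := by
    refine .of_list _ _ rfl hnd fun i hi j hj => ?_
    rw [List.mem_singleton] at hj
    subst hj
    interval_cases i <;> assumption
  have := PathThrough.add_ne_copy (A := ∅) (i := 0) (j := 6) (r := 0) hG hf
    (by decide) (by simp) (by norm_num) (by norm_num) (by norm_num) (.single _ h7.symm)
    (by decide)
  omega

section
variable {V : Type u} [Fintype V] [DecidableEq V] {G : SimpleGraph V} [DecidableRel G.Adj]
  {S : Finset V}

theorem sum_degree_eq {V : Type u} [Fintype V] {G : SimpleGraph V} [DecidableRel G.Adj] :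
     ∑ v, G.degree v = 2 * G.edgeSet.ncard := by
  rw [G.sum_degrees_eq_twice_card_edges, Set.ncard_eq_toFinset_card', edgeFinset]

theorem meeting_singleton_le (v : V) :
    (meeting G (({v} : Finset V) : Set V)).ncard ≤ G.degree v := by
  have hsub : meeting G (({v} : Finset V) : Set V) ⊆
      (((G.neighborFinset v).image fun x => s(v, x) : Finset (Sym2 V)) : Set (Sym2 V)) := by
    rintro e ⟨he, x, hx, hxe⟩
    simp only [Finset.coe_singleton, Set.mem_singleton_iff] at hx
    subst hx
    obtain ⟨y, rfl⟩ := Sym2.mem_iff_exists.1 hxe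
    simp only [Finset.coe_image, Set.mem_image, Finset.mem_coe, mem_neighborFinset]
    exact ⟨y, he, rfl⟩
  refine (Set.ncard_le_ncard hsub).trans ?_
  rw [Set.ncard_coe_finset]
  exact Finset.card_image_le

theorem exists_other_nbr {v w : V} (hw : G.degree w = 2) (hwv : G.Adj w v) :
    ∃ s, s ≠ v ∧ G.Adj w s ∧ ∀ x, G.Adj w x → x = v ∨ x = s := by
  rw [← card_neighborFinset_eq_degree, Finset.card_eq_two] at hw
  obtain ⟨a, b, hab, hN⟩ := hw
  have hmem : ∀ x, G.Adj w x ↔ x = a ∨ x = b := fun x => by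
    rw [← mem_neighborFinset, hN]; simp
  rcases (hmem v).1 hwv with rfl | rfl
  · exact ⟨b, hab.symm, (hmem b).2 (.inr rfl), fun x hx => (hmem x).1 hx⟩
  · exact ⟨a, hab, (hmem a).2 (.inl rfl), fun x hx => ((hmem x).1 hx).symm⟩

theorem MinCounterexample.two_le_degree (h : MinCounterexample G S) {v : V} (hv : v ∈ S) :
    2 ≤ G.degree v := by
  have he := h.card_edges
  have h1 := h.meeting_ge (X := {v}) (by simpa using hv) (by simp) (fun e => by
    rw [← e] at he; simp at he)
  have h2 := meeting_singleton_le (G := G) v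
  simp only [Finset.card_singleton] at h1
  omega

/-- The number of neighbours of degree two. -/
def lowDegree (G : SimpleGraph V) [DecidableRel G.Adj] (v : V) : ℕ :=
  ((G.neighborFinset v).filter fun w => G.degree w = 2).card

theorem MinCounterexample.lowNbrs_indep (h : MinCounterexample G S) {v w : V}
    (hvw : G.Adj v w) (hv : G.degree v = 2) (hw : G.degree w = 2) : False := by
  obtain ⟨a, ha, hva, hNv⟩ := exists_other_nbr hv hvw
  obtain ⟨b, hb, hwb, hNw⟩ := exists_other_nbr hw hvw.symm
  have hcard : ({v, w} : Finset V).card = 2 := Finset.card_pair hvw.ne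
  have hsub : meeting G (({v, w} : Finset V) : Set V) ⊆
      (({s(v, w), s(v, a), s(w, b)} : Finset (Sym2 V)) : Set (Sym2 V)) := by
    rintro e ⟨he, x, hx, hxe⟩
    obtain ⟨y, rfl⟩ := Sym2.mem_iff_exists.1 hxe
    simp only [Finset.coe_insert, Finset.coe_singleton, Set.mem_insert_iff,
      Set.mem_singleton_iff] at hx ⊢
    rcases hx with rfl | rfl
    · rcases hNv y he with rfl | rfl <;> simp
    · rcases hNw y he with rfl | rfl
      · exact .inl Sym2.eq_swap
      · simp
  have h3 : (meeting G (({v, w} : Finset V) : Set V)).ncard ≤ 3 := by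
    refine (Set.ncard_le_ncard hsub).trans ?_
    rw [Set.ncard_coe_finset]
    exact Finset.card_le_three
  have he := h.card_edges
  have hvS := h.supp _ _ hvw
  have hwS := h.supp _ _ hvw.symm
  have hXS : ({v, w} : Finset V) ≠ S := fun e => by
    rw [← e, hcard] at he
    -- a graph on two vertices has at most one edge
    have h4 : G.edgeSet ⊆ {s(v, w)} := by
      intro f hf
      induction f with
      | h x y =>
        have hx := h.supp x y hf
        have hy := h.supp y x (SimpleGraph.Adj.symm hf)
        have hne : x ≠ y := SimpleGraph.Adj.ne hf
        rw [← e] at hx hy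
        simp at hx hy ⊢
        rcases hx with rfl | rfl <;> rcases hy with rfl | rfl <;> simp_all
    have := Set.ncard_le_ncard h4
    rw [Set.ncard_singleton] at this
    omega
  have := h.meeting_ge (X := {v, w}) (by
    intro x hx; simp at hx; rcases hx with rfl | rfl <;> assumption) (by simp) hXS
  omega

/-- Discharging: every vertex of degree two passes a deficit of one half to each neighbour. -/
theorem MinCounterexample.exists_low (h : MinCounterexample G S) :
    ∃ v, 3 ≤ G.degree v ∧ 2 * G.degree v < lowDegree G v + 6 := by
  by_contra! hcon
  have he := h.card_edges
  have hsum : ∑ v ∈ S, G.degree v = 2 * G.edgeSet.ncard := by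
    rw [← sum_degree_eq]
    refine Finset.sum_subset (Finset.subset_univ S) fun v _ hv => ?_
    rw [← card_neighborFinset_eq_degree, Finset.card_eq_zero, Finset.eq_empty_iff_forall_notMem]
    intro w hw
    exact hv (h.supp v w (by simpa using hw))
  -- double counting of the edges between vertices of degree two and the others
  have hlow : ∑ v ∈ S with G.degree v ≠ 2, lowDegree G v =
      2 * (S.filter (G.degree · = 2)).card := by
    have := Finset.sum_card_bipartiteAbove_eq_sum_card_bipartiteBelow
      (s := S.filter (G.degree · ≠ 2)) (t := S.filter (G.degree · = 2)) G.Adj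
    have h1 : ∀ v ∈ S.filter (G.degree · ≠ 2),
        ((S.filter (G.degree · = 2)).bipartiteAbove G.Adj v).card = lowDegree G v := by
      intro v hv
      unfold lowDegree
      congr 1
      ext w
      simp only [Finset.bipartiteAbove, Finset.mem_filter, mem_neighborFinset]
      constructor
      · rintro ⟨⟨-, h2⟩, h3⟩; exact ⟨h3, h2⟩
      · rintro ⟨h3, h2⟩; exact ⟨⟨h.supp w v h3.symm, h2⟩, h3⟩
    have h2 : ∀ w ∈ S.filter (G.degree · = 2),
        ((S.filter (G.degree · ≠ 2)).bipartiteBelow G.Adj w).card = 2 := by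
      intro w hw
      rw [Finset.mem_filter] at hw
      refine Eq.trans ?_ ((card_neighborFinset_eq_degree G w).trans hw.2)
      congr 1
      ext v
      simp only [Finset.bipartiteBelow, Finset.mem_filter, mem_neighborFinset]
      constructor
      · rintro ⟨-, h3⟩; exact h3.symm
      · intro h3
        exact ⟨⟨h.supp v w h3.symm, fun h4 => h.lowNbrs_indep h3 hw.2 h4⟩, h3.symm⟩
    rw [Finset.sum_congr rfl h1, Finset.sum_congr rfl h2] at this
    rw [this, Finset.sum_const, smul_eq_mul, mul_comm]
  have hsplit := Finset.sum_filter_add_sum_filter_not S (G.degree · = 2) (G.degree ·)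
  have h2 : ∑ v ∈ S with G.degree v = 2, G.degree v = 2 * (S.filter (G.degree · = 2)).card := by
    rw [Finset.sum_congr rfl (g := fun _ => 2) (by
       intro v hv; simpa using (Finset.mem_filter.1 hv).2)]
    simp [mul_comm]
  have hcard := Finset.card_filter_add_card_filter_not (s := S) (G.degree · = 2)
  have h3 : ∑ v ∈ S with G.degree v ≠ 2, (lowDegree G v + 6) ≤
      ∑ v ∈ S with G.degree v ≠ 2, 2 * G.degree v := by
    refine Finset.sum_le_sum fun v hv => hcon v ?_
    rw [Finset.mem_filter] at hv
    have := h.two_le_degree hv.1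
    omega
  rw [Finset.sum_add_distrib, Finset.sum_const, smul_eq_mul, ← Finset.mul_sum, hlow] at h3
  simp only [ne_eq] at h3
  omega

/-- The vertices and edges that a low vertex and its neighbours of degree two span. -/
theorem MinCounterexample.star (h : MinCounterexample G S) {v : V} (hv : 3 ≤ G.degree v)
    {X : Finset V}
    (hX : X = insert v ((G.neighborFinset v).filter fun w => G.degree w = 2)) :
    X ⊆ S ∧ X.card = lowDegree G v + 1 ∧
    (meeting G (X : Set V)).ncard ≤ G.degree v + lowDegree G v := by
  obtain ⟨a, ha⟩ : (G.neighborFinset v).Nonempty := by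
    rw [← Finset.card_pos, card_neighborFinset_eq_degree]; omega
  have hvS : v ∈ S := h.supp v a (by simpa using ha)
  subst hX
  refine ⟨?_, ?_, ?_⟩
  · intro x hx
    simp only [Finset.mem_insert, Finset.mem_filter, mem_neighborFinset] at hx
    rcases hx with rfl | hx
    · exact hvS
    · exact h.supp x v hx.1.symm
  · rw [Finset.card_insert_of_notMem (by simp)]; rfl
  · have hex : ∀ w, ∃ s, G.degree w = 2 → G.Adj w v → ∀ x, G.Adj w x → x = v ∨ x = s := by
      intro w
      by_cases hw : G.degree w = 2 ∧ G.Adj w v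
      · obtain ⟨s, -, -, hs⟩ := exists_other_nbr hw.1 hw.2
        exact ⟨s, fun _ _ => hs⟩
      · exact ⟨v, fun h1 h2 => absurd ⟨h1, h2⟩ hw⟩
    choose s hs using hex
    have hsub : meeting G ((insert v ((G.neighborFinset v).filter fun w => G.degree w = 2) :
        Finset V) : Set V) ⊆ (((G.neighborFinset v).image (fun x => s(v, x)) ∪
          ((G.neighborFinset v).filter fun w => G.degree w = 2).image (fun w => s(w, s w)) :
          Finset (Sym2 V)) : Set (Sym2 V)) := by
      rintro e ⟨he, x, hx, hxe⟩
      obtain ⟨y, rfl⟩ := Sym2.mem_iff_exists.1 hxe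
      have hxy : G.Adj x y := he
      simp only [Finset.coe_insert, Set.mem_insert_iff, Finset.mem_coe, Finset.mem_filter,
        mem_neighborFinset, Finset.coe_union, Finset.coe_image, Set.mem_union,
        Set.mem_image] at hx ⊢
      rcases hx with rfl | ⟨hx1, hx2⟩
      · exact .inl ⟨y, hxy, rfl⟩
      · rcases hs x hx2 hx1.symm y hxy with rfl | rfl
        · exact .inl ⟨x, hx1, Sym2.eq_swap⟩
        · exact .inr ⟨x, ⟨hx1, hx2⟩, rfl⟩
    refine (Set.ncard_le_ncard hsub).trans ?_
    rw [Set.ncard_coe_finset]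
    refine (Finset.card_union_le _ _).trans (Nat.add_le_add ?_ Finset.card_image_le)
    exact Finset.card_image_le

/-- A vertex whose neighbours of degree two make it low has exactly one such neighbour, and
degree three. -/
theorem MinCounterexample.low_eq (h : MinCounterexample G S) {v : V} (hv : 3 ≤ G.degree v)
    (hlow : 2 * G.degree v < lowDegree G v + 6) : G.degree v = 3 ∧ lowDegree G v = 1 := by
  obtain ⟨X, hX⟩ : ∃ X, X = insert v ((G.neighborFinset v).filter fun w => G.degree w = 2) :=
    ⟨_, rfl⟩
  obtain ⟨W, hW⟩ : ∃ W, W = (G.neighborFinset v).filter fun w => G.degree w = 2 := ⟨_, rfl⟩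
  obtain ⟨hXS, hXcard, hXm⟩ := h.star hv hX
  have hWd : W.card = lowDegree G v := by rw [hW]; rfl
  have hle : lowDegree G v ≤ G.degree v := by
    rw [← card_neighborFinset_eq_degree]; exact Finset.card_filter_le _ _
  have h4 := h.p4Free
  have hWmem : ∀ w, w ∈ W ↔ G.Adj v w ∧ G.degree w = 2 := by simp [hW]
  have hXmem : ∀ x, x ∈ X ↔ x = v ∨ x ∈ W := by simp [hX, hW]
  have hex : ∀ w, ∃ s, w ∈ W → s ≠ v ∧ G.Adj w s := by
    intro w
    by_cases hw : w ∈ W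
    · obtain ⟨s, hs⟩ := exists_other_nbr ((hWmem w).1 hw).2 ((hWmem w).1 hw).1.symm
      exact ⟨s, fun _ => ⟨hs.1, hs.2.1⟩⟩
    · exact ⟨v, fun h => absurd h hw⟩
  choose s hs using hex
  have hvW : ∀ w ∈ W, G.Adj v w := fun w hw => ((hWmem w).1 hw).1
  have hsX : ∀ w ∈ W, s w ∉ X := by
    intro w hw hmem
    rcases (hXmem _).1 hmem with h1 | h1
    · exact (hs w hw).1 h1
    · exact h.lowNbrs_indep (hs w hw).2 ((hWmem w).1 hw).2 ((hWmem _).1 h1).2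
  have hsinj : ∀ w ∈ W, ∀ w' ∈ W, w ≠ w' → s w ≠ s w' := by
    intro w hw w' hw' hne e
    exact not_two_common h.noCycle (hs w hw).1.symm hne (hvW w hw).symm (hs w hw).2
      (hvW w' hw').symm (e ▸ (hs w' hw').2)
  -- a path of length four through `X` joins `s w` to `s w'`; were they not adjacent, the edge
  -- between them could be added after deleting `X`
  have hsadj : ∀ w ∈ W, ∀ w' ∈ W, w ≠ w' → G.Adj (s w) (s w') := by
    intro w hw w' hw' hne
    by_contra hn
    have := h.add_edge h4 hXS (hsinj w hw w' hw' hne) (hsX w hw) (hsX w' hw')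
      ((hXmem w).2 (.inr hw)) ((hXmem v).2 (.inl rfl)) ((hXmem w').2 (.inr hw')) hne
      (hs w hw).2.symm (hvW w hw).symm (hvW w' hw') (hs w' hw').2 hn
    omega
  -- four of the pairwise adjacent vertices `s w` would contain a four-cycle
  have hj3 : W.card ≤ 3 := by
    by_contra hcon
    obtain ⟨U, hU, hU4⟩ := Finset.exists_subset_card_eq (show 4 ≤ W.card by omega)
    obtain ⟨a, b, c, d, hab, hac, had, hbc, hbd, hcd, rfl⟩ := Finset.card_eq_four.1 hU4
    have ha : a ∈ W := hU (by simp)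
    have hb : b ∈ W := hU (by simp)
    have hc : c ∈ W := hU (by simp)
    have hd : d ∈ W := hU (by simp)
    exact not_two_common h.noCycle (hsinj a ha c hc hac) (hsinj b hb d hd hbd)
      (hsadj b hb a ha hab.symm) (hsadj b hb c hc hbc) (hsadj d hd a ha had.symm)
      (hsadj d hd c hc hcd.symm)
  have he := h.card_edges
  have hF1 : X ≠ S → 3 * X.card + 1 ≤ 2 * (meeting G (X : Set V)).ncard := fun hne =>
    h.meeting_ge hXS ⟨v, (hXmem v).2 (.inl rfl)⟩ hne
  by_cases hj1 : lowDegree G v = 1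
  · omega
  exfalso
  -- the remaining cases have at least two neighbours of degree two
  obtain ⟨w₁, hw₁, w₂, hw₂, hw₁₂⟩ := Finset.one_lt_card.1 (show 1 < W.card by omega)
  have hne : X ≠ S := fun e => hsX w₁ hw₁ (e ▸ h.supp _ _ (hs w₁ hw₁).2.symm)
  have := hF1 hne
  have hp : ∃ p, G.Adj v p ∧ p ∉ W := by
    by_contra! hcon
    have : (G.neighborFinset v).card ≤ W.card := Finset.card_le_card fun x hx =>
      hcon x (by simpa using hx)
    rw [card_neighborFinset_eq_degree] at this
    omega
  -- `X` meets at least `(3 |X| + 1) / 2` edges, which leaves the values `(3, 2)` and `(4, 3)` of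
  -- the degree and low degree; identify a further neighbour `p` of `v` with `s w`
  obtain ⟨p, hvp, hpW⟩ := hp
  have hpX : p ∉ X := fun hmem => by
    rcases (hXmem _).1 hmem with h1 | h1
    · exact hvp.ne h1.symm
    · exact hpW h1
  have hother : ∀ w ∈ W, ∃ w' ∈ W, w ≠ w' := by
    intro w hw
    by_cases hww : w = w₁
    · exact ⟨w₂, hw₂, hww ▸ hw₁₂⟩
    · exact ⟨w₁, hw₁, hww⟩
  have hps : ∀ w ∈ W, p ≠ s w := by
    rintro w hw rfl
    obtain ⟨w', hw', hne⟩ := hother w hw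
    exact not_two_common h.noCycle (p := v) (s := s w') (a := s w) (b := w')
      (hs w' hw').1.symm (fun e => hpX (e ▸ (hXmem _).2 (.inr hw'))) hvp.symm
      (hsadj w hw w' hw' hne) (hvW w' hw').symm (hs w' hw').2
  have hpadj : ∀ w ∈ W, ¬ G.Adj p (s w) := by
    intro w hw hadj
    exact not_two_common h.noCycle (p := v) (s := s w) (a := p) (b := w)
      (hs w hw).1.symm (fun e => hpW (e ▸ hw)) hvp.symm hadj (hvW w hw).symm (hs w hw).2
  have hid : ∀ w ∈ W, _ := fun w hw => h.identify h4 hXS (hps w hw) hpX (hsX w hw)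
    ((hXmem v).2 (.inl rfl)) ((hXmem w).2 (.inr hw)) hvp.symm (hvW w hw) (hs w hw).2 (hpadj w hw)
  rcases hid w₁ hw₁ with h5 | ⟨h5, b, hbX, hbp, hbs⟩
  · omega
  -- the degree is four, and `p` and `s w₁` have a common neighbour `b`, which closes the cycle
  -- `v, w₂, s w₂, s w₃, s w₁, b, p`
  have hW3 : W.card = 3 := by omega
  obtain ⟨w₃, hw₃⟩ : ((W.erase w₁).erase w₂).Nonempty := by
    rw [← Finset.card_pos, Finset.card_erase_of_mem (by simp [hw₁₂.symm, hw₂]),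
      Finset.card_erase_of_mem hw₁]
    omega
  simp only [Finset.mem_erase] at hw₃
  obtain ⟨hw₃₂, hw₃₁, hw₃⟩ := hw₃
  have hWX : ∀ w ∈ W, w ∈ X := fun w hw => (hXmem w).2 (.inr hw)
  have n1 : ∀ w ∈ W, ∀ w' ∈ W, w ≠ s w' := fun w hw w' hw' e => hsX w' hw' (e ▸ hWX w hw)
  have n2 : ∀ w ∈ W, b ≠ s w := fun w hw e => hpadj w hw (e ▸ hbp.symm)
  have hvX : v ∈ X := (hXmem v).2 (.inl rfl)
  refine no_seven_cycle (G := G) h.noCycle (a := v) (b := w₂) (c := s w₂) (d := s w₃) (e := s w₁)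
    (f := b) (g := p) ?_ (hvW w₂ hw₂) (hs w₂ hw₂).2 (hsadj w₂ hw₂ w₃ hw₃ hw₃₂.symm)
    (hsadj w₃ hw₃ w₁ hw₁ hw₃₁) hbs.symm hbp hvp.symm
  have := n1 w₂ hw₂
  have m1 := (hvW w₂ hw₂).ne
  have m2 := (hs w₁ hw₁).1.symm
  have m3 := (hs w₂ hw₂).1.symm
  have m4 := (hs w₃ hw₃).1.symm
  have m5 : v ≠ b := fun e => hbX (e ▸ hvX)
  have m6 := hvp.ne
  have m7 : w₂ ≠ b := fun e => hbX (e ▸ hWX _ hw₂)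
  have m8 : w₂ ≠ p := fun e => hpW (e ▸ hw₂)
  have m9 := hsinj w₂ hw₂ w₃ hw₃ hw₃₂.symm
  have m10 := hsinj w₂ hw₂ w₁ hw₁ hw₁₂.symm
  have m11 := hsinj w₃ hw₃ w₁ hw₁ hw₃₁
  simp only [List.nodup_cons, List.mem_cons, List.not_mem_nil, or_false, not_or, not_false_iff,
    List.nodup_nil, and_true]
  refine ⟨⟨m1, m3, m4, m2, m5, m6⟩, ⟨this _ hw₂, this _ hw₃, this _ hw₁, m7, m8⟩,
    ⟨m9, m10, (n2 _ hw₂).symm, (hps _ hw₂).symm⟩, ⟨m11, (n2 _ hw₃).symm, (hps _ hw₃).symm⟩,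
    ⟨(n2 _ hw₁).symm, (hps _ hw₁).symm⟩, hbp.ne⟩

theorem MinCounterexample.false (h : MinCounterexample G S) : False := by
  obtain ⟨u, hu, hlow⟩ := h.exists_low
  obtain ⟨hu3, hu1⟩ := h.low_eq hu hlow
  obtain ⟨hXS, hXcard, hXm⟩ := h.star hu rfl
  have h4 := h.p4Free
  obtain ⟨w, hw⟩ := Finset.card_eq_one.1 hu1
  have hw' : G.Adj u w ∧ G.degree w = 2 := by
    have : w ∈ (G.neighborFinset u).filter fun w => G.degree w = 2 := by rw [hw]; simp
    simpa using this
  rw [hw, hu3, hu1] at hXm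
  rw [hw] at hXcard hXS
  rw [hu1] at hXcard
  obtain ⟨huw, hdw⟩ := hw'
  obtain ⟨s, hsu, hws, hNw⟩ := exists_other_nbr hdw huw.symm
  have herase : ((G.neighborFinset u).erase w).card = 2 := by
    rw [Finset.card_erase_of_mem (by simpa using huw), card_neighborFinset_eq_degree, hu3]
  obtain ⟨p, p', hpp, hN⟩ := Finset.card_eq_two.1 herase
  have hNu : ∀ x, (G.Adj u x ∧ x ≠ w) ↔ x = p ∨ x = p' := by
    intro x
    have : x ∈ (G.neighborFinset u).erase w ↔ x ∈ ({p, p'} : Finset V) := by rw [hN]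
    simpa [and_comm] using this
  obtain ⟨hup, hpw⟩ := (hNu p).2 (.inl rfl)
  obtain ⟨hup', hpw'⟩ := (hNu p').2 (.inr rfl)
  have hX : ∀ x, x ∉ ({u, w} : Finset V) ↔ x ≠ u ∧ x ≠ w := by simp
  -- `s` is a new vertex
  have hsne : ∀ p p', p ≠ p' → G.Adj u p → p ≠ w → G.Adj u p' → p' ≠ w → s ≠ p := by
    rintro p p' hpp hup hpw hup' hpw' rfl
    by_cases hadj : G.Adj p' s
    · exact not_two_common h.noCycle (p := p') (s := w) (a := u) (b := s) hpw' hsu.symm hup' huw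
        hadj.symm hws.symm
    · rcases h.identify h4 hXS hpp.symm ((hX _).2 ⟨hup'.ne', hpw'⟩) ((hX _).2 ⟨hsu, hpw⟩)
        (x := u) (y := w) (by simp) (by simp) hup'.symm huw hws hadj with h5 | ⟨-, b, hbX, hb1, hb2⟩
      · omega
      · exact not_two_common h.noCycle hpp.symm ((hX _).1 hbX).1 hb1 hb2 hup' hup
  have hsp := hsne p p' hpp hup hpw hup' hpw'
  have hsp' := hsne p' p hpp.symm hup' hpw' hup hpw
  have hnadj : ∀ p, s ≠ p → G.Adj u p → p ≠ w → ¬ G.Adj p s := fun p hsp hup hpw hadj =>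
    not_two_common h.noCycle hsu.symm hpw hup.symm hadj huw.symm hws
  -- since `p` and `s` cannot be identified without loss, they have a common neighbour
  have hcom : ∀ p, s ≠ p → G.Adj u p → p ≠ w →
      ∃ t ∉ ({u, w} : Finset V), G.Adj t p ∧ G.Adj t s := by
    intro p hsp hup hpw
    rcases h.identify h4 hXS hsp.symm ((hX _).2 ⟨hup.ne', hpw⟩) ((hX _).2 ⟨hsu, hws.ne'⟩)
        (x := u) (y := w) (by simp) (by simp) hup.symm huw hws (hnadj p hsp hup hpw) with h5 | h5
    · omega
    · exact h5.2
  obtain ⟨t, htX, htp, hts⟩ := hcom p hsp hup hpw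
  obtain ⟨t', htX', htp', hts'⟩ := hcom p' hsp' hup' hpw'
  have htt : t ≠ t' := by
    rintro rfl
    exact not_two_common h.noCycle hpp ((hX _).1 htX).1 htp htp' hup hup'
  refine h.not_lowPair (u := u) (w := w) (s := s) (p := p) (p' := p') (t := t) (t' := t')
    ⟨?_, huw, hws, hup, hup', htp.symm, htp'.symm, hts.symm, hts'.symm, ?_, hNw⟩
  · have m1 : p ≠ t' := by rintro rfl; exact hnadj p hsp hup hpw hts'
    have m2 : p' ≠ t := by rintro rfl; exact hnadj p' hsp' hup' hpw' hts
    have m3 := (hX _).1 htX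
    have m4 := (hX _).1 htX'
    simp only [List.nodup_cons, List.mem_cons, List.not_mem_nil, or_false, not_or, not_false_iff,
      List.nodup_nil, and_true]
    exact ⟨⟨huw.ne, hsu.symm, hup.ne, hup'.ne, m3.1.symm, m4.1.symm⟩,
      ⟨hws.ne, hpw.symm, hpw'.symm, m3.2.symm, m4.2.symm⟩, ⟨hsp, hsp', hts.ne', hts'.ne'⟩,
      ⟨hpp, htp.ne', m1⟩, ⟨m2, htp'.ne'⟩, htt⟩
  · intro x hx
    by_cases hxw : x = w
    · exact .inl hxw
    · exact .inr ((hNu x).1 ⟨hx, hxw⟩)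

end

/-- A graph with neither a `(1 mod 3)`-cycle nor a Petersen graph minus an edge has at most
`3(n - 1)/2` edges. -/
theorem Sparse.card_edges_le (n : ℕ) : ∀ (V : Type u) [Finite V] (G : SimpleGraph V)
    (S : Finset V), Sparse G S → S.Nonempty → S.card = n →
    2 * G.edgeSet.ncard + 3 ≤ 3 * S.card := by
  induction n using Nat.strong_induction_on with
  | _ n ih =>
  intro V _ G S h hS hn
  classical
  have := Fintype.ofFinite V
  by_contra hcon
  have hpos := hS.card_pos
  -- pass to a subgraph that just violates the bound
  obtain ⟨E, hE, hEcard⟩ := Set.exists_subset_card_eq (s := G.edgeSet)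
    (n := (3 * S.card - 3) / 2 + 1) (by omega)
  obtain ⟨H, hHE⟩ : ∃ H : SimpleGraph V, H.edgeSet = E := by
    refine ⟨fromEdgeSet E, ?_⟩
    rw [edgeSet_fromEdgeSet]
    ext e
    exact ⟨fun h => h.1, fun h => ⟨h, fun hd => G.not_isDiag_of_mem_edgeSet (hE h) hd⟩⟩
  have hHG : H ≤ G := by
    rw [← edgeSet_subset_edgeSet, hHE]; exact hE
  have hHs : Sparse H S := ⟨fun x y hxy => h.supp x y (hHG hxy),
    fun hc => h.noCycle (hc.mono hHG), h.pFree.mono hHG⟩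
  have hcard : H.edgeSet.ncard = (3 * S.card - 3) / 2 + 1 := by rw [hHE, hEcard]
  have hsmall : ∀ (W : Type u) [Finite W] (H : SimpleGraph W) (T : Finset W), Sparse H T →
      T.Nonempty → T.card < S.card → 2 * H.edgeSet.ncard + 3 ≤ 3 * T.card :=
    fun W _ K T hK hT hlt => ih T.card (hn ▸ hlt) W K T hK hT rfl
  -- for even `n` this is a minimal counterexample; for odd `n` it has one more half edge
  rcases Nat.even_or_odd S.card with heven | hodd
  · obtain ⟨m, hm⟩ := heven
    exact MinCounterexample.false (G := H) (S := S)
      { hHs with card_edges := by omega, smaller := hsmall }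
  · obtain ⟨m, hm⟩ := hodd
    by_cases hm0 : m = 0
    · -- a single vertex
      obtain ⟨v, hv⟩ := Finset.card_eq_one.1 (show S.card = 1 by omega)
      have : H.edgeSet = ∅ := by
        ext e
        refine ⟨fun he => ?_, fun he => he.elim⟩
        induction e with
        | h x y =>
          have hx := hHs.supp x y he
          have hy := hHs.supp y x (SimpleGraph.Adj.symm he)
          rw [hv, Finset.mem_singleton] at hx hy
          exact (H.ne_of_adj he (hx.trans hy.symm)).elim
      rw [this] at hcard
      simp at hcard
    -- every degree is at least three, which makes too many edges
    have hdeg : ∀ v ∈ S, 3 ≤ H.degree v := by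
      intro v hv
      have h1 := hsmall V _ _ (hHs.del {v}) (by
        rw [← Finset.card_pos, Finset.card_sdiff_of_subset (by simpa using hv)]
        simp; omega) (by
        rw [Finset.card_sdiff_of_subset (by simpa using hv)]
        simp; omega)
      rw [Finset.card_sdiff_of_subset (by simpa using hv), Finset.card_singleton] at h1
      have h2 := ncard_del H (({v} : Finset V) : Set V)
      have h3 := meeting_singleton_le (G := H) v
      omega
    have h1 : S.card * 3 ≤ ∑ v ∈ S, H.degree v := by
      rw [← smul_eq_mul]; exact Finset.card_nsmul_le_sum _ _ _ hdeg
    have h2 : ∑ v ∈ S, H.degree v ≤ 2 * H.edgeSet.ncard := by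
      rw [← sum_degree_eq]
      exact Finset.sum_le_sum_of_subset (Finset.subset_univ S)
    omega

/-! ### Graphs containing a Petersen graph minus an edge -/

section
variable {V : Type u} {G : SimpleGraph V}

theorem exists_third {t : Finset V} (ht : G.IsNClique 3 t) {x y : V} (hx : x ∈ t) (hy : y ∈ t)
    (hxy : x ≠ y) : ∃ z ∈ t, G.Adj z x ∧ G.Adj z y ∧ ∀ w ∈ t, w = x ∨ w = y ∨ w = z := by
  classical
  have h1 : ((t.erase x).erase y).card = 1 := by
    rw [Finset.card_erase_of_mem (by simp [hxy.symm, hy]), Finset.card_erase_of_mem hx, ht.card_eq]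
  obtain ⟨z, hz⟩ := Finset.card_eq_one.1 h1
  have hmem : ∀ w, (w ≠ y ∧ w ≠ x ∧ w ∈ t) ↔ w = z := fun w => by
    have : w ∈ (t.erase x).erase y ↔ w ∈ ({z} : Finset V) := by rw [hz]
    simpa using this
  obtain ⟨h2, h3, h4⟩ := (hmem z).2 rfl
  refine ⟨z, h4, ht.isClique h4 hx h3, ht.isClique h4 hy h2, fun w hw => ?_⟩
  by_cases hwx : w = x
  · exact .inl hwx
  · by_cases hwy : w = y
    · exact .inr (.inl hwy)
    · exact .inr (.inr ((hmem w).1 ⟨hwy, hwx, hw⟩))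

theorem edgeDisjointTriangles (hG : ¬ HasCycleMod G 1 3) : G.EdgeDisjointTriangles := by
  intro t ht t' ht' hne x hx y hy
  by_contra hxy
  obtain ⟨z, hz, hzx, hzy, hzt⟩ := exists_third ht hx.1 hy.1 hxy
  obtain ⟨z', hz', hzx', hzy', hzt'⟩ := exists_third ht' hx.2 hy.2 hxy
  by_cases h : z = z'
  · subst h
    refine hne (Finset.ext fun w => ⟨fun hw => ?_, fun hw => ?_⟩)
    · rcases hzt w hw with rfl | rfl | rfl
      exacts [hx.2, hy.2, hz']
    · rcases hzt' w hw with rfl | rfl | rfl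
      exacts [hx.1, hy.1, hz]
  · exact not_two_common hG hxy h hzx hzy hzx' hzy'

theorem three_mul_triangles_le [Finite V] (hG : ¬ HasCycleMod G 1 3) :
    3 * (G.cliqueSet 3).ncard ≤ G.edgeSet.ncard := by
  classical
  have := Fintype.ofFinite V
  have h := (edgeDisjointTriangles hG).card_edgeFinset_le
  rw [← Set.ncard_coe_finset, ← Set.ncard_coe_finset, coe_cliqueFinset, coe_edgeFinset] at h
  exact h

end

/-- The colours used for gluing along the Petersen graph minus an edge. -/
def pmCol (i : ℕ) : Option (Fin 3) := some (petCol i)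

theorem earTable_pmN : earTable pmN 10 pmCol true = true := by decide +kernel

theorem pmN_lt' : ∀ i < 10, pmN i ≠ [] ∧ ∀ j ∈ pmN i, j < 10 := by decide

theorem pmN_common : ∀ i < 10, ∀ j < 10, i ≠ j → findPath pmN j 10 [i] i 2 = true := by
  decide +kernel

/-- Adjacency in the Petersen graph in terms of the labels of `pmN`. -/
def petAdj (i j : ℕ) : Bool := (pmN i).contains j || (i == 0 && j == 5) || (i == 5 && j == 0)

theorem pmN_chord : ∀ i < 10, ∀ j < 10,
    (i == j || findPath pmN j 10 [i] i 0 || petAdj i j) = true := by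
  decide +kernel

theorem petAdj_triangle : ∀ i < 10, ∀ j < 10, ∀ k < 10,
    (petAdj i j && petAdj j k && petAdj i k) = false := by
  decide +kernel

section
variable {V : Type u} {G : SimpleGraph V} {f : ℕ → V}

theorem petAdj_of_adj (hG : ¬ HasCycleMod G 1 3) (hf : IsCopy pmN 10 G f) {i j : ℕ} (hi : i < 10)
    (hj : j < 10) (hij : G.Adj (f i) (f j)) : petAdj i j = true := by
  have hne : i ≠ j := fun e => hij.ne (e ▸ rfl)
  have := pmN_chord i hi j hj
  simp only [Bool.or_eq_true, beq_iff_eq, hne, false_or] at this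
  rcases this with h | h
  · have := PathThrough.add_ne_copy (A := ∅) hG hf pmN_lt' (by simp) hi hj hne (.single _ hij) h
    omega
  · exact h

/-- A vertex outside a copy of the Petersen graph minus an edge has at most one neighbour in it. -/
theorem eq_of_common_nbr (hG : ¬ HasCycleMod G 1 3) (hf : IsCopy pmN 10 G f) {a : V}
    (ha : ∀ i < 10, f i ≠ a) {i j : ℕ} (hi : i < 10) (hj : j < 10) (h1 : G.Adj a (f i))
    (h2 : G.Adj a (f j)) : i = j := by
  by_contra hij
  have := PathThrough.add_ne_copy (A := {a}) hG hf pmN_lt' (by simpa using ha) hi hj hij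
    (pathThrough_two (fun e => hij (hf.inj i hi j hj e)) (by simpa using ha i hi) rfl h1 h2)
    (pmN_common i hi j hj hij)
  omega

theorem triangle_meets (hG : ¬ HasCycleMod G 1 3) (hf : IsCopy pmN 10 G f) {t : Finset V}
    (ht : G.IsNClique 3 t) {i j : ℕ} (hi : i < 10) (hj : j < 10) (hit : f i ∈ t) (hjt : f j ∈ t) :
    i = j := by
  by_contra hij
  have hne : f i ≠ f j := fun e => hij (hf.inj i hi j hj e)
  obtain ⟨z, -, h1, h2, -⟩ := exists_third ht hit hjt hne
  by_cases hz : ∃ k < 10, f k = z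
  · obtain ⟨k, hk, rfl⟩ := hz
    have h3 := petAdj_triangle k hk i hi j hj
    rw [petAdj_of_adj hG hf hk hi h1, petAdj_of_adj hG hf hk hj h2,
      petAdj_of_adj hG hf hi hj (ht.isClique hit hjt hne)] at h3
    simp at h3
  · push Not at hz
    exact hij (eq_of_common_nbr hG hf hz hi hj h1 h2)

/-- The graph induced on a copy of the Petersen graph minus an edge has at most fifteen edges. -/
theorem copy_edges_le [Finite V] (hG : ¬ HasCycleMod G 1 3) (hf : IsCopy pmN 10 G f) {A : Set V}
    (hA : ∀ x y, G.Adj x y → x ∉ A → ∃ i < 10, f i = x) : (del G A).edgeSet.ncard ≤ 15 := by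
  classical
  let E : Finset (Sym2 V) := ((Finset.range 10 ×ˢ Finset.range 10).filter
    fun e => petAdj e.1 e.2 = true ∧ e.1 < e.2).image fun e => s(f e.1, f e.2)
  have hsub : (del G A).edgeSet ⊆ (E : Set (Sym2 V)) := by
    intro e he
    induction e with
    | h x y =>
      obtain ⟨hxy, hx, hy⟩ := he
      obtain ⟨i, hi, rfl⟩ := hA x y hxy hx
      obtain ⟨j, hj, rfl⟩ := hA y _ hxy.symm hy
      simp only [E, Finset.coe_image, Set.mem_image, Finset.mem_coe, Finset.mem_filter,
        Finset.mem_product, Finset.mem_range]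
      have hne : i ≠ j := fun e => hxy.ne (e ▸ rfl)
      rcases lt_or_gt_of_ne hne with h | h
      · exact ⟨(i, j), ⟨⟨hi, hj⟩, petAdj_of_adj hG hf hi hj hxy, h⟩, rfl⟩
      · exact ⟨(j, i), ⟨⟨hj, hi⟩, petAdj_of_adj hG hf hj hi hxy.symm, h⟩, Sym2.eq_swap⟩
  refine (Set.ncard_le_ncard hsub).trans ?_
  rw [Set.ncard_coe_finset]
  refine Finset.card_image_le.trans ?_
  decide +kernel

theorem glueMap_eq_inl {col : V → Option (Fin 3)} {x y : V} (h : glueMap col x = .inl y) :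
    x = y := by
  unfold glueMap at h
  rcases hx : col x with _ | i <;> simp [hx] at h
  exact h

theorem glueMap_eq_inr {col : V → Option (Fin 3)} {x : V} {i : Fin 3}
    (h : glueMap col x = .inr i) : col x = some i := by
  unfold glueMap at h
  rcases hx : col x with _ | j <;> simp [hx] at h
  rw [h]

/-- Gluing along a copy of the Petersen graph minus an edge preserves the triangles of `G`, and
adds one. -/
theorem triangles_lt_glue [Finite V] (hG : ¬ HasCycleMod G 1 3) (hf : IsCopy pmN 10 G f) {A : Set V}
    (hAf : ∀ i < 10, f i ∉ A) (hA : ∀ x y, G.Adj x y → x ∈ A ∨ ∃ i < 10, f i = x) :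
    (G.cliqueSet 3).ncard + 1 ≤ ((triGlue G A (copyCol f 10 pmCol)).cliqueSet 3).ncard := by
  classical
  have hEar := (earCond_of_earTable hG hf pmN_lt' hAf earTable_pmN).1
  obtain ⟨φ, hφ⟩ : ∃ φ, φ = glueMap (copyCol f 10 pmCol) := ⟨_, rfl⟩
  have hφA : ∀ a ∈ A, φ a = .inl a := fun a ha => by
    simp [hφ, glueMap, col_eq_none_of_mem hEar ha]
  have hcolf : ∀ i < 10, copyCol f 10 pmCol (f i) = some (petCol i) := fun i hi =>
    copyCol_apply hf.inj hi
  have hφf : ∀ i < 10, φ (f i) = .inr (petCol i) := fun i hi => by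
    simp [hφ, glueMap, hcolf i hi]
  -- the part of a triangle outside `A` is at most one vertex
  have hverts : ∀ t, G.IsNClique 3 t → ∀ x ∈ t, x ∈ A ∨ ∃ i < 10, f i = x := by
    intro t ht x hx
    obtain ⟨y, hy, hxy⟩ := Finset.exists_mem_ne (by rw [ht.card_eq]; norm_num) x
    exact hA x y (ht.isClique hx hy hxy.symm)
  have htwo : ∀ t, G.IsNClique 3 t → ∀ x ∈ t, ∀ y ∈ t, x ≠ y → x ∈ A ∨ y ∈ A := by
    intro t ht x hx y hy hxy
    rcases hverts t ht x hx with h | ⟨i, hi, rfl⟩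
    · exact .inl h
    · rcases hverts t ht y hy with h | ⟨j, hj, rfl⟩
      · exact .inr h
      · exact absurd (congrArg f (triangle_meets hG hf ht hi hj hx hy)) hxy
  have hadj : ∀ t, G.IsNClique 3 t → ∀ x ∈ t, ∀ y ∈ t, x ≠ y →
      (triGlue G A (copyCol f 10 pmCol)).Adj (φ x) (φ y) := by
    have main : ∀ t, G.IsNClique 3 t → ∀ x ∈ t, ∀ y ∈ t, x ≠ y → x ∈ A →
        (triGlue G A (copyCol f 10 pmCol)).Adj (φ x) (φ y) := by
      intro t ht x hx y hy hxy hxA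
      rw [hφA x hxA]
      rcases hverts t ht y hy with h | ⟨j, hj, rfl⟩
      · rw [hφA y h]
        exact ⟨hxA, h, ht.isClique hx hy hxy⟩
      · rw [hφf j hj]
        exact ⟨hxA, f j, hcolf j hj, ht.isClique hx hy hxy⟩
    intro t ht x hx y hy hxy
    rcases htwo t ht x hx y hy hxy with h | h
    · exact main t ht x hx y hy hxy h
    · exact (main t ht y hy x hx hxy.symm h).symm
  let T : Finset (V ⊕ Fin 3) := {.inr 0, .inr 1, .inr 2}
  have hT : (triGlue G A (copyCol f 10 pmCol)).IsNClique 3 T := by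
    rw [is3Clique_triple_iff]
    exact ⟨(by decide : (0 : Fin 3) ≠ 1), (by decide : (0 : Fin 3) ≠ 2),
      (by decide : (1 : Fin 3) ≠ 2)⟩
  have hclique : ∀ t, G.IsNClique 3 t →
      (triGlue G A (copyCol f 10 pmCol)).IsNClique 3 (t.image φ) := by
    intro t ht
    refine ⟨?_, ?_⟩
    · intro x hx y hy hne
      simp only [Finset.coe_image, Set.mem_image, Finset.mem_coe] at hx hy
      obtain ⟨x, hx, rfl⟩ := hx
      obtain ⟨y, hy, rfl⟩ := hy
      exact hadj t ht x hx y hy (fun e => hne (e ▸ rfl))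
    · rw [Finset.card_image_of_injOn, ht.card_eq]
      intro x hx y hy e
      by_contra hne
      exact (hadj t ht x hx y hy hne).ne e
  have hexA : ∀ t, G.IsNClique 3 t → ∀ y, ∃ a ∈ t, a ∈ A ∧ a ≠ y := by
    intro t ht y
    obtain ⟨x, hx, hxy⟩ := Finset.exists_mem_ne (by rw [ht.card_eq]; norm_num) y
    by_cases hy : y ∈ t
    · obtain ⟨z, hz, hzx, hzy, -⟩ := exists_third ht hx hy hxy
      rcases htwo t ht x hx z hz hzx.ne' with h | h
      · exact ⟨x, hx, h, hxy⟩
      · exact ⟨z, hz, h, hzy.ne⟩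
    · obtain ⟨z, hz, hzx⟩ := Finset.exists_mem_ne (by rw [ht.card_eq]; norm_num) x
      rcases htwo t ht x hx z hz hzx.symm with h | h
      · exact ⟨x, hx, h, hxy⟩
      · exact ⟨z, hz, h, fun e => hy (e ▸ hz)⟩
  have hsubset : ∀ t, G.IsNClique 3 t → ∀ t', G.IsNClique 3 t' → t.image φ = t'.image φ →
      t ⊆ t' := by
    intro t ht t' ht' e
    have hinA : ∀ a ∈ t, a ∈ A → a ∈ t' := by
      intro a ha haA
      have h1 : φ a ∈ t'.image φ := e ▸ Finset.mem_image_of_mem φ ha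
      obtain ⟨a', ha', h2⟩ := Finset.mem_image.1 h1
      rw [hφA a haA, hφ] at h2
      rwa [← glueMap_eq_inl h2]
    intro y hy
    rcases hverts t ht y hy with h | ⟨i, hi, rfl⟩
    · exact hinA y hy h
    · have h1 : φ (f i) ∈ t'.image φ := e ▸ Finset.mem_image_of_mem φ hy
      obtain ⟨y', hy', h2⟩ := Finset.mem_image.1 h1
      rw [hφf i hi, hφ] at h2
      obtain ⟨j, hj, rfl, -⟩ := exists_of_copyCol (glueMap_eq_inr h2)
      obtain ⟨a, ha, haA, hay⟩ := hexA t ht (f i)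
      have haf : ∀ i < 10, f i ≠ a := fun i hi e => hAf i hi (e ▸ haA)
      have := eq_of_common_nbr hG hf haf hi hj (ht.isClique ha hy hay)
        (ht'.isClique (hinA a ha haA) hy' (haf j hj).symm)
      rwa [this]
  have hinj : Set.InjOn (fun t : Finset V => t.image φ) (G.cliqueSet 3) := by
    intro t ht t' ht' e
    exact (hsubset t ht t' ht' e).antisymm (hsubset t' ht' t ht e.symm)
  have hTnot : T ∉ (fun t : Finset V => t.image φ) '' G.cliqueSet 3 := by
    rintro ⟨t, ht, e⟩
    obtain ⟨a, ha, haA, -⟩ := hexA t ht (f 0)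
    have h1 : φ a ∈ T := e ▸ Finset.mem_image_of_mem φ ha
    rw [hφA a haA] at h1
    simp [T] at h1
  rw [← hinj.ncard_image, ← Set.ncard_insert_of_notMem hTnot]
  refine Set.ncard_le_ncard ?_
  rintro _ (rfl | ⟨t, ht, rfl⟩)
  · exact hT
  · exact hclique t ht

end

/-- Every graph without `(1 mod 3)`-cycles arises from gluing `p` times along a Petersen graph minus
an edge. Compared to the bound `3(n - 1)/2`, each step gains three half edges. It replaces ten
vertices by the three vertices of a new triangle; as each triangle in the end accounts for two
vertices, the step uses up nine, so that `p` is at most `(n - 1)/9`. -/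
theorem exists_card_edges_le (n : ℕ) : ∀ (V : Type u) [Finite V] (G : SimpleGraph V)
    (S : Finset V), (∀ x y, G.Adj x y → x ∈ S) → ¬ HasCycleMod G 1 3 → S.Nonempty → S.card = n →
    ∃ p, 2 * G.edgeSet.ncard + 3 ≤ 3 * S.card + 3 * p ∧
      9 * p + 2 * (G.cliqueSet 3).ncard + 1 ≤ S.card := by
  induction n using Nat.strong_induction_on with
  | _ n ih =>
  intro V _ G S hsupp hG hS hn
  classical
  by_cases hP : PFree G
  · refine ⟨0, ?_, ?_⟩
    · have := Sparse.card_edges_le n V G S ⟨hsupp, hG, hP⟩ hS hn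
      omega
    · have := Sparse.card_edges_le n V G S ⟨hsupp, hG, hP⟩ hS hn
      have := three_mul_triangles_le hG
      have := hS.card_pos
      omega
  · simp only [PFree, not_forall, not_not] at hP
    obtain ⟨f, hf⟩ := hP
    have himage : (Finset.range 10).image f ⊆ S := by
      intro x hx
      simp only [Finset.mem_image, Finset.mem_range] at hx
      obtain ⟨i, hi, rfl⟩ := hx
      obtain ⟨j, hj⟩ := exists_mem_pmN i hi
      exact hsupp _ _ (hf.adj i hi j hj)
    obtain ⟨A, hA⟩ : ∃ A, A = S \ (Finset.range 10).image f := ⟨_, rfl⟩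
    have hcard : A.card + 10 = S.card := by
      have := Finset.card_sdiff_add_card_eq_card himage
      rwa [Finset.card_image_of_injOn, Finset.card_range, ← hA] at this
      intro i hi j hj e
      simp only [Finset.coe_range, Set.mem_Iio] at hi hj
      exact hf.inj i hi j hj e
    have hAf : ∀ i < 10, f i ∉ (A : Set V) := by
      intro i hi hmem
      simp only [hA, Finset.coe_sdiff, Set.mem_sdiff, Finset.mem_coe, Finset.mem_image,
        Finset.mem_range] at hmem
      exact hmem.2 ⟨i, hi, rfl⟩
    have hout : ∀ x y, G.Adj x y → x ∈ (A : Set V) ∨ ∃ i < 10, f i = x := by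
      intro x y hxy
      by_cases hx : ∃ i < 10, f i = x
      · exact .inr hx
      · left
        rw [hA, Finset.mem_coe, Finset.mem_sdiff]
        exact ⟨hsupp x y hxy, by simpa using hx⟩
    have hE := (earCond_of_earTable hG hf pmN_lt' hAf earTable_pmN).1
    have he := triGlue_card hE (meeting G (A : Set V)) (fun e he => he.1) (fun e he => by
      obtain ⟨he1, a, ha, hae⟩ := he
      obtain ⟨b, rfl⟩ := Sym2.mem_iff_exists.1 hae
      refine ⟨a, b, rfl, ha, ?_⟩
      rcases hout b a (SimpleGraph.Adj.symm he1) with h | ⟨i, hi, rfl⟩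
      · exact .inl h
      · exact .inr ⟨_, copyCol_apply hf.inj hi⟩) (fun a ha ρ ρ' x hρ hρ' h1 h2 => by
      obtain ⟨i, hi, rfl, -⟩ := exists_of_copyCol hρ
      obtain ⟨j, hj, rfl, -⟩ := exists_of_copyCol hρ'
      rw [eq_of_common_nbr hG hf (fun i hi e => hAf i hi (e ▸ ha)) hi hj h1.1 h2.1])
    obtain ⟨p, hp1, hp2⟩ := ih (A.card + 3) (by omega) (V ⊕ Fin 3)
      (triGlue G (A : Set V) (copyCol f 10 pmCol)) (A.disjSum Finset.univ)
      (fun x y hxy => by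
        rcases x with x | i <;> rcases y with y | j
        · simpa using hxy.1
        · simpa using hxy.1
        · simp
        · simp) (triGlue_not_hasCycle hG hE) ⟨.inr 0, by simp⟩ (by simp [Finset.card_disjSum])
    have h15 := copy_edges_le (A := (A : Set V)) hG hf fun x y hxy hx =>
      (hout x y hxy).resolve_left hx
    have hd := ncard_del G (A : Set V)
    have ht := triangles_lt_glue hG hf hAf hout
    simp only [Finset.card_disjSum, Finset.card_univ, Fintype.card_fin] at hp1 hp2
    exact ⟨p + 1, by omega, by omega⟩

/-- A graph on `9q + r + 1` vertices, `r ≤ 8`, without `(1 mod 3)`-cycles has at most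
`15q + ⌊3r/2⌋` edges. -/
theorem card_edges_le {V : Type u} [Finite V] {G : SimpleGraph V} (hG : ¬ HasCycleMod G 1 3)
    {q r : ℕ} (hr : r ≤ 8) (hV : Nat.card V = 9 * q + r + 1) :
    G.edgeSet.ncard ≤ 15 * q + 3 * r / 2 := by
  classical
  have := Fintype.ofFinite V
  rw [Nat.card_eq_fintype_card] at hV
  have hne : (Finset.univ : Finset V).Nonempty := by
    rw [← Finset.card_pos, Finset.card_univ]; omega
  obtain ⟨p, h1, h2⟩ := exists_card_edges_le _ V G Finset.univ (by simp) hG hne rfl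
  rw [Finset.card_univ, hV] at h1 h2
  omega

/-! ### Blocks -/

section
variable {V : Type u} {G : SimpleGraph V}

theorem preconnected_iff {H : G.Subgraph} :
    H.Preconnected ↔ ∀ x ∈ H.verts, ∀ y ∈ H.verts, H.spanningCoe.Reachable x y := by
  constructor
  · intro h x hx y hy
    obtain ⟨p⟩ := h.coe ⟨x, hx⟩ ⟨y, hy⟩
    exact ⟨p.map ⟨Subtype.val, fun h => h⟩⟩
  · intro h
    refine ⟨fun ⟨x, hx⟩ ⟨y, hy⟩ => ?_⟩
    obtain ⟨p⟩ := h x hx y hy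
    clear h
    induction p with
    | nil => exact Reachable.refl _
    | @cons x z y e p ih =>
      have hz : z ∈ H.verts := H.edge_vert (Subgraph.Adj.symm e)
      have hadj : H.coe.Adj ⟨x, hx⟩ ⟨z, hz⟩ := e
      exact hadj.reachable.trans (ih hz hy)

theorem spanningCoe_deleteVerts (H : G.Subgraph) (v : V) :
    (H.deleteVerts {v}).spanningCoe = del H.spanningCoe {v} := by
  ext x y
  simp only [Subgraph.spanningCoe_adj, Subgraph.deleteVerts_adj, del, Set.mem_singleton_iff]
  constructor
  · rintro ⟨-, h1, -, h2, h3⟩; exact ⟨h3, h1, h2⟩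
  · rintro ⟨h3, h1, h2⟩; exact ⟨H.edge_vert h3, h1, H.edge_vert h3.symm, h2, h3⟩

theorem connectedNoCutVertex_iff {H : G.Subgraph} :
    ConnectedNoCutVertex H ↔ H.verts.Nonempty ∧
      (∀ x ∈ H.verts, ∀ y ∈ H.verts, H.spanningCoe.Reachable x y) ∧
      ∀ v, ∀ x ∈ H.verts, ∀ y ∈ H.verts, x ≠ v → y ≠ v →
        (del H.spanningCoe {v}).Reachable x y := by
  unfold ConnectedNoCutVertex
  rw [Subgraph.connected_iff, preconnected_iff]
  constructor
  · rintro ⟨⟨hconn, hne⟩, h⟩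
    refine ⟨hne, hconn, fun v x hx y hy hxv hyv => ?_⟩
    by_cases hv : v ∈ H.verts
    · have := preconnected_iff.1 (h v hv) x ⟨hx, hxv⟩ y ⟨hy, hyv⟩
      rwa [spanningCoe_deleteVerts] at this
    · refine (hconn x hx y hy).mono fun a b hab => ⟨hab, ?_, ?_⟩
      · rintro rfl; exact hv (H.edge_vert hab)
      · rintro rfl; exact hv (H.edge_vert (Subgraph.Adj.symm hab))
  · rintro ⟨hne, hconn, h⟩
    refine ⟨⟨hconn, hne⟩, fun v hv => ?_⟩
    rw [preconnected_iff, spanningCoe_deleteVerts]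
    exact fun x hx y hy => h v x hx.1 y hy.1 hx.2 hy.2

theorem ConnectedNoCutVertex.sup {H K : G.Subgraph} (hH : ConnectedNoCutVertex H)
    (hK : ConnectedNoCutVertex K) {a b : V} (hab : a ≠ b) (ha : a ∈ H.verts) (hb : b ∈ H.verts)
    (ha' : a ∈ K.verts) (hb' : b ∈ K.verts) : ConnectedNoCutVertex (H ⊔ K) := by
  rw [connectedNoCutVertex_iff] at hH hK ⊢
  have hle : H.spanningCoe ≤ (H ⊔ K).spanningCoe := fun x y h => .inl h
  have hle' : K.spanningCoe ≤ (H ⊔ K).spanningCoe := fun x y h => .inr h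
  have hdel : ∀ {L M : SimpleGraph V} (v : V), L ≤ M → del L {v} ≤ del M {v} :=
    fun v h x y hxy => ⟨h hxy.1, hxy.2⟩
  refine ⟨⟨a, .inl ha⟩, ?_, ?_⟩
  · have h1 : ∀ x ∈ (H ⊔ K).verts, (H ⊔ K).spanningCoe.Reachable x a := by
      rintro x (hx | hx)
      · exact (hH.2.1 x hx a ha).mono hle
      · exact (hK.2.1 x hx a ha').mono hle'
    exact fun x hx y hy => (h1 x hx).trans (h1 y hy).symm
  · intro v
    have main : ∀ c, c ≠ v → c ∈ H.verts → c ∈ K.verts → ∀ x ∈ (H ⊔ K).verts,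
        ∀ y ∈ (H ⊔ K).verts, x ≠ v → y ≠ v → (del (H ⊔ K).spanningCoe {v}).Reachable x y := by
      intro c hcv hc hc'
      have h1 : ∀ x ∈ (H ⊔ K).verts, x ≠ v → (del (H ⊔ K).spanningCoe {v}).Reachable x c := by
        rintro x (hx | hx) hxv
        · exact (hH.2.2 v x hx c hc hxv hcv).mono (hdel v hle)
        · exact (hK.2.2 v x hx c hc' hxv hcv).mono (hdel v hle')
      exact fun x hx y hy hxv hyv => (h1 x hx hxv).trans (h1 y hy hyv).symm
    by_cases hav : a = v
    · exact main b (hav ▸ hab.symm) hb hb'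
    · exact main a hav ha ha'

theorem IsBlock.eq_of_two_common {H K : G.Subgraph} (hH : IsBlock H) (hK : IsBlock K) {a b : V}
    (hab : a ≠ b) (ha : a ∈ H.verts) (hb : b ∈ H.verts) (ha' : a ∈ K.verts) (hb' : b ∈ K.verts) :
    H = K := by
  have hs := hH.1.sup hK.1 hab ha hb ha' hb'
  exact (hH.eq_of_le hs le_sup_left).trans (hK.eq_of_le hs le_sup_right).symm

theorem ConnectedNoCutVertex.exists_block [Finite V] {H : G.Subgraph}
    (hH : ConnectedNoCutVertex H) : ∃ B, IsBlock B ∧ H ≤ B := by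
  obtain ⟨B, hHB, hB⟩ := Finite.exists_le_maximal hH
  exact ⟨B, hB, hHB⟩

theorem connectedNoCutVertex_edge {a b : V} (h : G.Adj a b) :
    ConnectedNoCutVertex (G.subgraphOfAdj h) := by
  rw [connectedNoCutVertex_iff]
  have hadj : (G.subgraphOfAdj h).spanningCoe.Adj a b := by
    simp [h.ne]
  refine ⟨⟨a, by simp⟩, ?_, ?_⟩
  · intro x hx y hy
    simp only [subgraphOfAdj_verts, Set.mem_insert_iff, Set.mem_singleton_iff] at hx hy
    rcases hx with rfl | rfl <;> rcases hy with rfl | rfl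
    exacts [.refl _, hadj.reachable, hadj.symm.reachable, .refl _]
  · intro v x hx y hy hxv hyv
    simp only [subgraphOfAdj_verts, Set.mem_insert_iff, Set.mem_singleton_iff] at hx hy
    have hr : ∀ a b, (G.subgraphOfAdj h).spanningCoe.Adj a b → a ≠ v → b ≠ v →
        (del (G.subgraphOfAdj h).spanningCoe {v}).Reachable a b :=
      fun a b hab ha hb => Adj.reachable (G := del _ _) ⟨hab, ha, hb⟩
    rcases hx with rfl | rfl <;> rcases hy with rfl | rfl
    exacts [.refl _, hr _ _ hadj hxv hyv, hr _ _ hadj.symm hxv hyv, .refl _]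

theorem connectedNoCutVertex_cycle {v : V} {c : G.Walk v v} (hc : c.IsCycle) :
    ConnectedNoCutVertex c.toSubgraph := by
  classical
  rw [connectedNoCutVertex_iff]
  have hpre := preconnected_iff.1 c.toSubgraph_connected.preconnected
  refine ⟨⟨v, by simp⟩, hpre, ?_⟩
  intro w x hx y hy hxw hyw
  have hadj : ∀ a b, s(a, b) ∈ c.edges → c.toSubgraph.spanningCoe.Adj a b := fun a b h =>
    (c.mem_edges_toSubgraph (e := s(a, b))).2 h
  rw [Walk.mem_verts_toSubgraph] at hx hy
  by_cases hw : w ∈ c.support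
  · have hcw := hc.rotate hw
    have hed : ∀ e, e ∈ (c.rotate _ hw).edges ↔ e ∈ c.edges := fun e =>
      (Walk.rotate_edges c _ hw).mem_iff
    have hsup : ∀ z, z ∈ c.support → z ∈ (c.rotate _ hw).support := by
      intro z hz
      rw [← Walk.mem_verts_toSubgraph] at hz ⊢
      rwa [Walk.toSubgraph_rotate]
    generalize c.rotate _ hw = d at hcw hed hsup
    cases d with
    | nil => exact (Walk.not_isCycle_nil hcw).elim
    | @cons _ z _ e p =>
      have hp := ((Walk.cons_isCycle_iff _ _).1 hcw).1
      -- the path that remains after deleting `w` from the cycle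
      have hreach : ∀ x, x ∈ c.support → x ≠ w →
          (del c.toSubgraph.spanningCoe {w}).Reachable z x := by
        intro x hx hxw
        have hxp : x ∈ p.support := by
          have := hsup x hx
          rw [Walk.support_cons, List.mem_cons] at this
          exact this.resolve_left hxw
        have hnot := Walk.endpoint_notMem_support_takeUntil hp hxp hxw.symm
        refine ⟨(p.takeUntil x hxp).transfer _ fun f hf => ?_⟩
        have hfc : f ∈ c.edges := by
          rw [← hed, Walk.edges_cons]
          exact List.mem_cons_of_mem _ (Walk.edges_takeUntil_subset_edges _ hxp hf)
        induction f with
        | h a b =>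
          refine ⟨hadj a b hfc, ?_, ?_⟩
          · rintro rfl; exact hnot (Walk.fst_mem_support_of_mem_edges _ hf)
          · rintro rfl; exact hnot (Walk.snd_mem_support_of_mem_edges _ hf)
      exact (hreach x hx hxw).symm.trans (hreach y hy hyw)
  · refine (hpre x (by simpa using hx) y (by simpa using hy)).mono fun a b hab => ⟨hab, ?_, ?_⟩
    · rintro rfl; exact hw (c.mem_verts_toSubgraph.1 <| c.toSubgraph.edge_vert hab)
    · rintro rfl
      exact hw (c.mem_verts_toSubgraph.1 <| c.toSubgraph.edge_vert (Subgraph.Adj.symm hab))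

theorem ncard_edgeSet_of_iso [Finite V] {B : G.Subgraph} {W : Type*} {F : SimpleGraph W}
    (φ : B.coe ≃g F) : B.edgeSet.ncard = F.edgeSet.ncard := by
  rw [← Subgraph.image_coe_edgeSet_coe,
    Set.ncard_image_of_injective _ (Sym2.map.injective Subtype.val_injective),
    ← Nat.card_coe_set_eq, ← Nat.card_coe_set_eq]
  exact Nat.card_congr φ.mapEdgeSet

/-- A cycle within a subgraph isomorphic to `F` gives a cycle of the same length in `F`. -/
theorem hasCycle_of_iso {B : G.Subgraph} {W : Type*} {F : SimpleGraph W} (φ : B.coe ≃g F) {v : V}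
    {c : G.Walk v v} (hc : c.IsCycle) (hcB : c.toSubgraph ≤ B) :
    ∃ (x y : W) (p : F.Walk x y), F.Adj y x ∧ p.IsPath ∧ p.length + 1 = c.length := by
  have main : ∀ {a b : V} (p : G.Walk a b), p.IsPath → p.toSubgraph ≤ B → ∀ (ha : a ∈ B.verts)
      (hb : b ∈ B.verts), ∃ q : F.Walk (φ ⟨a, ha⟩) (φ ⟨b, hb⟩), q.IsPath ∧ q.length = p.length ∧
      ∀ z ∈ q.support, ∃ w, ∃ hw : w ∈ B.verts, w ∈ p.support ∧ z = φ ⟨w, hw⟩ := by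
    intro a b p hp hpB ha hb
    induction p with
    | nil => exact ⟨Walk.nil, by simp, rfl, fun z hz => ⟨_, ha, by simp, by simpa using hz⟩⟩
    | @cons a z b e p ih =>
      rw [Walk.cons_isPath_iff] at hp
      have hpB' : p.toSubgraph ≤ B := le_trans (by simp [Walk.toSubgraph]) hpB
      have hz : z ∈ B.verts := hpB'.1 (by simp)
      have hadj : B.Adj a z := hpB.2 (by simp [Walk.toSubgraph])
      obtain ⟨q, hq, hql, hqs⟩ := ih hp.1 hpB' hz hb
      have hF : F.Adj (φ ⟨a, ha⟩) (φ ⟨z, hz⟩) := φ.map_rel_iff.2 hadj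
      refine ⟨Walk.cons hF q, ?_, by simp [hql], ?_⟩
      · rw [Walk.cons_isPath_iff]
        refine ⟨hq, fun h => ?_⟩
        obtain ⟨w, hw, hwp, hwe⟩ := hqs _ h
        have : a = w := by simpa using φ.injective hwe
        exact hp.2 (this ▸ hwp)
      · intro x hx
        rw [Walk.support_cons, List.mem_cons] at hx
        rcases hx with rfl | hx
        · exact ⟨a, ha, by simp, rfl⟩
        · obtain ⟨w, hw, hwp, hwe⟩ := hqs _ hx
          exact ⟨w, hw, by simp [hwp], hwe⟩
  cases c with
  | nil => exact (Walk.not_isCycle_nil hc).elim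
  | @cons _ y _ e p =>
    have hpB : p.toSubgraph ≤ B := le_trans (by simp [Walk.toSubgraph]) hcB
    have hadj : B.Adj v y := hcB.2 (by simp [Walk.toSubgraph])
    obtain ⟨q, hq, hql, -⟩ := main p ((Walk.cons_isCycle_iff _ _).1 hc).1 hpB
      (B.edge_vert hadj.symm) (B.edge_vert hadj)
    exact ⟨_, _, q, φ.map_rel_iff.2 hadj, hq, by simp [hql]⟩

end

/-! ### The Petersen graph -/

/-- The labels of the vertices of the Petersen graph used in `pmN`. -/
def petLabel : Fin 5 ⊕ Fin 5 → ℕ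
  | .inl i => i
  | .inr i => 5 + i

/-- Neighbour lists of the Petersen graph. -/
def petN (i : ℕ) : List ℕ := if i = 0 then [1, 4, 5] else if i = 5 then [0, 7, 8] else pmN i

theorem mem_petN_iff (x y : Fin 5 ⊕ Fin 5) :
    petersenGraph.Adj x y ↔ petLabel y ∈ petN (petLabel x) := by
  have h : petersenGraph.Adj x y ↔ x ≠ y ∧ (petersenRel x y ∨ petersenRel y x) := Iff.rfl
  rw [h]
  clear h
  rcases x with x | x <;> rcases y with y | y <;> simp only [petersenRel, petLabel] <;>
    revert x y <;> decide

theorem petLabel_lt (x : Fin 5 ⊕ Fin 5) : petLabel x < 10 := by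
  rcases x with x | x <;> simp only [petLabel] <;> omega

theorem petLabel_injective : Function.Injective petLabel := by
  rintro (x | x) (y | y) h <;> simp only [petLabel] at h
  · exact congrArg _ (Fin.ext h)
  · omega
  · omega
  · exact congrArg _ (Fin.ext (by omega))

/-- The depth first search finds every path. -/
theorem findPath_of_isPath {x y : Fin 5 ⊕ Fin 5} {p : petersenGraph.Walk x y} (hp : p.IsPath)
    (fuel : ℕ) (hfuel : p.length < fuel) (vis : List ℕ)
    (hvis : ∀ z ∈ p.support, z ≠ x → petLabel z ∉ vis) {r : ℕ} (hr : r < 3)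
    (hrp : p.length % 3 = r) : findPath petN (petLabel y) fuel vis (petLabel x) r = true := by
  induction p generalizing fuel vis r with
  | nil =>
    obtain ⟨fuel, rfl⟩ : ∃ k, fuel = k + 1 := ⟨fuel - 1, by simp at hfuel; omega⟩
    simp at hrp
    simp [findPath, ← hrp]
  | @cons x z y e p ih =>
    rw [Walk.cons_isPath_iff] at hp
    obtain ⟨fuel, rfl⟩ : ∃ k, fuel = k + 1 := ⟨fuel - 1, by omega⟩
    rw [Walk.length_cons] at hfuel hrp
    have hxy : (petLabel x == petLabel y) = false := by
      rw [beq_eq_false_iff_ne]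
      intro h
      exact hp.2 (petLabel_injective h ▸ Walk.end_mem_support p)
    rw [findPath, hxy, cond_false, List.any_eq_true]
    refine ⟨petLabel z, (mem_petN_iff x z).1 e, ?_⟩
    have hz : petLabel z ∉ vis := hvis z (by simp) e.ne'
    rw [Bool.and_eq_true]
    refine ⟨by simpa using hz, ih hp.1 fuel (by omega) _ ?_ (by omega) (by omega)⟩
    intro w hw hwz
    simp only [List.mem_cons, not_or]
    refine ⟨fun h => hwz (petLabel_injective h), hvis w (by simp [hw]) ?_⟩
    rintro rfl; exact hp.2 hw

theorem petN_no_path : ∀ i < 10, ∀ j ∈ petN i, findPath petN j 10 [i] i 0 = false := by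
  decide +kernel

/-- The Petersen graph has no `(1 mod 3)`-cycle. -/
theorem petersen_path_length {x y : Fin 5 ⊕ Fin 5} {p : petersenGraph.Walk x y} (hp : p.IsPath)
    (h : petersenGraph.Adj y x) : (p.length + 1) % 3 ≠ 1 := by
  intro hl
  have hlen : p.length < 10 := by simpa using hp.length_lt
  have h1 := findPath_of_isPath hp 10 hlen [petLabel x] (fun z _ hzx => by
    simpa using fun h => hzx (petLabel_injective h)) (r := 0) (by norm_num) (by omega)
  rw [petN_no_path _ (petLabel_lt x) _ ((mem_petN_iff x y).1 h.symm)] at h1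
  cases h1

theorem card_edges_petersen : petersenGraph.edgeSet.ncard = 15 := by
  classical
  have h : ∀ x, petersenGraph.degree x = 3 := by
    intro x
    rw [← card_neighborFinset_eq_degree]
    have : petersenGraph.neighborFinset x =
        Finset.univ.filter fun y => petLabel y ∈ petN (petLabel x) := by
      ext y; simp [mem_petN_iff]
    rw [this]
    clear this
    revert x; decide
  have := sum_degree_eq (G := petersenGraph)
  simp [h] at this
  omega

/-! ### Graphs whose blocks are Petersen graphs, triangles and edges -/

section
variable {V : Type u} {G : SimpleGraph V}

theorem card_edges_top (n : ℕ) :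
    (⊤ : SimpleGraph (Fin n)).edgeSet.ncard = n.choose 2 := by
  classical
  rw [Set.ncard_eq_toFinset_card', ← edgeFinset, card_edgeFinset_top_eq_card_choose_two,
    Fintype.card_fin]

theorem IsPetersenTriangleEdgeGraph.not_hasCycle [Finite V] {q t s : ℕ}
    (h : IsPetersenTriangleEdgeGraph G q t s) : ¬ HasCycleMod G 1 3 := by
  rintro ⟨v, c, hc, hl⟩
  replace hl : c.length % 3 = 1 := hl
  obtain ⟨B, hB, hcB⟩ := (connectedNoCutVertex_cycle hc).exists_block
  have hnt : B.verts.Nontrivial := by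
    cases c with
    | nil => exact (Walk.not_isCycle_nil hc).elim
    | @cons _ y _ e p => exact ⟨v, hcB.1 (by simp), y, hcB.1 (by simp), e.ne⟩
  have h3 := hc.three_le_length
  rcases h.block_cases B hB hnt with ⟨-, ⟨φ⟩⟩ | ⟨-, ⟨φ⟩⟩ | ⟨-, ⟨φ⟩⟩
  · obtain ⟨x, y, p, hxy, hp, hpl⟩ := hasCycle_of_iso φ hc hcB
    exact petersen_path_length hp hxy (by omega)
  · obtain ⟨x, y, p, hxy, hp, hpl⟩ := hasCycle_of_iso φ hc hcB
    have := hp.length_lt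
    simp at this; omega
  · obtain ⟨x, y, p, hxy, hp, hpl⟩ := hasCycle_of_iso φ hc hcB
    have := hp.length_lt
    simp at this; omega

theorem disjoint_blocksIso {W W' : Type*} [Fintype W] [Fintype W'] (F : SimpleGraph W)
    (F' : SimpleGraph W') (h : Fintype.card W ≠ Fintype.card W') :
    Disjoint (blocksIso G F) (blocksIso G F') := by
  rw [Set.disjoint_left]
  rintro B ⟨-, ⟨φ⟩⟩ ⟨-, ⟨ψ⟩⟩
  exact h (Fintype.card_congr (φ.symm.trans ψ).toEquiv)

theorem IsPetersenTriangleEdgeGraph.card_edges [Finite V] {q t s : ℕ}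
    (h : IsPetersenTriangleEdgeGraph G q t s) : G.edgeSet.ncard = 15 * q + 3 * t + s := by
  classical
  have := Fintype.ofFinite G.Subgraph
  have hcard : ∀ {W : Type} (F : SimpleGraph W) (k : ℕ), (blocksIso G F).encard = k →
      (blocksIso G F).toFinset.card = k := by
    intro W F k hk
    rw [← Set.ncard_eq_toFinset_card', Set.ncard, hk, ENat.toNat_natCast]
  have h1 := hcard _ _ h.card_petersen
  have h2 := hcard _ _ h.card_triangle
  have h3 := hcard _ _ h.card_edge
  have hd1 := disjoint_blocksIso (G := G) petersenGraph (⊤ : SimpleGraph (Fin 3)) (by simp)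
  have hd2 := disjoint_blocksIso (G := G) petersenGraph (⊤ : SimpleGraph (Fin 2)) (by simp)
  have hd3 := disjoint_blocksIso (G := G) (⊤ : SimpleGraph (Fin 3)) (⊤ : SimpleGraph (Fin 2))
    (by simp)
  have hfin : ∀ B : G.Subgraph, Fintype B.edgeSet := fun B => Fintype.ofFinite _
  let P := (blocksIso G petersenGraph).toFinset
  let T := (blocksIso G (⊤ : SimpleGraph (Fin 3))).toFinset
  let K := (blocksIso G (⊤ : SimpleGraph (Fin 2))).toFinset
  have hblock : ∀ B ∈ P ∪ (T ∪ K), IsBlock B := by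
    intro B hB
    simp only [P, T, K, Finset.mem_union, Set.mem_toFinset] at hB
    rcases hB with hB | hB | hB <;> exact hB.1
  have hunion : G.edgeSet =
      ((P ∪ (T ∪ K)).biUnion fun B => B.edgeSet.toFinset : Finset (Sym2 V)) := by
    ext e
    simp only [Finset.coe_biUnion, Finset.mem_coe, Set.mem_iUnion, Set.coe_toFinset]
    constructor
    · intro he
      induction e with
      | h a b =>
        have hab : G.Adj a b := he
        obtain ⟨B, hB, hle⟩ := (connectedNoCutVertex_edge hab).exists_block
        have hB' : B.Adj a b := hle.2 (by simp)
        refine ⟨B, ?_, hB'⟩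
        have hnt : B.verts.Nontrivial :=
          ⟨a, B.edge_vert hB', b, B.edge_vert hB'.symm, hab.ne⟩
        simpa [P, T, K] using h.block_cases B hB hnt
    · rintro ⟨B, -, he⟩
      exact B.edgeSet_subset he
  rw [hunion, Set.ncard_coe_finset, Finset.card_biUnion]
  · have hP : ∀ B ∈ P, B.edgeSet.toFinset.card = 15 := by
      intro B hB
      obtain ⟨-, ⟨φ⟩⟩ : B ∈ blocksIso G petersenGraph := by simpa [P] using hB
      rw [← Set.ncard_eq_toFinset_card', ncard_edgeSet_of_iso φ, card_edges_petersen]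
    have hT : ∀ B ∈ T, B.edgeSet.toFinset.card = 3 := by
      intro B hB
      obtain ⟨-, ⟨φ⟩⟩ : B ∈ blocksIso G (⊤ : SimpleGraph (Fin 3)) := by simpa [T] using hB
      rw [← Set.ncard_eq_toFinset_card', ncard_edgeSet_of_iso φ, card_edges_top]; rfl
    have hK : ∀ B ∈ K, B.edgeSet.toFinset.card = 1 := by
      intro B hB
      obtain ⟨-, ⟨φ⟩⟩ : B ∈ blocksIso G (⊤ : SimpleGraph (Fin 2)) := by simpa [K] using hB
      rw [← Set.ncard_eq_toFinset_card', ncard_edgeSet_of_iso φ, card_edges_top]; rfl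
    rw [Finset.sum_union, Finset.sum_union, Finset.sum_congr rfl hP, Finset.sum_congr rfl hT,
      Finset.sum_congr rfl hK]
    · simp only [Finset.sum_const, smul_eq_mul]
      rw [show P.card = q from h1, show T.card = t from h2, show K.card = s from h3]
      ring
    · simpa [T, K] using hd3
    · simpa [P, T, K] using ⟨hd1, hd2⟩
  · -- different blocks share no edge
    intro B hB B' hB' hne
    rw [Function.onFun, Finset.disjoint_left]
    intro e he he'
    rw [Set.mem_toFinset] at he he'
    induction e with
    | h a b =>
      exact hne ((hblock B hB).eq_of_two_common (hblock B' hB') (B.adj_sub he).ne (B.edge_vert he)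
        (B.edge_vert (Subgraph.Adj.symm he)) (B'.edge_vert he')
        (B'.edge_vert (Subgraph.Adj.symm he')))

end

/-! ### Graphs glued together at a common root -/

/-- `G` is the union of copies of the graphs `F i`, any two of which meet exactly in the
vertex `r`. -/
structure IsWindmill {V : Type u} (G : SimpleGraph V) (r : V) {I : Type*} {X : I → Type*}
    (F : ∀ i, SimpleGraph (X i)) (φ : ∀ i, F i ↪g G) : Prop where
  root : ∀ i, r ∈ Set.range (φ i)
  inter : ∀ i j, i ≠ j → ∀ x ∈ Set.range (φ i), x ∈ Set.range (φ j) → x = r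
  edge : ∀ x y, G.Adj x y → ∃ i, x ∈ Set.range (φ i) ∧ y ∈ Set.range (φ i)
  cover : ∀ x, x = r ∨ ∃ i, x ∈ Set.range (φ i)

/-- The graph `F` is connected, has at least two vertices, and has no cut-vertex. -/
structure TwoConnected {W : Type*} (F : SimpleGraph W) : Prop where
  nontrivial : Nontrivial W
  reachable : ∀ x y, F.Reachable x y
  del_reachable : ∀ v x y, x ≠ v → y ≠ v → (del F {v}).Reachable x y

section
variable {V : Type u} {G : SimpleGraph V} {r : V} {I : Type*} {X : I → Type*}
  {F : ∀ i, SimpleGraph (X i)} {φ : ∀ i, F i ↪g G}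

/-- The subgraph of `G` induced on a set `s`. -/
abbrev inducedOn (G : SimpleGraph V) (s : Set V) : G.Subgraph := (⊤ : G.Subgraph).induce s

theorem le_inducedOn {H : G.Subgraph} {s : Set V} : H ≤ inducedOn G s ↔ H.verts ⊆ s := by
  constructor
  · intro h; exact h.1
  · intro h
    exact ⟨h, fun x y hxy => ⟨h (H.edge_vert hxy), h (H.edge_vert hxy.symm), H.adj_sub hxy⟩⟩

/-- An embedded graph is isomorphic to the subgraph induced on its range. -/
theorem inducedOn_range_iso {W : Type*} {F : SimpleGraph W} (φ : F ↪g G) :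
    Nonempty ((inducedOn G (Set.range φ)).coe ≃g F) := by
  refine ⟨(RelIso.symm ⟨Equiv.ofInjective φ φ.injective, ?_⟩)⟩
  intro a b
  have h : (inducedOn G (Set.range φ)).Adj (φ a) (φ b) ↔ G.Adj (φ a) (φ b) :=
    ⟨fun h => h.2.2, fun h => ⟨⟨a, rfl⟩, ⟨b, rfl⟩, h⟩⟩
  exact h.trans φ.map_rel_iff

theorem TwoConnected.connectedNoCutVertex {W : Type*} {F : SimpleGraph W} (hF : TwoConnected F)
    (φ : F ↪g G) : ConnectedNoCutVertex (inducedOn G (Set.range φ)) := by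
  have hadj : ∀ a b, F.Adj a b → (inducedOn G (Set.range φ)).spanningCoe.Adj (φ a) (φ b) :=
    fun a b h => ⟨⟨a, rfl⟩, ⟨b, rfl⟩, φ.map_rel_iff.2 h⟩
  rw [connectedNoCutVertex_iff]
  have := hF.nontrivial
  refine ⟨⟨φ (Classical.arbitrary W), ⟨_, rfl⟩⟩, ?_, ?_⟩
  · rintro _ ⟨x, rfl⟩ _ ⟨y, rfl⟩
    exact (hF.reachable x y).map
      (⟨φ, fun h => hadj _ _ h⟩ : F →g (inducedOn G (Set.range φ)).spanningCoe)
  · rintro v _ ⟨x, rfl⟩ _ ⟨y, rfl⟩ hx hy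
    by_cases hv : ∃ w, φ w = v
    · obtain ⟨w, rfl⟩ := hv
      refine (hF.del_reachable w x y (fun e => hx (e ▸ rfl)) (fun e => hy (e ▸ rfl))).map
        (⟨φ, fun h => ⟨hadj _ _ h.1, fun e => h.2.1 (φ.injective e),
          fun e => h.2.2 (φ.injective e)⟩⟩ :
            del F {w} →g del (inducedOn G (Set.range φ)).spanningCoe {φ w})
    · refine (hF.reachable x y).map
        (⟨φ, fun h => ⟨hadj _ _ h, fun e => hv ⟨_, e⟩, fun e => hv ⟨_, e⟩⟩⟩ :
          F →g del (inducedOn G (Set.range φ)).spanningCoe {v})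

theorem IsWindmill.connected (h : IsWindmill G r F φ) (hF : ∀ i, TwoConnected (F i)) :
    G.Connected := by
  have h1 : ∀ x, G.Reachable x r := by
    intro x
    rcases h.cover x with rfl | ⟨i, a, rfl⟩
    · exact .refl _
    · obtain ⟨b, hb⟩ := h.root i
      rw [← hb]
      exact ((hF i).reachable a b).map (φ i).toHom
  exact { preconnected := fun x y => (h1 x).trans (h1 y).symm, nonempty := ⟨r⟩ }

theorem IsWindmill.range_inj (h : IsWindmill G r F φ) (hF : ∀ i, TwoConnected (F i)) {i j : I}
    (hij : Set.range (φ i) ⊆ Set.range (φ j)) : i = j := by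
  by_contra hne
  have := (hF i).nontrivial
  obtain ⟨a, b, hab⟩ := exists_pair_ne (X i)
  exact hab ((φ i).injective ((h.inter i j hne _ ⟨a, rfl⟩ (hij ⟨a, rfl⟩)).trans
    (h.inter i j hne _ ⟨b, rfl⟩ (hij ⟨b, rfl⟩)).symm))

/-- A connected subgraph without a cut-vertex remains connected when the root is deleted, so it
lies in one of the parts. -/
theorem IsWindmill.exists_le [Nonempty I] (h : IsWindmill G r F φ) {H : G.Subgraph}
    (hH : ConnectedNoCutVertex H) : ∃ i, H ≤ inducedOn G (Set.range (φ i)) := by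
  rw [connectedNoCutVertex_iff] at hH
  by_cases hex : ∃ x ∈ H.verts, x ≠ r
  · obtain ⟨x, hx, hxr⟩ := hex
    obtain ⟨i, hi⟩ := (h.cover x).resolve_left hxr
    refine ⟨i, le_inducedOn.2 fun y hy => ?_⟩
    by_cases hyr : y = r
    · exact hyr ▸ h.root i
    · obtain ⟨p⟩ := hH.2.2 r x hx y hy hxr hyr
      clear hx hxr hy hyr
      induction p with
      | nil => exact hi
      | @cons a b c e p ih =>
        obtain ⟨j, hj1, hj2⟩ := h.edge _ _ (H.adj_sub e.1)
        refine ih ?_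
        by_cases hij : i = j
        · rwa [hij]
        · exact absurd (h.inter i j hij _ hi hj1) e.2.1
  · push Not at hex
    obtain ⟨i⟩ := ‹Nonempty I›
    exact ⟨i, le_inducedOn.2 fun x hx => hex x hx ▸ h.root i⟩

theorem IsWindmill.isBlock_iff [Nonempty I] (h : IsWindmill G r F φ)
    (hF : ∀ i, TwoConnected (F i)) {B : G.Subgraph} :
    IsBlock B ↔ ∃ i, B = inducedOn G (Set.range (φ i)) := by
  constructor
  · intro hB
    obtain ⟨i, hi⟩ := h.exists_le hB.1
    exact ⟨i, hB.eq_of_le ((hF i).connectedNoCutVertex (φ i)) hi⟩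
  · rintro ⟨i, rfl⟩
    refine ⟨(hF i).connectedNoCutVertex (φ i), fun H hH hle => ?_⟩
    obtain ⟨j, hj⟩ := h.exists_le hH
    have := h.range_inj hF (hle.trans hj).1
    rwa [this]

theorem IsWindmill.encard_blocksIso (h : IsWindmill G r F φ) (hF : ∀ i, TwoConnected (F i))
    {W : Type*} [Nontrivial W] (K : SimpleGraph W) :
    (blocksIso G K).encard = {i | Nonempty (F i ≃g K)}.encard := by
  rcases isEmpty_or_nonempty I with hI | hI
  · have h1 : {i | Nonempty (F i ≃g K)} = ∅ := Set.eq_empty_of_isEmpty _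
    have h2 : blocksIso G K = ∅ := by
      rw [Set.eq_empty_iff_forall_notMem]
      rintro B ⟨-, ⟨ψ⟩⟩
      obtain ⟨a, b, hab⟩ := exists_pair_ne W
      have hr : ∀ x : V, x = r := fun x => (h.cover x).resolve_right fun ⟨i, _⟩ => hI.elim i
      exact hab (ψ.symm.injective (Subtype.ext ((hr _).trans (hr _).symm)))
    rw [h1, h2]
    simp
  · have h1 : blocksIso G K =
        (fun i => inducedOn G (Set.range (φ i))) '' {i | Nonempty (F i ≃g K)} := by
      ext B
      simp only [blocksIso, Set.mem_ofPred_eq, h.isBlock_iff hF, Set.mem_image]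
      constructor
      · rintro ⟨⟨i, rfl⟩, ⟨ψ⟩⟩
        obtain ⟨χ⟩ := inducedOn_range_iso (φ i)
        exact ⟨i, ⟨χ.symm.trans ψ⟩, rfl⟩
      · rintro ⟨i, ⟨ψ⟩, rfl⟩
        obtain ⟨χ⟩ := inducedOn_range_iso (φ i)
        exact ⟨⟨i, rfl⟩, ⟨χ.trans ψ⟩⟩
    rw [h1, Function.Injective.encard_image]
    intro i j hij
    exact h.range_inj hF (le_of_eq hij : inducedOn G _ ≤ inducedOn G _).1

end

/-! ### The parts of the extremal graphs -/

theorem twoConnected_top {n : ℕ} (hn : 2 ≤ n) : TwoConnected (⊤ : SimpleGraph (Fin n)) where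
  nontrivial := Fin.nontrivial_iff_two_le.2 hn
  reachable x y := by
    by_cases h : x = y
    · exact h ▸ .refl _
    · exact Adj.reachable h
  del_reachable v x y hx hy := by
    by_cases h : x = y
    · exact h ▸ .refl _
    · exact Adj.reachable (G := del _ _) ⟨h, hx, hy⟩

theorem petN_path : ∀ v < 10, ∀ i < 10, ∀ j < 10, (i == v || j == v ||
    findPath petN j 10 [i, v] i 0 || findPath petN j 10 [i, v] i 1 ||
    findPath petN j 10 [i, v] i 2) = true := by
  decide +kernel

/-- The inverse of `petLabel`. -/
def petVertex (i : ℕ) : Fin 5 ⊕ Fin 5 :=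
  if i < 5 then .inl (Fin.ofNat 5 i) else .inr (Fin.ofNat 5 (i - 5))

theorem petLabel_petVertex : ∀ i < 10, petLabel (petVertex i) = i := by decide

theorem petVertex_petLabel (x : Fin 5 ⊕ Fin 5) : petVertex (petLabel x) = x :=
  petLabel_injective (petLabel_petVertex _ (petLabel_lt x))

theorem petN_lt : ∀ i < 10, ∀ j ∈ petN i, j < 10 := by decide

theorem petersen_isCopy : IsCopy petN 10 petersenGraph petVertex where
  inj i hi j hj h := by rw [← petLabel_petVertex i hi, h, petLabel_petVertex j hj]
  adj i hi j hj := by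
    rw [mem_petN_iff, petLabel_petVertex i hi, petLabel_petVertex j (petN_lt i hi j hj)]
    exact hj

instance petersen_nontrivial : Nontrivial (Fin 5 ⊕ Fin 5) := ⟨⟨.inl 0, .inr 0, by simp⟩⟩

theorem twoConnected_petersen : TwoConnected petersenGraph := by
  have hdel : ∀ v x y, x ≠ v → y ≠ v → (del petersenGraph {v}).Reachable x y := by
    intro v x y hx hy
    have ht := petN_path _ (petLabel_lt v) _ (petLabel_lt x) _ (petLabel_lt y)
    simp only [Bool.or_eq_true, beq_iff_eq, petLabel_injective.eq_iff, hx, hy, false_or] at ht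
    obtain ⟨r, hr⟩ : ∃ r, findPath petN (petLabel y) 10 [petLabel x, petLabel v] (petLabel x) r =
        true := by
      rcases ht with (h | h) | h
      exacts [⟨_, h⟩, ⟨_, h⟩, ⟨_, h⟩]
    obtain ⟨l, -, p, -, -, hs⟩ := PathThrough.of_findPath petersen_isCopy petN_lt (petLabel_lt y)
      10 _ _ _ (petLabel_lt x) (by simp) hr
    have hv : v ∉ p.support := by
      intro hmem
      rcases hs v hmem with h | h | ⟨c, hc, hcv, h⟩
      · rw [petVertex_petLabel] at h; exact hx h.symm
      · rw [petVertex_petLabel] at h; exact hy h.symm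
      · refine hcv ?_
        rw [h, petLabel_petVertex c hc]; simp
    have hreach : (del petersenGraph {v}).Reachable (petVertex (petLabel x))
        (petVertex (petLabel y)) := by
      refine ⟨p.transfer _ fun e he => ?_⟩
      induction e with
      | h a b =>
        refine ⟨p.edges_subset_edgeSet he, ?_, ?_⟩
        · rintro rfl; exact hv (Walk.fst_mem_support_of_mem_edges _ he)
        · rintro rfl; exact hv (Walk.snd_mem_support_of_mem_edges _ he)
    rwa [petVertex_petLabel, petVertex_petLabel] at hreach
  refine ⟨inferInstance, fun x y => ?_, hdel⟩
  obtain ⟨v, hvx, hvy⟩ : ∃ v : Fin 5 ⊕ Fin 5, x ≠ v ∧ y ≠ v := by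
    revert x y; decide
  exact (hdel v x y hvx hvy).mono (del_le _ _)

/-! ### Construction of the extremal graphs -/

section
variable {I : Type*} {X : I → Type*} [∀ i, DecidableEq (X i)]
  (F : ∀ i, SimpleGraph (X i)) (root : ∀ i, X i)

/-- The inclusion of the `i`-th part into the disjoint union of all parts with the roots
identified. -/
def windmillIncl (i : I) (x : X i) : Option (Σ i, {x : X i // x ≠ root i}) :=
  if h : x = root i then none else some ⟨i, x, h⟩

theorem windmillIncl_injective (i : I) : Function.Injective (windmillIncl root i) := by
  intro x y h
  unfold windmillIncl at h
  split_ifs at h with h1 h2 h2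
  · rw [h1, h2]
  · simpa using h

theorem windmillIncl_eq {i j : I} (hij : i ≠ j) {x : X i} {y : X j}
    (h : windmillIncl root i x = windmillIncl root j y) : windmillIncl root i x = none := by
  unfold windmillIncl at h ⊢
  split_ifs at h ⊢ with h1 h2 h2
  · rfl
  · simp only [Option.some.injEq, Sigma.mk.injEq] at h
    exact absurd h.1 hij

/-- The union of the graphs `F i` with their roots identified. -/
def windmillGraph : SimpleGraph (Option (Σ i, {x : X i // x ≠ root i})) where
  Adj u v := ∃ i a b, windmillIncl root i a = u ∧ windmillIncl root i b = v ∧ (F i).Adj a b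
  symm := ⟨fun _ _ ⟨i, a, b, ha, hb, h⟩ => ⟨i, b, a, hb, ha, h.symm⟩⟩
  loopless := ⟨fun _ ⟨i, _, _, ha, hb, h⟩ =>
    h.ne (windmillIncl_injective root i (ha.trans hb.symm))⟩

theorem windmillGraph_adj {i : I} {a b : X i} :
    (windmillGraph F root).Adj (windmillIncl root i a) (windmillIncl root i b) ↔
      (F i).Adj a b := by
  constructor
  · rintro ⟨j, a', b', ha, hb, h⟩
    by_cases hij : j = i
    · subst hij
      rwa [← windmillIncl_injective root _ ha, ← windmillIncl_injective root _ hb]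
    · exact absurd (windmillIncl_injective root _ ((windmillIncl_eq root hij ha).trans
        (windmillIncl_eq root hij hb).symm)) h.ne
  · intro h
    exact ⟨i, a, b, rfl, rfl, h⟩

theorem exists_isWindmill {V : Type u} (e : V ≃ Option (Σ i, {x : X i // x ≠ root i})) :
    ∃ (G : SimpleGraph V) (r : V) (φ : ∀ i, F i ↪g G), IsWindmill G r F φ := by
  have hnone : ∀ i, windmillIncl root i (root i) = none := fun i => by simp [windmillIncl]
  refine ⟨(windmillGraph F root).comap e, e.symm none, fun i =>
    ⟨⟨fun x => e.symm (windmillIncl root i x), fun x y h =>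
      windmillIncl_injective root i (e.symm.injective h)⟩, ?_⟩, ?_⟩
  · intro a b
    change (windmillGraph F root).Adj (e (e.symm _)) (e (e.symm _)) ↔ _
    rw [e.apply_symm_apply, e.apply_symm_apply]
    exact windmillGraph_adj F root
  · refine ⟨fun i => ⟨root i, ?_⟩, ?_, ?_, ?_⟩
    · change e.symm _ = _
      rw [hnone]
    · rintro i j hij _ ⟨a, rfl⟩ ⟨b, hb⟩
      change e.symm _ = e.symm _ at hb
      change e.symm _ = e.symm _
      rw [windmillIncl_eq root hij (e.symm.injective hb.symm)]
    · rintro x y ⟨i, a, b, ha, hb, -⟩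
      refine ⟨i, ⟨a, ?_⟩, ⟨b, ?_⟩⟩
      · change e.symm _ = _
        rw [ha, e.symm_apply_apply]
      · change e.symm _ = _
        rw [hb, e.symm_apply_apply]
    · intro x
      rcases hx : e x with _ | ⟨i, a, ha⟩
      · left; rw [← hx, e.symm_apply_apply]
      · right
        refine ⟨i, a, ?_⟩
        change e.symm (windmillIncl root i a) = x
        rw [windmillIncl, dif_neg ha, ← hx, e.symm_apply_apply]

end

/-- The vertex types of the parts of an extremal graph. -/
abbrev Part (q t s : ℕ) : Fin q ⊕ Fin t ⊕ Fin s → Type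
  | .inl _ => Fin 5 ⊕ Fin 5
  | .inr (.inl _) => Fin 3
  | .inr (.inr _) => Fin 2

/-- The parts of an extremal graph: `q` Petersen graphs, `t` triangles and `s` edges. -/
def partGraph (q t s : ℕ) : ∀ i, SimpleGraph (Part q t s i)
  | .inl _ => petersenGraph
  | .inr (.inl _) => ⊤
  | .inr (.inr _) => ⊤

/-- The roots at which the parts are glued. -/
def partRoot (q t s : ℕ) : ∀ i, Part q t s i
  | .inl _ => .inl 0
  | .inr (.inl _) => (0 : Fin 3)
  | .inr (.inr _) => (0 : Fin 2)

instance instFintypePart (q t s : ℕ) (i) : Fintype (Part q t s i) := by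
  rcases i with i | i | i <;> unfold Part <;> infer_instance

instance instDecidableEqPart (q t s : ℕ) (i) : DecidableEq (Part q t s i) := by
  rcases i with i | i | i <;> unfold Part <;> infer_instance

theorem twoConnected_part (q t s : ℕ) (i) : TwoConnected (partGraph q t s i) := by
  rcases i with i | i | i
  · exact twoConnected_petersen
  · exact twoConnected_top (n := 3) (by norm_num)
  · exact twoConnected_top (n := 2) (by norm_num)

theorem card_windmill (q t s : ℕ) :
    Fintype.card (Option (Σ i, {x : Part q t s i // x ≠ partRoot q t s i})) =
      9 * q + (2 * t + s) + 1 := by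
  rw [Fintype.card_option, Fintype.card_sigma, Fintype.sum_sum_type, Fintype.sum_sum_type]
  have h1 : ∀ i : Fin q,
      Fintype.card {x : Part q t s (.inl i) // x ≠ partRoot q t s (.inl i)} = 9 :=
    fun i => (Fintype.card_subtype_compl _).trans (by simp)
  have h2 : ∀ i : Fin t, Fintype.card {x : Part q t s (.inr (.inl i)) //
      x ≠ partRoot q t s (.inr (.inl i))} = 2 := 
    fun i => (Fintype.card_subtype_compl _).trans (by simp)
  have h3 : ∀ i : Fin s, Fintype.card {x : Part q t s (.inr (.inr i)) //
      x ≠ partRoot q t s (.inr (.inr i))} = 1 :=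
    fun i => (Fintype.card_subtype_compl _).trans (by simp)
  simp only [h1, h2, h3, Finset.sum_const, Finset.card_univ, Fintype.card_fin, smul_eq_mul]
  ring

theorem exists_petersenTriangleEdgeGraph {q t s n : ℕ} (hn : n = 9 * q + (2 * t + s) + 1) :
    ∃ G : SimpleGraph (Fin n), IsPetersenTriangleEdgeGraph G q t s := by
  obtain ⟨e⟩ : Nonempty (Fin n ≃ Option (Σ i, {x : Part q t s i // x ≠ partRoot q t s i})) :=
    Fintype.card_eq.1 (by rw [card_windmill, Fintype.card_fin, hn])
  obtain ⟨G, r, φ, h⟩ := exists_isWindmill (partGraph q t s) (partRoot q t s) e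
  have hF := twoConnected_part q t s
  have hcard : ∀ {W : Type} [Fintype W] (K : SimpleGraph W) (i),
      Nonempty (partGraph q t s i ≃g K) → Fintype.card (Part q t s i) = Fintype.card W :=
    fun K i ⟨ψ⟩ => Fintype.card_congr ψ.toEquiv
  refine ⟨G, h.connected hF, fun B hB hnt => ?_, ?_, ?_, ?_⟩
  · have hI : Nonempty (Fin q ⊕ Fin t ⊕ Fin s) := by
      by_contra hI
      rw [not_nonempty_iff] at hI
      obtain ⟨a, -, b, -, hab⟩ := hnt
      have hr : ∀ x, x = r := fun x => (h.cover x).resolve_right fun ⟨i, _⟩ => hI.elim i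
      exact hab ((hr a).trans (hr b).symm)
    obtain ⟨i, rfl⟩ := (h.isBlock_iff hF).1 hB
    obtain ⟨χ⟩ := inducedOn_range_iso (φ i)
    rcases i with i | i | i
    · exact .inl ⟨hB, ⟨χ⟩⟩
    · exact .inr (.inl ⟨hB, ⟨χ⟩⟩)
    · exact .inr (.inr ⟨hB, ⟨χ⟩⟩)
  · have : {i | Nonempty (partGraph q t s i ≃g petersenGraph)} = Set.range Sum.inl := by
      ext i
      refine ⟨fun hi => ?_, ?_⟩
      · have := hcard _ i hi
        rcases i with i | i | i
        · exact ⟨i, rfl⟩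
        · simp [Part] at this
        · simp [Part] at this
      · rintro ⟨i, rfl⟩; exact ⟨RelIso.refl _⟩
    rw [h.encard_blocksIso hF, this, ← Set.image_univ, Sum.inl_injective.encard_image]
    simp
  · have : {i | Nonempty (partGraph q t s i ≃g (⊤ : SimpleGraph (Fin 3)))} =
        Set.range (Sum.inr ∘ Sum.inl) := by
      ext i
      refine ⟨fun hi => ?_, ?_⟩
      · have := hcard _ i hi
        rcases i with i | i | i
        · simp [Part] at this
        · exact ⟨i, rfl⟩
        · simp [Part] at this
      · rintro ⟨i, rfl⟩; exact ⟨RelIso.refl _⟩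
    rw [h.encard_blocksIso hF, this, ← Set.image_univ,
      (Sum.inr_injective.comp Sum.inl_injective).encard_image]
    simp
  · have : {i | Nonempty (partGraph q t s i ≃g (⊤ : SimpleGraph (Fin 2)))} =
        Set.range (Sum.inr ∘ Sum.inr) := by
      ext i
      refine ⟨fun hi => ?_, ?_⟩
      · have := hcard _ i hi
        rcases i with i | i | i
        · simp [Part] at this
        · simp [Part] at this
        · exact ⟨i, rfl⟩
      · rintro ⟨i, rfl⟩; exact ⟨RelIso.refl _⟩
    rw [h.encard_blocksIso hF, this, ← Set.image_univ,
      (Sum.inr_injective.comp Sum.inr_injective).encard_image]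
    simp

/-! ### The extremal number and the density constant -/

/-- The extremal graph on `9 * q + r + 1` vertices with as many triangles as possible. -/
theorem exists_extremal (n q r : ℕ) (hn : n = 9 * q + r + 1) :
    ∃ G : SimpleGraph (Fin n), ¬ HasCycleMod G 1 3 ∧ G.edgeSet.ncard = 15 * q + 3 * r / 2 := by
  obtain ⟨G, hG⟩ := exists_petersenTriangleEdgeGraph
    (q := q) (t := r / 2) (s := r % 2) (n := n) (by omega)
  exact ⟨G, hG.not_hasCycle, by rw [hG.card_edges]; omega⟩

theorem isGreatest_edgeCountsAvoiding {n q r : ℕ} (hr : r ≤ 8) (hn : n = 9 * q + r + 1) :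
    IsGreatest (edgeCountsAvoiding n 1 3) (15 * q + 3 * r / 2) := by
  refine ⟨exists_extremal n q r hn, ?_⟩
  rintro _ ⟨G, hG, rfl⟩
  exact card_edges_le hG hr (by rw [Nat.card_eq_fintype_card, Fintype.card_fin, hn])

theorem isLeast_forcingConstants : IsLeast (forcingConstants 1 3) (5 / 3 : ℝ) := by
  constructor
  · intro n hn G hc
    by_contra hG
    have h := card_edges_le (q := (n - 1) / 9) (r := (n - 1) % 9) hG (by omega)
      (by rw [Nat.card_eq_fintype_card, Fintype.card_fin]; omega)
    -- `15 * q + 3 * r / 2 ≤ 5 * (n - 1) / 3`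
    have h' : 3 * G.edgeSet.ncard < 5 * n := by omega
    have h'' : (3 * G.edgeSet.ncard : ℝ) < 5 * n := by exact_mod_cast h'
    linarith
  · intro c hc
    by_contra! hlt
    obtain ⟨q, hq⟩ := exists_nat_ge (c / (15 - 9 * c))
    obtain ⟨G, hG, he⟩ := exists_extremal (9 * q + 0 + 1) q 0 rfl
    -- for `c < 5 / 3` a large number `q` of Petersen blocks has `c * (9 * q + 1) ≤ 15 * q`
    refine hG (hc _ (by omega) G ?_)
    rw [he]
    rw [div_le_iff₀ (by linarith)] at hq
    push_cast
    linarith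

end CycleMod

theorem theorem2 :
    -- the upper bound: too many edges force a `(1 mod 3)`-cycle
    (∀ (V : Type*) [Fintype V] (G : SimpleGraph V) (q r : ℕ),
      r ≤ 8 → Fintype.card V = 9 * q + r + 1 →
      15 * q + 3 * r / 2 < G.edgeSet.ncard → CycleMod.HasCycleMod G 1 3) ∧
    -- sharpness: with `r = 2 * t + s`, connected `n`-vertex graphs consisting of `q` Petersen
    -- blocks, `t` triangles and `s ≤ 1` copies of `K₂` exist, and all of them attain the bound
    (∀ q r t s : ℕ, r ≤ 8 → r = 2 * t + s → s ≤ 1 →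
      (∃ G : SimpleGraph (Fin (9 * q + r + 1)), CycleMod.IsPetersenTriangleEdgeGraph G q t s) ∧
      (∀ (V : Type*) [Fintype V] (G : SimpleGraph V), Fintype.card V = 9 * q + r + 1 →
        CycleMod.IsPetersenTriangleEdgeGraph G q t s →
        ¬ CycleMod.HasCycleMod G 1 3 ∧ G.edgeSet.ncard = 15 * q + 3 * r / 2)) ∧
    -- the extremal number
    (∀ n q r : ℕ, r ≤ 8 → n = 9 * q + r + 1 →
      IsGreatest (CycleMod.edgeCountsAvoiding n 1 3) (15 * q + 3 * r / 2)) ∧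
    -- the constant `c_{1,3}`
    IsLeast (CycleMod.forcingConstants 1 3) (5 / 3 : ℝ) := by
  refine ⟨fun V _ G q r hr hV hlt => ?_, fun q r t s _ hts hs => ⟨?_, fun V _ G _ hG => ?_⟩,
    fun n q r hr hn => CycleMod.isGreatest_edgeCountsAvoiding hr hn,
    CycleMod.isLeast_forcingConstants⟩
  · by_contra hG
    exact hlt.not_ge (CycleMod.card_edges_le hG hr (by rw [Nat.card_eq_fintype_card, hV]))
  · exact CycleMod.exists_petersenTriangleEdgeGraph (by rw [hts])
  · exact ⟨hG.not_hasCycle, by rw [hG.card_edges]; omega⟩
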